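/- Let $X$ be a smooth manifold of real dimension $4$ with a smooth almost complex structure $J$, let $M\subset X$, and let $S\subset\partial M$ be a smoothly embedded two-sphere. A point $p\in S$ is called a *hyperbolic point* if there are local $J$-holomorphic coordinates $(z,w)\in\mathbb C^2$ centred at $p$ (so $J$ is integrable near $p$) in which $S=\{w=|z|^2+\gamma\,\mathrm{Re}\,z^2+o(|z|^2)\}$ with $\gamma>1$. It is called *good* if, moreover, near $p$ one has $M=\{\rho\le 0\}$ with a strictly Levi convex hypersurface $\{\rho=0\}$, the coordinates can be chosen so that $$S=\{w=\psi(z)\},\qquad \psi(z)=|z|^2+\gamma\,\mathrm{Re}\,z^2,\quad \gamma>1,$$ near the origin, and the antiholomorphic involutions of $\mathbb C^2$ $$\tau_1(z,w)=(\bar w,\bar z),\qquad \tau_2(z,w)=\overline{\left(-\tfrac{2}{\gamma}z-w,\ \left(\tfrac{4}{\gamma^2}-1\right)z+\tfrac{2}{\gamma}w\right)}$$ generate a finite dihedral group. Let $D^{+}$ and $D^-$ be the connected components of $\{z\in\mathbb C: |z|^2+\gamma\,\mathrm{Re}\,z^2<0\}$ lying in $\{\mathrm{Im}\,z>0\}$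 and $\{\mathrm{Im}\,z<0\}$, respectively. A *hyperbolic disc* is a map $f:\overline{\mathbb D}\to M$, continuous on $\overline{\mathbb D}$ and $J$-holomorphic in $\mathbb D$, with $f(\partial\mathbb D)\subset S$, such that $f$ maps finitely many points of $\partial\mathbb D$ to hyperbolic points of $S$ and all other points of $\partial\mathbb D$ to totally real points of $S$. **Lemma.** Let $p$ be a good hyperbolic point, with coordinates $(z,w)$ and parameter $\gamma$ as above, and let $f$ be a hyperbolic disc. Then every $\zeta_0\in\partial\mathbb D$ with $f(\zeta_0)=p$ has a neighbourhood $V_{\zeta_0}$ such that, in the coordinates $(z,w)$, $f(V_{\zeta_0}\cap\mathbb D)$ is the graph $\{w=g(z)\}$ of a function $g$ holomorphic on a domain $D\subset\mathbb C$ with $0\in\partial D$, and: 1. $g$ has on $D$ a convergent Puiseux expansion $g(z)=\sum_{k>2m}g_k z^{k/m}$ for some integer $m\ge 1$ (with a holomorphic branch of $z^{1/m}$ on $D$); 2. $D$ is asymptotic at $0$ to $D^+$ or to $D^-$: near $0$ it is the region between two curves $r\mapsto re^{i\theta_j(r)}$ ($j=1,2$, $\theta_j$ continuous on $[0,\delta)$)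 which form $\partial D$ near $0$ and are tangent at $0$ to the two boundary rays of $D^+$ (respectively of $D^-$); 3. $g\in C^2(\overline D)$ and $g(0)=g'(0)=g''(0)=0$. Moreover, $p$ has a neighbourhood $N$ such that every $\zeta\in\mathbb D$ with $f(\zeta)\in N$ lies in one of the sets $V_{\zeta_0}$ with $\zeta_0\in\partial\mathbb D$, $f(\zeta_0)=p$. In particular, if $f(\zeta_0)=p$ for exactly one $\zeta_0\in\partial\mathbb D$, then near $p$ the set $f(\mathbb D)$ is the graph of $g$ over $D$, so $f$ has a good (admissible) approach at $p$. -/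

import Mathlib

open Set Filter Topology Metric Manifold ContDiff Bundle Asymptotics

noncomputable section

/-! ### Almost complex manifolds of complex dimension two -/

/-- A smooth almost complex structure on a smooth manifold `X` of real dimension four (modelled on
`ℂ × ℂ`, regarded as a real vector space). -/
structure AlmostComplexStructure (X : Type*) [TopologicalSpace X] [ChartedSpace (ℂ × ℂ) X]
    [IsManifold 𝓘(ℝ, ℂ × ℂ) ∞ X] where
  /-- the endomorphism of the tangent space at `x` -/
  toFun : ∀ x : X, TangentSpace 𝓘(ℝ, ℂ × ℂ) x →L[ℝ] TangentSpace 𝓘(ℝ, ℂ × ℂ) x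
  sq_eq_neg : ∀ (x : X) (v : TangentSpace 𝓘(ℝ, ℂ × ℂ) x), toFun x (toFun x v) = -v
  smooth : ContMDiff 𝓘(ℝ, ℂ × ℂ) (𝓘(ℝ, ℂ × ℂ).prod 𝓘(ℝ, (ℂ × ℂ) →L[ℝ] (ℂ × ℂ))) ∞
    (fun x => TotalSpace.mk' ((ℂ × ℂ) →L[ℝ] (ℂ × ℂ))
      (E := fun x : X => TangentSpace 𝓘(ℝ, ℂ × ℂ) x →L[ℝ] TangentSpace 𝓘(ℝ, ℂ × ℂ) x) x (toFun x))

/-- The standard two-sphere, as a smooth manifold. -/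
abbrev TwoSphere : Type := sphere (0 : EuclideanSpace ℝ (Fin (2 + 1))) 1

section Manifold

variable {X : Type*} [TopologicalSpace X] [ChartedSpace (ℂ × ℂ) X]
  [IsManifold 𝓘(ℝ, ℂ × ℂ) ∞ X]

/-- The differential at `x` of coordinates `Φ` with values in `ℂ²`. -/
def coordDeriv (Φ : X → ℂ × ℂ) (x : X) : TangentSpace 𝓘(ℝ, ℂ × ℂ) x →L[ℝ] ℂ × ℂ :=
  mfderiv 𝓘(ℝ, ℂ × ℂ) 𝓘(ℝ, ℂ × ℂ) Φ x

/-- `Φ` is a system of local holomorphic coordinates `(z, w)` centred at `p`: a smooth chart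
with `Φ p = 0` which carries `J` to the standard complex structure on the whole domain
of `Φ`. In particular `J` is integrable near `p`. -/
structure IsHolomorphicChartAt (J : AlmostComplexStructure X) (p : X)
    (Φ : OpenPartialHomeomorph X (ℂ × ℂ)) : Prop where
  mem_atlas : Φ ∈ IsManifold.maximalAtlas 𝓘(ℝ, ℂ × ℂ) ∞ X
  mem_source : p ∈ Φ.source
  map_eq_zero : Φ p = 0
  map_J : ∀ x ∈ Φ.source, ∀ v : TangentSpace 𝓘(ℝ, ℂ × ℂ) x,
    coordDeriv Φ x (J.toFun x v) = Complex.I • coordDeriv Φ x v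

/-- The function `ψ(z) = z z̄ + γ Re z²`. -/
def quadric (γ : ℝ) (z : ℂ) : ℝ := Complex.normSq z + γ * (z ^ 2).re

/-- `p` is a hyperbolic complex point of the sphere `ι(S²)` near which `J` is integrable:
in suitable holomorphic coordinates centred at `p` the sphere has the form
`w = z z̄ + γ Re z² + o(|z|²)` with `γ > 1`. -/
def IsHyperbolicPoint (J : AlmostComplexStructure X) (ι : TwoSphere → X) (p : X) : Prop :=
  ∃ (Φ : OpenPartialHomeomorph X (ℂ × ℂ)) (γ : ℝ) (φ : ℂ → ℂ),
    IsHolomorphicChartAt J p Φ ∧ 1 < γ ∧ φ =o[𝓝 0] (fun z => ‖z‖ ^ 2) ∧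
    ∀ x ∈ Φ.source, x ∈ range ι ↔ (Φ x).2 = (quadric γ (Φ x).1 : ℂ) + φ (Φ x).1

/-- The sphere `ι(S²)` is totally real at its point `q`: its tangent plane `T` at `q` satisfies
`T ∩ J T = 0`. -/
def IsTotallyRealPoint (J : AlmostComplexStructure X) (ι : TwoSphere → X) (q : X) : Prop :=
  ∃ y : TwoSphere, ι y = q ∧
    ∀ u v : TangentSpace (𝓡 2) y,
      mfderiv (𝓡 2) 𝓘(ℝ, ℂ × ℂ) ι y u
          = J.toFun (ι y) (mfderiv (𝓡 2) 𝓘(ℝ, ℂ × ℂ) ι y v) →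
        mfderiv (𝓡 2) 𝓘(ℝ, ℂ × ℂ) ι y u = 0

/-- A hyperbolic disc in `M` with boundary in the sphere `ι(S²)`: a map which is
continuous on the closed unit disc with values in `M`, is `J`-holomorphic in the open disc, maps
the unit circle to `ι(S²)`, and maps all points of the circle to totally real points of the sphere,
except for finitely many points, which are mapped to hyperbolic points. -/
structure IsHyperbolicDisc (J : AlmostComplexStructure X) (M : Set X) (ι : TwoSphere → X)
    (f : ℂ → X) : Prop where
  continuousOn : ContinuousOn f (closedBall 0 1)
  mapsTo : MapsTo f (closedBall 0 1) M
  contMDiffOn : ContMDiffOn 𝓘(ℝ, ℂ) 𝓘(ℝ, ℂ × ℂ) 1 f (ball 0 1)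
  holomorphic : ∀ ζ ∈ ball (0 : ℂ) 1, ∀ v : ℂ,
    mfderiv 𝓘(ℝ, ℂ) 𝓘(ℝ, ℂ × ℂ) f ζ (Complex.I * v : ℂ) =
      J.toFun (f ζ) (mfderiv 𝓘(ℝ, ℂ) 𝓘(ℝ, ℂ × ℂ) f ζ v)
  mapsTo_sphere : MapsTo f (sphere 0 1) (range ι)
  boundary : ∃ F : Set ℂ, F.Finite ∧ F ⊆ sphere 0 1 ∧
    (∀ ζ ∈ F, IsHyperbolicPoint J ι (f ζ)) ∧
    ∀ ζ ∈ sphere (0 : ℂ) 1 \ F, IsTotallyRealPoint J ι (f ζ)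

end Manifold

/-! ### Good hyperbolic points -/

/-- The antiholomorphic involution `τ₁` of `ℂ²` with fixed point set `w = z̄`. -/
def tauOne : Equiv.Perm (ℂ × ℂ) :=
  Function.Involutive.toPerm
    (fun x => (starRingEnd ℂ x.2, starRingEnd ℂ x.1)) (fun x => by simp)

/-- The antiholomorphic involution `τ₂` of `ℂ²` with fixed point set `w = -z̄ - (2/γ) z`. -/
def tauTwo (γ : ℝ) : Equiv.Perm (ℂ × ℂ) :=
  Function.Involutive.toPerm
    (fun x => (starRingEnd ℂ (-((2 / γ : ℝ) : ℂ) * x.1 - x.2),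
      starRingEnd ℂ ((((2 / γ : ℝ) : ℂ) ^ 2 - 1) * x.1 + ((2 / γ : ℝ) : ℂ) * x.2)))
    (fun x => by
      ext1
      · simp only [map_sub, map_add, map_mul, map_neg, map_one, map_pow, Complex.conj_conj,
          Complex.conj_ofReal]
        ring
      · simp only [map_sub, map_add, map_mul, map_neg, map_one, map_pow, Complex.conj_conj,
          Complex.conj_ofReal]
        ring)

/-- The parameters `γ` for which `τ₁` and `τ₂` generate a finite dihedral group. -/
def IsGoodParameter (γ : ℝ) : Prop :=
  ∃ n : ℕ, 0 < n ∧
    Nonempty (Subgroup.closure {tauOne, tauTwo γ} ≃* DihedralGroup n)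

section Manifold

variable {X : Type*} [TopologicalSpace X] [ChartedSpace (ℂ × ℂ) X]
  [IsManifold 𝓘(ℝ, ℂ × ℂ) ∞ X]

/-- In the coordinates `Φ` centred at `p`, the boundary of `M` is near `p` a strictly Levi convex
hypersurface, `M` being locally `{ρ ≤ 0}`: the Levi form
`v ↦ (D²ρ(v, v) + D²ρ(iv, iv)) / 4` is positive definite on the complex tangent lines
of `{ρ = 0}`. -/
def IsStrictlyLeviConvexAt (M : Set X) (Φ : OpenPartialHomeomorph X (ℂ × ℂ)) : Prop :=
  ∃ (W : Set (ℂ × ℂ)) (ρ : ℂ × ℂ → ℝ),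
    IsOpen W ∧ (0 : ℂ × ℂ) ∈ W ∧ W ⊆ Φ.target ∧ ContDiffOn ℝ 2 ρ W ∧
    (∀ x ∈ W, Φ.symm x ∈ M ↔ ρ x ≤ 0) ∧
    ∀ x ∈ W, ρ x = 0 → fderiv ℝ ρ x ≠ 0 ∧
      ∀ v : ℂ × ℂ, v ≠ 0 → fderiv ℝ ρ x v = 0 → fderiv ℝ ρ x (Complex.I • v) = 0 →
        0 < fderiv ℝ (fderiv ℝ ρ) x v v +
          fderiv ℝ (fderiv ℝ ρ) x (Complex.I • v) (Complex.I • v)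

/-- `p` is a good hyperbolic point of the sphere `ι(S²) ⊆ ∂M`, and `Φ` are holomorphic
coordinates centred at `p` in which the sphere is the quadric `w = z z̄ + γ Re z²`. -/
structure IsGoodHyperbolicPoint (J : AlmostComplexStructure X) (M : Set X) (ι : TwoSphere → X)
    (p : X) (Φ : OpenPartialHomeomorph X (ℂ × ℂ)) (γ : ℝ) : Prop where
  chart : IsHolomorphicChartAt J p Φ
  leviConvex : IsStrictlyLeviConvexAt M Φ
  one_lt : 1 < γ
  sphere_eq : ∀ x ∈ Φ.source, x ∈ range ι ↔ (Φ x).2 = (quadric γ (Φ x).1 : ℂ)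
  good : IsGoodParameter γ

end Manifold

/-! ### Good approach -/

/-- The two connected components of `{z : z z̄ + γ Re z² < 0}` (for `γ > 1` this set does not meet
the real axis): `D⁺` for `s = 1` and `D⁻` for `s = -1`. -/
def admissibleSector (γ s : ℝ) : Set ℂ := {z | quadric γ z < 0 ∧ 0 < s * z.im}

/-- The domain `D` is asymptotic at `0` to the sector `Q`: near `0` it is the region between two
curves `r ↦ r exp(i θ₁(r))` and `r ↦ r exp(i θ₂(r))`, which form the boundary of `D` near `0` and
are tangent at `0` to the two boundary rays of `Q`. -/
def IsAsymptoticToSector (D Q : Set ℂ) : Prop :=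
  ∃ (δ : ℝ) (θ₁ θ₂ : ℝ → ℝ), 0 < δ ∧
    ContinuousOn θ₁ (Ico 0 δ) ∧ ContinuousOn θ₂ (Ico 0 δ) ∧
    Q = {z | ∃ r θ : ℝ, 0 < r ∧ θ ∈ Ioo (θ₁ 0) (θ₂ 0) ∧ z = r * Complex.exp (θ * Complex.I)} ∧
    D ∩ ball 0 δ = {z | ∃ r θ : ℝ, r ∈ Ioo 0 δ ∧ θ ∈ Ioo (θ₁ r) (θ₂ r) ∧
      z = r * Complex.exp (θ * Complex.I)} ∧
    frontier D ∩ ball 0 δ =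
      (fun r : ℝ => (r : ℂ) * Complex.exp (θ₁ r * Complex.I)) '' Ico 0 δ ∪
      (fun r : ℝ => (r : ℂ) * Complex.exp (θ₂ r * Complex.I)) '' Ico 0 δ

/-- `Y` is the graph `{w = g(z)}` over the domain `D` of a function `g` holomorphic
on `D`, and the boundary of `D` contains the origin. -/
structure IsHolomorphicGraph (Y : Set (ℂ × ℂ)) (D : Set ℂ) (g : ℂ → ℂ) : Prop where
  isOpen : IsOpen D
  isConnected : IsConnected D
  zero_mem_frontier : (0 : ℂ) ∈ frontier D
  holomorphic : DifferentiableOn ℂ g D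
  eq_graph : Y = (fun z => (z, g z)) '' D

/-- `g` has on `D` a convergent Puiseux expansion `g(z) = ∑ c_k z^{k/m}` in which only exponents
with `k > 2m` occur; here `z^{1/m}` is the branch `τ`, which is holomorphic on `D`. -/
def HasPuiseuxExpansion (D : Set ℂ) (g : ℂ → ℂ) : Prop :=
  ∃ (m : ℕ) (c : ℕ → ℂ) (τ : ℂ → ℂ), 0 < m ∧ DifferentiableOn ℂ τ D ∧
    (∀ z ∈ D, τ z ^ m = z) ∧ (∀ k, k ≤ 2 * m → c k = 0) ∧
    ∀ z ∈ D, HasSum (fun k => c k * τ z ^ k) (g z)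

/-- The function `g`, holomorphic on `D`, is of class `C²` on the closure of `D`
(that is, `g`, `g'`, `g''` extend continuously to the closure)
and `g(0) = g'(0) = g''(0) = 0`. -/
def IsC2UpToBoundary (D : Set ℂ) (g : ℂ → ℂ) : Prop :=
  ∃ g₁ g₂ : ℂ → ℂ, ContinuousOn g (closure D) ∧ ContinuousOn g₁ (closure D) ∧
    ContinuousOn g₂ (closure D) ∧ (∀ z ∈ D, HasDerivAt g (g₁ z) z) ∧
    (∀ z ∈ D, HasDerivAt g₁ (g₂ z) z) ∧ g 0 = 0 ∧ g₁ 0 = 0 ∧ g₂ 0 = 0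

end

/-! Write `γ = -1 / cos α` with `π/2 < α < π`. The map `τ₁τ₂` is complex linear with eigenvalue
`exp(2iα)`, so finiteness of the dihedral group makes `α` a rational multiple of `π`: some even `n`
satisfies `e ^ n = 1` for `e = exp(iα/2)` (`IsGoodParameter.exists_pow_eq_one`).

Introduce unordered numbers `a, b` by `a + b = sin α · z` and `ab = w/(2γ)`. On the quadric they are
real multiples of `e` and of its conjugate (`quadric_param`), so `a ^ n` and `b ^ n` are real there.
Their symmetric functions are polynomials in `z, w`, hence extend across the boundary arc by Schwarz
reflection; the discriminant is a real square on the arc, so `a ^ n` and `b ^ n` extend separately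
(`IsBoundaryDisc.exists_powers`). After `t = s ^ n` the disc is analytic in `s` on a sector of
opening `π/n`, with `z = s ^ k V(s)` (`IsBoundaryDisc.exists_puiseux`).

Strict Levi convexity determines the leading terms. On `M` it gives `lam w + ψ(z) ≤ ε(|z|² + |w|)`
near the point, where `lam 1 = -1` (`exists_levi_functional`). If `w` had the size of `s ^ (2k)`,
this inequality and the boundary condition would give `ψ(c) + ψ(ic) = 2|c|² ≤ 0` for the leading
coefficient `c` of `z`, and then the leading coefficient of `w` would vanish. So `w` is of higher
order, and the leading part of `z` sweeps an arc on which `ψ ≤ 0` with `ψ = 0` at both ends: it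
fills exactly one of the two sectors, of opening `π - α` (`arg_eq_of_quadric_nonpos`). Hence `k π/n
= π - α < π/2`, so `n > 2k`; as `w` is divisible by `t = s ^ n`, only exponents above `2k` occur in
`w` as a series in `z^{1/k}`.

A coordinate `y` with `z = exp(iχ) y ^ m` (where `m` is `k`) turns this into a graph over a region
between two polar curves (`IsBoundaryDisc.exists_normal_form`, `IsBoundaryDisc.exists_graph`). The
Levi inequality also keeps the interior of the disc away from `p`
(`IsHyperbolicDisc.ne_of_mem_ball`); with compactness this gives the neighbourhood `N`. -/

/-! ### Schwarz reflection -/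

/-- The Schwarz reflection of a function on the upper half plane. -/
noncomputable def schwarzExtension (F : ℂ → ℂ) (t : ℂ) : ℂ :=
  if 0 ≤ t.im then F t else starRingEnd ℂ (F (starRingEnd ℂ t))

theorem continuousOn_schwarzExtension {F : ℂ → ℂ} {r : ℝ}
    (hc : ContinuousOn F (ball 0 r ∩ {t | 0 ≤ t.im}))
    (hreal : ∀ x : ℝ, (x : ℂ) ∈ ball (0 : ℂ) r → (F x).im = 0) :
    ContinuousOn (schwarzExtension F) (ball 0 r) := by
  have hcl : {t : ℂ | 0 ≤ t.im} = closure {t : ℂ | 0 ≤ t.im} :=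
    (isClosed_le continuous_const Complex.continuous_im).closure_eq.symm
  unfold schwarzExtension
  apply ContinuousOn.if
  · rintro t ⟨ht, hf⟩
    have him : t.im = 0 := by
      have := frontier_le_subset_eq (continuous_const (y := (0 : ℝ))) Complex.continuous_im hf
      exact this.symm
    have hx : ((t.re : ℝ) : ℂ) = t := by
      apply Complex.ext <;> simp [him]
    have h1 : starRingEnd ℂ t = t := by rw [← hx, Complex.conj_ofReal]
    have h2 := hreal t.re (by rwa [hx])
    rw [hx] at h2
    rw [h1, Complex.conj_eq_iff_im.2 h2]
  · rw [← hcl]; exact hc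
  · apply Complex.continuous_conj.comp_continuousOn
    apply hc.comp Complex.continuous_conj.continuousOn
    rintro t ⟨ht, ht'⟩
    have h3 : t.im ≤ 0 := by
      have h4 : closure {t : ℂ | ¬ 0 ≤ t.im} ⊆ {t : ℂ | t.im ≤ 0} :=
        closure_minimal (fun t ht => (not_le.1 ht).le)
          (isClosed_le Complex.continuous_im continuous_const)
      exact h4 ht'
    refine ⟨?_, by simpa using h3⟩
    rw [mem_ball_zero_iff] at ht ⊢
    simpa using ht

theorem differentiableAt_schwarzExtension {F : ℂ → ℂ} {r : ℝ}
    (hd : DifferentiableOn ℂ F (ball 0 r ∩ {t | 0 < t.im})) {t : ℂ} (ht : t ∈ ball (0 : ℂ) r)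
    (him : t.im ≠ 0) : DifferentiableAt ℂ (schwarzExtension F) t := by
  have hop : IsOpen (ball (0 : ℂ) r ∩ {t | 0 < t.im}) :=
    isOpen_ball.inter (isOpen_lt continuous_const Complex.continuous_im)
  rcases lt_or_gt_of_ne him with h | h
  · have h1 : starRingEnd ℂ t ∈ ball (0 : ℂ) r ∩ {t | 0 < t.im} := by
      refine ⟨?_, by simpa using h⟩
      rw [mem_ball_zero_iff] at ht ⊢
      simpa using ht
    have h2 := (hd.differentiableAt (hop.mem_nhds h1)).conj_conj
    rw [Complex.conj_conj] at h2
    refine h2.congr_of_eventuallyEq ?_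
    have h3 : ∀ᶠ u in 𝓝 t, u.im < 0 :=
      (isOpen_lt Complex.continuous_im continuous_const).mem_nhds h
    filter_upwards [h3] with u hu
    simp [schwarzExtension, not_le.2 hu]
  · have h2 := hd.differentiableAt (hop.mem_nhds ⟨ht, h⟩)
    refine h2.congr_of_eventuallyEq ?_
    have h3 : ∀ᶠ u in 𝓝 t, 0 < u.im :=
      (isOpen_lt continuous_const Complex.continuous_im).mem_nhds h
    filter_upwards [h3] with u hu
    simp [schwarzExtension, hu.le]

/-- A function continuous on a disc and holomorphic off the real axis is holomorphic. -/
theorem differentiableOn_ball_of_off_real {G : ℂ → ℂ} {r : ℝ} (hc : ContinuousOn G (ball 0 r))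
    (hd : ∀ t ∈ ball (0 : ℂ) r, t.im ≠ 0 → DifferentiableAt ℂ G t) :
    DifferentiableOn ℂ G (ball 0 r) := by
  -- Morera: integrals over rectangle boundaries must vanish. A rectangle that crosses the real axis
  -- is cut along it, and each half has holomorphic interior and continuous boundary values.
  rw [← Complex.isConservativeOn_and_continuousOn_iff_isDifferentiableOn isOpen_ball]
  refine ⟨?_, hc⟩
  intro z w hzw
  rw [← add_eq_zero_iff_eq_neg, Complex.wedgeIntegral_add_wedgeIntegral_eq]
  have key : ∀ z w : ℂ, Complex.Rectangle z w ⊆ ball 0 r →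
      (∀ y ∈ Ioo (min z.im w.im) (max z.im w.im), y ≠ 0) →
      (∫ x : ℝ in z.re..w.re, G (x + z.im * Complex.I)) -
      (∫ x : ℝ in z.re..w.re, G (x + w.im * Complex.I)) +
      Complex.I • (∫ y : ℝ in z.im..w.im, G (w.re + y * Complex.I)) -
      Complex.I • (∫ y : ℝ in z.im..w.im, G (z.re + y * Complex.I)) = 0 := by
    intro z w hzw hy
    apply Complex.integral_boundary_rect_eq_zero_of_continuousOn_of_differentiableOn
    · exact hc.mono hzw
    · intro t ht
      refine (hd t (hzw ?_) (hy _ ht.2)).differentiableWithinAt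
      exact ⟨Ioo_subset_Icc_self ht.1, Ioo_subset_Icc_self ht.2⟩
  by_cases h0 : (0 : ℝ) ∈ Ioo (min z.im w.im) (max z.im w.im)
  · have hmem : (0 : ℝ) ∈ uIcc z.im w.im := Ioo_subset_Icc_self h0
    have hs1 : Complex.Rectangle z ⟨w.re, 0⟩ ⊆ Complex.Rectangle z w := by
      intro t ht
      exact ⟨ht.1, uIcc_subset_uIcc left_mem_uIcc hmem ht.2⟩
    have hs2 : Complex.Rectangle ⟨z.re, 0⟩ w ⊆ Complex.Rectangle z w := by
      intro t ht
      exact ⟨ht.1, uIcc_subset_uIcc hmem right_mem_uIcc ht.2⟩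
    have k1 := key z ⟨w.re, 0⟩ (hs1.trans hzw) (by
      intro y hy h; subst h
      simp only [mem_Ioo, min_lt_iff, lt_max_iff, lt_irrefl, or_false] at hy
      exact lt_asymm hy.1 hy.2)
    have k2 := key ⟨z.re, 0⟩ w (hs2.trans hzw) (by
      intro y hy h; subst h
      simp only [mem_Ioo, min_lt_iff, lt_max_iff, lt_irrefl, false_or] at hy
      exact lt_asymm hy.1 hy.2)
    have hint : ∀ x a b : ℝ, x ∈ uIcc z.re w.re → a ∈ uIcc z.im w.im → b ∈ uIcc z.im w.im →
        IntervalIntegrable (fun y : ℝ => G (x + y * Complex.I)) MeasureTheory.volume a b := by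
      intro x a b hx ha hb
      apply ContinuousOn.intervalIntegrable
      apply hc.comp (by fun_prop)
      intro y hy
      apply hzw
      refine ⟨by simpa using hx, ?_⟩
      have := uIcc_subset_uIcc ha hb hy
      simpa using this
    have e1 := intervalIntegral.integral_add_adjacent_intervals
      (hint w.re z.im 0 right_mem_uIcc left_mem_uIcc hmem)
      (hint w.re 0 w.im right_mem_uIcc hmem right_mem_uIcc)
    have e2 := intervalIntegral.integral_add_adjacent_intervals
      (hint z.re z.im 0 left_mem_uIcc left_mem_uIcc hmem)
      (hint z.re 0 w.im left_mem_uIcc hmem right_mem_uIcc)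
    rw [← e1, ← e2]
    simp only [smul_add] at k1 k2 ⊢
    linear_combination k1 + k2
  · exact key z w hzw (fun y hy h => h0 (h ▸ hy))

/-- **Schwarz reflection principle**: a function continuous on a closed half disc, holomorphic in
its interior and real on the diameter extends holomorphically to the disc. -/
theorem exists_differentiableOn_ball_of_real {F : ℂ → ℂ} {r : ℝ}
    (hc : ContinuousOn F (ball 0 r ∩ {t | 0 ≤ t.im}))
    (hd : DifferentiableOn ℂ F (ball 0 r ∩ {t | 0 < t.im}))
    (hreal : ∀ x : ℝ, (x : ℂ) ∈ ball (0 : ℂ) r → (F x).im = 0) :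
    ∃ G : ℂ → ℂ, DifferentiableOn ℂ G (ball 0 r) ∧ ∀ t, 0 ≤ t.im → G t = F t :=
  ⟨schwarzExtension F, differentiableOn_ball_of_off_real
    (continuousOn_schwarzExtension hc hreal)
    (fun _ ht him => differentiableAt_schwarzExtension hd ht him),
    fun t ht => by simp [schwarzExtension, ht]⟩

/-! ### Power sums of two numbers -/

/-- The polynomial in `e₁ = a + b` and `e₂ = a b` which expresses `a ^ n + b ^ n`. -/
noncomputable def powerSum (e₁ e₂ : ℂ) : ℕ → ℂ
  | 0 => 2
  | 1 => e₁
  | n + 2 => e₁ * powerSum e₁ e₂ (n + 1) - e₂ * powerSum e₁ e₂ n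

/-- Newton's recursion. It makes `a ^ n + b ^ n` holomorphic in `(z, w)` although `a` and `b` are
determined only up to exchange. -/
theorem powerSum_add_mul (a b : ℂ) : ∀ n, powerSum (a + b) (a * b) n = a ^ n + b ^ n
  | 0 => by norm_num [powerSum]
  | 1 => by simp [powerSum]
  | n + 2 => by
    rw [powerSum, powerSum_add_mul a b (n + 1), powerSum_add_mul a b n]
    ring

theorem continuous_powerSum : ∀ n, Continuous fun x : ℂ × ℂ => powerSum x.1 x.2 n
  | 0 => by simp only [powerSum]; fun_prop
  | 1 => by simp only [powerSum]; fun_prop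
  | n + 2 => by
    have h1 := continuous_powerSum n
    have h2 := continuous_powerSum (n + 1)
    simp only [powerSum]
    fun_prop

theorem differentiable_powerSum : ∀ n, Differentiable ℂ fun x : ℂ × ℂ => powerSum x.1 x.2 n
  | 0 => by simp only [powerSum]; fun_prop
  | 1 => by simp only [powerSum]; fun_prop
  | n + 2 => by
    have h1 := differentiable_powerSum n
    have h2 := differentiable_powerSum (n + 1)
    simp only [powerSum]
    fun_prop

theorem exists_add_eq_mul_eq (e₁ e₂ : ℂ) : ∃ a b : ℂ, a + b = e₁ ∧ a * b = e₂ := by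
  obtain ⟨d, hd⟩ := IsAlgClosed.exists_pow_nat_eq (e₁ ^ 2 - 4 * e₂) (n := 2) two_pos
  refine ⟨(e₁ + d) / 2, (e₁ - d) / 2, by ring, ?_⟩
  linear_combination (-1 / 4 : ℂ) * hd

theorem eq_or_eq_of_add_eq_of_mul_eq {x y P Q : ℂ} (h₁ : x + y = P + Q) (h₂ : x * y = P * Q) :
    (x = P ∧ y = Q) ∨ (x = Q ∧ y = P) := by
  have h : (x - P) * (x - Q) = 0 := by linear_combination x * h₁ - h₂
  rcases mul_eq_zero.1 h with h | h
  · left; refine ⟨sub_eq_zero.1 h, ?_⟩; linear_combination h₁ - h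
  · right; refine ⟨sub_eq_zero.1 h, ?_⟩; linear_combination h₁ - h

/-! ### Germs of holomorphic functions at the origin -/

/-- `V / V 0` stays near `1`, where the principal logarithm is holomorphic; the prescribed value `c`
selects the branch. -/
theorem AnalyticAt.exists_pow_eq_of_ne_zero {V : ℂ → ℂ} (hV : AnalyticAt ℂ V 0) {n : ℕ} (hn : 0 < n)
    {c : ℂ} (hc : c ^ n = V 0) (h0 : V 0 ≠ 0) :
    ∃ v : ℂ → ℂ, AnalyticAt ℂ v 0 ∧ v 0 = c ∧ ∀ᶠ t in 𝓝 0, v t ^ n = V t := by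
  have hn' : (n : ℂ) ≠ 0 := by exact_mod_cast hn.ne'
  have h1 : AnalyticAt ℂ (fun t => V t / V 0) 0 := hV.div analyticAt_const h0
  have h2 : V 0 / V 0 ∈ Complex.slitPlane := by simp [div_self h0]
  refine ⟨fun t => c * Complex.exp (Complex.log (V t / V 0) / n), ?_, ?_, ?_⟩
  · exact analyticAt_const.mul ((h1.clog h2).div analyticAt_const hn').cexp
  · simp [div_self h0]
  · filter_upwards [hV.continuousAt.eventually_ne h0] with t ht
    rw [mul_pow, ← Complex.exp_nat_mul, mul_div_cancel₀ _ hn', Complex.exp_log (div_ne_zero ht h0),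
      hc, mul_div_cancel₀ _ h0]

theorem AnalyticAt.exists_eventually_eq_pow_mul {F : ℂ → ℂ} (hF : AnalyticAt ℂ F 0) :
    (∀ᶠ t in 𝓝 0, F t = 0) ∨ ∃ (k : ℕ) (g : ℂ → ℂ), AnalyticAt ℂ g 0 ∧ g 0 ≠ 0 ∧
      ∀ᶠ t in 𝓝 0, F t = t ^ k * g t := by
  by_cases h : ∀ᶠ t in 𝓝 0, F t = 0
  · exact Or.inl h
  · obtain ⟨k, g, h1, h2, h3⟩ := hF.exists_eventuallyEq_pow_smul_nonzero_iff.2 h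
    exact Or.inr ⟨k, g, h1, h2, by simpa using h3⟩

/-- The common factor has the smaller of the two orders, so at least one cofactor survives at the
origin; an identically vanishing germ imposes no condition. -/
theorem AnalyticAt.exists_pow_dvd_pair {P Q : ℂ → ℂ} (hP : AnalyticAt ℂ P 0)
    (hQ : AnalyticAt ℂ Q 0) (h : ¬ ((∀ᶠ t in 𝓝 0, P t = 0) ∧ ∀ᶠ t in 𝓝 0, Q t = 0)) :
    ∃ (k : ℕ) (p q : ℂ → ℂ), AnalyticAt ℂ p 0 ∧ AnalyticAt ℂ q 0 ∧ (p 0 ≠ 0 ∨ q 0 ≠ 0) ∧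
      (∀ᶠ t in 𝓝 0, P t = t ^ k * p t) ∧ ∀ᶠ t in 𝓝 0, Q t = t ^ k * q t := by
  rcases hP.exists_eventually_eq_pow_mul with h1 | ⟨k, p, hp, hp0, hk⟩
  · rcases hQ.exists_eventually_eq_pow_mul with h2 | ⟨l, q, hq, hq0, hl⟩
    · exact absurd ⟨h1, h2⟩ h
    · exact ⟨l, fun _ => 0, q, analyticAt_const, hq, Or.inr hq0, by simpa using h1, hl⟩
  · rcases hQ.exists_eventually_eq_pow_mul with h2 | ⟨l, q, hq, hq0, hl⟩
    · exact ⟨k, p, fun _ => 0, hp, analyticAt_const, Or.inl hp0, hk, by simpa using h2⟩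
    · rcases le_total k l with hkl | hkl
      · obtain ⟨d, rfl⟩ := Nat.exists_eq_add_of_le hkl
        refine ⟨k, p, fun t => t ^ d * q t, hp, (analyticAt_id.pow d).mul hq, Or.inl hp0, hk, ?_⟩
        filter_upwards [hl] with t ht
        rw [ht]; ring
      · obtain ⟨d, rfl⟩ := Nat.exists_eq_add_of_le hkl
        refine ⟨l, fun t => t ^ d * p t, q, (analyticAt_id.pow d).mul hp, hq, Or.inr hq0, ?_, hl⟩
        filter_upwards [hk] with t ht
        rw [ht]; ring

theorem tendsto_real_mul_nhds_zero (c : ℂ) :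
    Tendsto (fun r : ℝ => (r : ℂ) * c) (𝓝[>] 0) (𝓝 0) := by
  have : Tendsto (fun r : ℝ => (r : ℂ) * c) (𝓝 0) (𝓝 (((0 : ℝ) : ℂ) * c)) :=
    (Continuous.tendsto (by fun_prop) 0)
  simpa using this.mono_left nhdsWithin_le_nhds

/-- A holomorphic germ which is non-negative on the real axis has a holomorphic square root. -/
theorem AnalyticAt.exists_sq_eq_of_nonneg {F : ℂ → ℂ} (hF : AnalyticAt ℂ F 0)
    (hre : ∀ᶠ x : ℝ in 𝓝 0, ∃ y : ℝ, 0 ≤ y ∧ F x = y) :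
    ∃ R : ℂ → ℂ, AnalyticAt ℂ R 0 ∧ ∀ᶠ t in 𝓝 0, R t ^ 2 = F t := by
  rcases hF.exists_eventually_eq_pow_mul with h1 | ⟨k, g, hg, hg0, hk⟩
  · exact ⟨fun _ => 0, analyticAt_const, by filter_upwards [h1] with t ht; simp [ht]⟩
  have hcl : IsClosed {u : ℂ | 0 ≤ u.re ∧ u.im = 0} :=
    (isClosed_le continuous_const Complex.continuous_re).inter
      (isClosed_eq Complex.continuous_im continuous_const)
  -- Approaching `0` along the two real half-lines shows that `g 0` and `(-1) ^ k * g 0` are both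
  -- non-negative; since `g 0 ≠ 0`, the order `k` is even.
  have key : ∀ σ : ℝ, σ ^ 2 = 1 → 0 ≤ ((σ : ℂ) ^ k * g 0).re ∧ ((σ : ℂ) ^ k * g 0).im = 0 := by
    intro σ hσ
    have ht : Tendsto (fun r : ℝ => (r : ℂ) * σ) (𝓝[>] 0) (𝓝 0) := tendsto_real_mul_nhds_zero _
    have ht' : Tendsto (fun r : ℝ => r * σ) (𝓝[>] 0) (𝓝 0) := by
      have := (by fun_prop : Continuous fun r : ℝ => r * σ).tendsto 0
      simpa using this.mono_left nhdsWithin_le_nhds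
    have h2 : Tendsto (fun r : ℝ => (σ : ℂ) ^ k * g ((r : ℂ) * σ)) (𝓝[>] 0)
        (𝓝 ((σ : ℂ) ^ k * g 0)) := (hg.continuousAt.tendsto.comp ht).const_mul _
    refine hcl.mem_of_tendsto h2 ?_
    filter_upwards [ht.eventually hk, ht'.eventually hre, self_mem_nhdsWithin] with r h3 h4 h5
    obtain ⟨y, hy, hy'⟩ := h4
    have h5' : (0 : ℝ) < r := h5
    have h6 : (σ : ℂ) ^ k * g ((r : ℂ) * σ) = ((y / r ^ k : ℝ) : ℂ) := by
      have h7 : (r : ℂ) ^ k ≠ 0 := by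
        apply pow_ne_zero; exact_mod_cast h5'.ne'
      push_cast
      rw [eq_div_iff h7, ← hy']
      push_cast
      rw [h3]; ring
    show 0 ≤ (_ : ℂ).re ∧ (_ : ℂ).im = 0
    rw [h6]
    exact ⟨by rw [Complex.ofReal_re]; positivity, Complex.ofReal_im _⟩
  have h1 := key 1 (by norm_num)
  have h2 := key (-1) (by norm_num)
  simp only [Complex.ofReal_one, one_pow, one_mul] at h1
  have heven : Even k := by
    by_contra hodd
    rw [Nat.not_even_iff_odd] at hodd
    have h3 : ((-1 : ℝ) : ℂ) ^ k = -1 := by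
      rw [Complex.ofReal_neg, Complex.ofReal_one, hodd.neg_one_pow]
    rw [h3] at h2
    apply hg0
    apply Complex.ext
    · have := h2.1; simp at this; simpa using le_antisymm this h1.1
    · simpa using h1.2
  obtain ⟨j, rfl⟩ := heven
  obtain ⟨c, hc⟩ := IsAlgClosed.exists_pow_nat_eq (g 0) (n := 2) two_pos
  obtain ⟨v, hv, -, hv2⟩ := hg.exists_pow_eq_of_ne_zero two_pos hc hg0
  refine ⟨fun t => t ^ j * v t, (analyticAt_id.pow j).mul hv, ?_⟩
  filter_upwards [hk, hv2] with t h3 h4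
  rw [h3, mul_pow, h4]; ring

/-- A number whose `n`-th power is close to `p` is close to an `n`-th root of `p`. -/
theorem exists_pow_eq_dist_lt {n : ℕ} (hn : 0 < n) (p : ℂ) {ε : ℝ} (hε : 0 < ε) :
    ∃ δ > 0, ∀ x : ℂ, dist (x ^ n) p < δ → ∃ y, y ^ n = p ∧ dist x y < ε := by
  -- `x ^ n - p` is the product of `n` factors `x - y` over the roots `y`; if each has modulus at
  -- least `ε`, the product has modulus at least `ε ^ n`.
  refine ⟨ε ^ n, by positivity, fun x hx => ?_⟩
  by_contra! h
  have hm : (Polynomial.X ^ n - Polynomial.C p).Monic := Polynomial.monic_X_pow_sub_C p hn.ne'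
  have hs : (Polynomial.X ^ n - Polynomial.C p).Splits := IsAlgClosed.splits _
  have h1 := hs.eval_eq_prod_roots_of_monic hm x
  have hcard : Multiset.card (Polynomial.X ^ n - Polynomial.C p).roots = n := by
    rw [← hs.natDegree_eq_card_roots, Polynomial.natDegree_X_pow_sub_C]
  simp only [Polynomial.eval_sub, Polynomial.eval_pow, Polynomial.eval_X, Polynomial.eval_C] at h1
  rw [dist_eq_norm, h1, ← not_le] at hx
  apply hx
  have h2 : ∀ s : Multiset ℂ, (∀ y ∈ s, ε ≤ ‖x - y‖) →
      ε ^ Multiset.card s ≤ ‖(s.map fun a => x - a).prod‖ := by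
    intro s
    induction s using Multiset.induction with
    | empty => simp
    | cons a s ih =>
      intro h
      rw [Multiset.card_cons, Multiset.map_cons, Multiset.prod_cons, norm_mul, pow_succ']
      exact mul_le_mul (h a (Multiset.mem_cons_self a s))
        (ih fun y hy => h y (Multiset.mem_cons_of_mem hy)) (by positivity) (norm_nonneg _)
  have h3 := h2 (Polynomial.X ^ n - Polynomial.C p).roots (fun y hy => by
    rw [← dist_eq_norm]
    apply h
    have := Polynomial.isRoot_of_mem_roots hy
    simpa [Polynomial.IsRoot, sub_eq_zero] using this)
  rwa [hcard] at h3

theorem finite_setOf_pow_eq {n : ℕ} (hn : 0 < n) (p : ℂ) : {y : ℂ | y ^ n = p}.Finite := by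
  refine (Polynomial.X ^ n - Polynomial.C p).roots.toFinset.finite_toSet.subset ?_
  intro y hy
  have h0 : (Polynomial.X ^ n - Polynomial.C p) ≠ 0 := Polynomial.X_pow_sub_C_ne_zero hn p
  simpa [h0, sub_eq_zero] using hy

/-- A continuous function whose values approach a finite set converges to one of its points. -/
theorem exists_tendsto_of_approaches_finite {S : Set ℂ} {f : ℂ → ℂ} {A : Set ℂ} (hA : A.Finite)
    (hS : ∀ r > 0, IsPreconnected (S ∩ ball 0 r)) (hne : (𝓝[S] (0 : ℂ)).NeBot)
    {r₀ : ℝ} (hr₀ : 0 < r₀) (hf : ContinuousOn f (S ∩ ball 0 r₀))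
    (happ : ∀ ε > 0, ∀ᶠ s in 𝓝[S] 0, ∃ a ∈ A, dist (f s) a < ε) :
    ∃ a ∈ A, Tendsto f (𝓝[S] 0) (𝓝 a) := by
  -- The balls of radius `d` about the points of `A` are disjoint, so the connected image of a small
  -- piece of `S` stays in a single one.
  obtain ⟨d, hd, hsep⟩ : ∃ d > 0, ∀ a ∈ A, ∀ b ∈ A, a ≠ b → 2 * d ≤ dist a b := by
    rcases A.eq_empty_or_nonempty with rfl | -
    · exact ⟨1, one_pos, by simp⟩
    have h1 : (A.offDiag).Finite := hA.offDiag
    by_cases h2 : A.offDiag.Nonempty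
    · obtain ⟨x, hx, hmin⟩ := h1.exists_minimalFor (fun x => dist x.1 x.2) _ h2
      have hx' := mem_offDiag.1 hx
      refine ⟨dist x.1 x.2 / 2, by have := dist_pos.2 hx'.2.2; positivity, ?_⟩
      intro a ha b hb hab
      have h3 : (a, b) ∈ A.offDiag := mem_offDiag.2 ⟨ha, hb, hab⟩
      rcases le_total (dist x.1 x.2) (dist a b) with h4 | h4
      · linarith
      · have := hmin h3 h4
        simp only at this
        linarith
    · refine ⟨1, one_pos, fun a ha b hb hab => ?_⟩
      exact absurd ⟨(a, b), mem_offDiag.2 ⟨ha, hb, hab⟩⟩ h2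
  have hev := happ d hd
  obtain ⟨r₁, hr₁, hsub⟩ := Metric.mem_nhdsWithin_iff.1 hev
  set r := min r₀ r₁
  have hr : 0 < r := lt_min hr₀ hr₁
  have hmem : ∀ s ∈ S ∩ ball 0 r, ∃ a ∈ A, dist (f s) a < d := fun s hs =>
    hsub ⟨ball_subset_ball (min_le_right _ _) hs.2, hs.1⟩
  have hmemr : S ∩ ball 0 r ∈ 𝓝[S] (0 : ℂ) :=
    inter_mem self_mem_nhdsWithin (mem_nhdsWithin_of_mem_nhds (ball_mem_nhds 0 hr))
  obtain ⟨s₀, hs₀⟩ := hne.nonempty_of_mem hmemr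
  obtain ⟨a, ha, has⟩ := hmem s₀ hs₀
  have himg : IsPreconnected (f '' (S ∩ ball 0 r)) := (hS r hr).image f
    (hf.mono (inter_subset_inter_right _ (ball_subset_ball (min_le_left _ _))))
  have hsubl : f '' (S ∩ ball 0 r) ⊆ ball a d := by
    refine himg.subset_left_of_subset_union isOpen_ball
      (v := ⋃ b ∈ A \ {a}, ball b d) (isOpen_biUnion fun _ _ => isOpen_ball) ?_ ?_
      ⟨f s₀, ⟨s₀, hs₀, rfl⟩, has⟩
    · rw [Set.disjoint_left]
      intro x hx hx'
      simp only [mem_iUnion] at hx'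
      obtain ⟨b, hb, hxb⟩ := hx'
      have h1 := hsep a ha b hb.1 (fun h => hb.2 h.symm)
      have h2 := dist_triangle_left a b x
      rw [mem_ball] at hx hxb
      linarith
    · rintro _ ⟨s, hs, rfl⟩
      obtain ⟨b, hb, hsb⟩ := hmem s hs
      by_cases hba : b = a
      · left; rw [← hba]; exact hsb
      · right
        simp only [mem_iUnion]
        exact ⟨b, ⟨hb, hba⟩, hsb⟩
  refine ⟨a, ha, ?_⟩
  rw [Metric.tendsto_nhds]
  intro ε hε
  filter_upwards [happ (min ε d) (lt_min hε hd), hmemr] with s h1 h2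
  obtain ⟨b, hb, hsb⟩ := h1
  have h3 : dist (f s) a < d := hsubl ⟨s, h2, rfl⟩
  by_cases hba : b = a
  · rw [← hba]; exact hsb.trans_le (min_le_left _ _)
  · exfalso
    have h4 := hsep a ha b hb (fun h => hba h.symm)
    have h5 := dist_triangle_left a b (f s)
    have h6 := hsb.trans_le (min_le_right _ _)
    linarith

section

/-! ### Analytic discs near a point of the boundary -/

/-- A pair `(z, w)` of functions on the closed upper half disc of radius `r` which parametrises an
analytic disc with boundary in the quadric `w = ψ(z)`; the functional `lam` and the last condition
encode the Levi convexity of the ambient hypersurface. -/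
structure IsBoundaryDisc (γ : ℝ) (lam : ℂ →L[ℝ] ℝ) (z w : ℂ → ℂ) (r : ℝ) : Prop where
  pos : 0 < r
  continuousOn_z : ContinuousOn z (ball 0 r ∩ {t | 0 ≤ t.im})
  continuousOn_w : ContinuousOn w (ball 0 r ∩ {t | 0 ≤ t.im})
  differentiableOn_z : DifferentiableOn ℂ z (ball 0 r ∩ {t | 0 < t.im})
  differentiableOn_w : DifferentiableOn ℂ w (ball 0 r ∩ {t | 0 < t.im})
  z_zero : z 0 = 0
  boundary : ∀ x : ℝ, (x : ℂ) ∈ ball (0 : ℂ) r → w x = quadric γ (z x)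
  ne_zero : ∀ t ∈ ball (0 : ℂ) r, 0 < t.im → z t = 0 → w t ≠ 0
  lam_one : lam 1 = -1
  levi : ∀ ε > 0, ∀ᶠ t in 𝓝[{t : ℂ | 0 ≤ t.im}] 0,
    lam (w t) + quadric γ (z t) ≤ ε * (‖z t‖ ^ 2 + ‖w t‖)

theorem quadric_zero (γ : ℝ) : quadric γ 0 = 0 := by simp [quadric]

theorem continuous_quadric (γ : ℝ) : Continuous (quadric γ) := by
  unfold quadric
  exact Complex.continuous_normSq.add
    (continuous_const.mul (Complex.continuous_re.comp (continuous_pow 2)))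

theorem quadric_real_mul (γ r : ℝ) (z : ℂ) : quadric γ (r * z) = r ^ 2 * quadric γ z := by
  simp only [quadric, map_mul, Complex.normSq_ofReal, mul_pow, ← Complex.ofReal_pow,
    Complex.re_ofReal_mul]
  ring

theorem quadric_add_quadric_I_mul (γ : ℝ) (z : ℂ) :
    quadric γ z + quadric γ (Complex.I * z) = 2 * Complex.normSq z := by
  simp only [quadric, map_mul, Complex.normSq_I, mul_pow, Complex.I_sq, neg_mul, one_mul,
    Complex.neg_re]
  ring

theorem quadric_exp (γ r θ : ℝ) :
    quadric γ (r * Complex.exp (θ * Complex.I)) = r ^ 2 * (1 + γ * Real.cos (2 * θ)) := by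
  rw [quadric_real_mul, quadric, ← Complex.exp_nat_mul, Complex.normSq_eq_norm_sq,
    Complex.norm_exp_ofReal_mul_I]
  have : ((2 : ℕ) : ℂ) * (θ * Complex.I) = ((2 * θ : ℝ) : ℂ) * Complex.I := by push_cast; ring
  rw [this, Complex.exp_ofReal_mul_I_re]
  norm_num

/-- On the quadric, `z` and `w` are parametrised by two real numbers. -/
theorem quadric_param {γ α : ℝ} (hγ : 1 < γ) (hα : Real.cos α = -1 / γ) (z : ℂ) :
    let e := Complex.exp ((α / 2 : ℝ) * Complex.I)
    let a := e * ((e * z).im : ℂ)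
    let b := -(starRingEnd ℂ e) * ((starRingEnd ℂ e * z).im : ℂ)
    a + b = Real.sin α * z ∧ a * b = (quadric γ z : ℂ) / (2 * γ) := by
  intro e a b
  have he : e = Real.cos (α / 2) + Real.sin (α / 2) * Complex.I := by
    simp only [e]
    rw [Complex.exp_mul_I, ← Complex.ofReal_cos, ← Complex.ofReal_sin]
  have hs : Real.sin α = 2 * Real.sin (α / 2) * Real.cos (α / 2) := by
    rw [← Real.sin_two_mul]; congr 1; ring
  have hc : Real.cos α = 2 * Real.cos (α / 2) ^ 2 - 1 := by
    rw [← Real.cos_two_mul]; congr 1; ring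
  have h1 := Real.sin_sq_add_cos_sq (α / 2)
  simp only [a, b, he]
  generalize Real.sin (α / 2) = S at *
  generalize Real.cos (α / 2) = C at *
  have hγ0 : γ ≠ 0 := by positivity
  rw [hα] at hc
  have hC : 2 * γ * C ^ 2 = γ - 1 := by field_simp at hc; linarith
  have hS : 2 * γ * S ^ 2 = γ + 1 := by linear_combination 2 * γ * h1 - hC
  constructor
  · rw [hs]
    apply Complex.ext
    · simp; ring
    · simp; ring
  · have h2γ : (2 * (γ : ℂ)) ≠ 0 := by
      have : (γ : ℂ) ≠ 0 := by exact_mod_cast hγ0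
      simpa using this
    rw [eq_div_iff h2γ]
    have h3 : ((C : ℂ) + S * Complex.I) * (starRingEnd ℂ ((C : ℂ) + S * Complex.I)) = 1 := by
      rw [Complex.mul_conj, Complex.normSq_add_mul_I]
      norm_cast; linarith
    have h4 : ((C : ℂ) + S * Complex.I) * ((((C : ℂ) + S * Complex.I) * z).im : ℂ) *
        (-(starRingEnd ℂ ((C : ℂ) + S * Complex.I)) *
          ((starRingEnd ℂ ((C : ℂ) + S * Complex.I) * z).im : ℂ)) * (2 * γ) =
        ((-(((((C : ℂ) + S * Complex.I) * z).im) *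
          (starRingEnd ℂ ((C : ℂ) + S * Complex.I) * z).im * (2 * γ)) : ℝ) : ℂ) := by
      push_cast
      linear_combination (-((((C : ℂ) + S * Complex.I) * z).im : ℂ) *
        ((starRingEnd ℂ ((C : ℂ) + S * Complex.I) * z).im : ℂ) * (2 * γ)) * h3
    rw [h4]
    congr 1
    simp [quadric, Complex.normSq_apply, pow_two]
    linear_combination (z.re ^ 2) * hS - (z.im ^ 2) * hC

/-- The closed sector of opening `π / n` above the positive real axis, without its vertex. -/
noncomputable def closedSector (n : ℕ) : Set ℂ :=
  {s | ∃ r φ : ℝ, 0 < r ∧ φ ∈ Icc 0 (Real.pi / n) ∧ s = r * Complex.exp (φ * Complex.I)}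

theorem pow_polar (r φ : ℝ) (n : ℕ) :
    ((r : ℂ) * Complex.exp (φ * Complex.I)) ^ n =
      ((r ^ n : ℝ) : ℂ) * Complex.exp ((n * φ : ℝ) * Complex.I) := by
  rw [mul_pow, ← Complex.exp_nat_mul]
  push_cast
  ring_nf

theorem norm_polar {r : ℝ} (hr : 0 ≤ r) (φ : ℝ) : ‖(r : ℂ) * Complex.exp (φ * Complex.I)‖ = r := by
  rw [norm_mul, Complex.norm_exp_ofReal_mul_I, Complex.norm_real, Real.norm_of_nonneg hr, mul_one]

theorem im_polar (r φ : ℝ) : ((r : ℂ) * Complex.exp (φ * Complex.I)).im = r * Real.sin φ := by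
  rw [Complex.im_ofReal_mul, Complex.exp_ofReal_mul_I_im]

theorem ne_zero_of_mem_closedSector {n : ℕ} {s : ℂ} (hs : s ∈ closedSector n) : s ≠ 0 := by
  obtain ⟨r, φ, hr, -, rfl⟩ := hs
  exact mul_ne_zero (by exact_mod_cast hr.ne') (Complex.exp_ne_zero _)

theorem im_pow_nonneg_of_mem_closedSector {n : ℕ} (hn : 0 < n) {s : ℂ} (hs : s ∈ closedSector n) :
    0 ≤ (s ^ n).im := by
  obtain ⟨r, φ, hr, hφ, rfl⟩ := hs
  have hn' : (0 : ℝ) < n := by exact_mod_cast hn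
  rw [pow_polar, im_polar]
  refine mul_nonneg (by positivity) (Real.sin_nonneg_of_nonneg_of_le_pi ?_ ?_)
  · exact mul_nonneg hn'.le hφ.1
  · have := mul_le_mul_of_nonneg_left hφ.2 hn'.le
    rwa [mul_div_cancel₀ _ hn'.ne'] at this

theorem isPreconnected_closedSector_inter_ball (n : ℕ) (r : ℝ) :
    IsPreconnected (closedSector n ∩ ball 0 r) := by
  have : closedSector n ∩ ball 0 r =
      (fun x : ℝ × ℝ => (x.1 : ℂ) * Complex.exp (x.2 * Complex.I)) ''
        (Ioo 0 r ×ˢ Icc 0 (Real.pi / n)) := by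
    ext s
    constructor
    · rintro ⟨⟨ρ, φ, hρ, hφ, rfl⟩, h⟩
      rw [mem_ball_zero_iff, norm_polar hρ.le] at h
      exact ⟨(ρ, φ), ⟨⟨hρ, h⟩, hφ⟩, rfl⟩
    · rintro ⟨⟨ρ, φ⟩, ⟨hρ, hφ⟩, rfl⟩
      refine ⟨⟨ρ, φ, hρ.1, hφ, rfl⟩, ?_⟩
      rw [mem_ball_zero_iff, norm_polar hρ.1.le]
      exact hρ.2
  rw [this]
  refine (isPreconnected_Ioo.prod isPreconnected_Icc).image _ (Continuous.continuousOn ?_)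
  fun_prop

theorem tendsto_polar_closedSector {n : ℕ} {φ : ℝ} (hφ : φ ∈ Icc 0 (Real.pi / n)) :
    Tendsto (fun r : ℝ => (r : ℂ) * Complex.exp (φ * Complex.I)) (𝓝[>] 0)
      (𝓝[closedSector n] 0) := by
  refine tendsto_nhdsWithin_iff.2 ⟨tendsto_real_mul_nhds_zero _, ?_⟩
  filter_upwards [self_mem_nhdsWithin] with r hr
  exact ⟨r, φ, hr, hφ, rfl⟩

theorem neBot_nhdsWithin_closedSector (n : ℕ) : (𝓝[closedSector n] (0 : ℂ)).NeBot :=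
  (tendsto_polar_closedSector (φ := 0) ⟨le_rfl, by positivity⟩).neBot

theorem tendsto_pow_closedSector {n : ℕ} (hn : 0 < n) :
    Tendsto (fun s : ℂ => s ^ n) (𝓝[closedSector n] 0) (𝓝[{t : ℂ | 0 ≤ t.im}] 0) := by
  refine tendsto_nhdsWithin_iff.2 ⟨?_, ?_⟩
  · have := (continuous_pow n : Continuous fun s : ℂ => s ^ n).tendsto 0
    rw [zero_pow hn.ne'] at this
    exact this.mono_left nhdsWithin_le_nhds
  · filter_upwards [self_mem_nhdsWithin] with s hs
    exact im_pow_nonneg_of_mem_closedSector hn hs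

variable {γ α r : ℝ} {lam : ℂ →L[ℝ] ℝ} {z w : ℂ → ℂ} {n : ℕ}

theorem IsBoundaryDisc.w_zero (h : IsBoundaryDisc γ lam z w r) : w 0 = 0 := by
  have := h.boundary 0 (by simpa using h.pos)
  simpa [h.z_zero, quadric_zero] using this

/-- The symmetric functions of the `n`-th powers extend holomorphically through the boundary. -/
theorem IsBoundaryDisc.exists_powers (h : IsBoundaryDisc γ lam z w r) (hγ : 1 < γ)
    (hα : Real.cos α = -1 / γ) (hn : Even n) (hn0 : 0 < n)
    (he : Complex.exp ((α / 2 : ℝ) * Complex.I) ^ n = 1) :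
    ∃ P Q W : ℂ → ℂ, AnalyticAt ℂ P 0 ∧ AnalyticAt ℂ Q 0 ∧ AnalyticAt ℂ W 0 ∧
      P 0 = 0 ∧ Q 0 = 0 ∧ (∀ t, 0 ≤ t.im → W t = w t) ∧
      ∀ᶠ t in 𝓝 0, 0 ≤ t.im → ∀ a b : ℂ, a + b = Real.sin α * z t → a * b = w t / (2 * γ) →
        (a ^ n = P t ∧ b ^ n = Q t) ∨ (a ^ n = Q t ∧ b ^ n = P t) := by
  have hmem : ball (0 : ℂ) r ∈ 𝓝 0 := ball_mem_nhds 0 h.pos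
  set e := Complex.exp ((α / 2 : ℝ) * Complex.I) with hedef
  set T₀ : ℂ → ℂ := fun t => powerSum (Real.sin α * z t) (w t / (2 * γ)) n with hT₀
  -- On the boundary `a` is `e X` and `b` is minus the conjugate of `e` times `Y`, with `X, Y` real.
  -- Since `e ^ n = 1` and `n` is even, `a ^ n = X ^ n` and `b ^ n = Y ^ n`.
  have hbd : ∀ x : ℝ, (x : ℂ) ∈ ball (0 : ℂ) r → ∃ X Y : ℝ,
      T₀ x = ((X ^ n + Y ^ n : ℝ) : ℂ) ∧ (w x / (2 * γ)) ^ n = ((X ^ n * Y ^ n : ℝ) : ℂ) := by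
    intro x hx
    obtain ⟨h1, h2⟩ := quadric_param hγ hα (z x)
    rw [← h.boundary x hx] at h2
    rw [← hedef] at h1 h2
    refine ⟨(e * z x).im, (starRingEnd ℂ e * z x).im, ?_, ?_⟩
    · simp only [hT₀]
      rw [← h1, ← h2, powerSum_add_mul, mul_pow, mul_pow, hn.neg_pow, ← map_pow, he, map_one]
      push_cast; ring
    · rw [← h2, mul_pow, mul_pow, mul_pow, hn.neg_pow, ← map_pow, he, map_one]
      push_cast; ring
  obtain ⟨W, hW, hWw⟩ := exists_differentiableOn_ball_of_real h.continuousOn_w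
    h.differentiableOn_w (fun x hx => by rw [h.boundary x hx]; exact Complex.ofReal_im _)
  obtain ⟨T, hT, hTT⟩ := exists_differentiableOn_ball_of_real (F := T₀) (r := r)
    ((continuous_powerSum n).comp_continuousOn
      ((continuousOn_const.mul h.continuousOn_z).prodMk (h.continuousOn_w.div_const _)))
    ((differentiable_powerSum n).comp_differentiableOn
      (((differentiableOn_const _).mul h.differentiableOn_z).prodMk
        (h.differentiableOn_w.div_const _)))
    (fun x hx => by
      obtain ⟨X, Y, hXY, -⟩ := hbd x hx
      rw [hXY]; exact Complex.ofReal_im _)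
  have hWa : AnalyticAt ℂ W 0 := hW.analyticAt hmem
  have hTa : AnalyticAt ℂ T 0 := hT.analyticAt hmem
  have hWn : AnalyticAt ℂ (fun t => (W t / (2 * γ)) ^ n) 0 := by
    have : AnalyticAt ℂ (fun t => W t / (2 * (γ : ℂ))) 0 := by
      simp only [div_eq_mul_inv]
      exact hWa.mul analyticAt_const
    exact this.pow n
  have hF : AnalyticAt ℂ (fun t => T t ^ 2 - 4 * (W t / (2 * γ)) ^ n) 0 :=
    (hTa.pow 2).sub (analyticAt_const.mul hWn)
  -- The discriminant of the quadratic equation with roots `a ^ n`, `b ^ n` is `(X ^ n - Y ^ n) ^ 2`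
  -- on the real axis. It therefore has a holomorphic square root, and both roots are holomorphic
  -- germs.
  obtain ⟨R, hRa, hR⟩ := hF.exists_sq_eq_of_nonneg (by
    have hev : ∀ᶠ x : ℝ in 𝓝 0, (x : ℂ) ∈ ball (0 : ℂ) r :=
      Complex.continuous_ofReal.continuousAt.eventually (by simp only [Complex.ofReal_zero]; exact hmem)
    filter_upwards [hev] with x hx
    obtain ⟨X, Y, h1, h2⟩ := hbd x hx
    refine ⟨(X ^ n - Y ^ n) ^ 2, by positivity, ?_⟩
    rw [hTT _ (by simp), hWw _ (by simp), h1, h2]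
    push_cast; ring)
  have hT0 : T 0 = 0 := by
    obtain ⟨a, b, hab, hab'⟩ := exists_add_eq_mul_eq 0 0
    rw [hTT 0 (by simp)]
    simp only [hT₀, h.z_zero, h.w_zero, mul_zero, zero_div]
    rw [show powerSum 0 0 n = powerSum (0 + 0) (0 * 0) n by simp, powerSum_add_mul,
      zero_pow hn0.ne', add_zero]
  have hR0 : R 0 = 0 := by
    have := hR.self_of_nhds
    rw [hT0, hWw 0 (by simp), h.w_zero, zero_div, zero_pow hn0.ne'] at this
    simpa using this
  have h2 : (2 : ℂ) ≠ 0 := two_ne_zero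
  refine ⟨fun t => (T t + R t) / 2, fun t => (T t - R t) / 2, W,
    (hTa.add hRa).div analyticAt_const h2, (hTa.sub hRa).div analyticAt_const h2, hWa,
    by simp [hT0, hR0], by simp [hT0, hR0], hWw, ?_⟩
  filter_upwards [hR] with t hRt ht a b hab hab'
  apply eq_or_eq_of_add_eq_of_mul_eq
  · rw [← powerSum_add_mul, hab, hab']
    have := hTT t ht
    simp only [hT₀] at this
    rw [← this]; ring
  · rw [← mul_pow, hab', ← hWw t ht]
    linear_combination (1 / 4 : ℂ) * hRt

end

/-! ### Orders of vanishing, and the conditions they impose on the leading terms -/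

section

variable {γ α r : ℝ} {lam : ℂ →L[ℝ] ℝ} {z w : ℂ → ℂ} {n : ℕ}

/-- Germs known to agree only in the upper half plane are compared along the imaginary axis. -/
theorem eq_at_zero_of_eventually_eq {f g : ℂ → ℂ} (hf : ContinuousAt f 0) (hg : ContinuousAt g 0)
    (h : ∀ᶠ t in 𝓝 (0 : ℂ), 0 < t.im → f t = g t) : f 0 = g 0 := by
  have ht : Tendsto (fun r : ℝ => (r : ℂ) * Complex.I) (𝓝[>] 0) (𝓝 0) :=
    tendsto_real_mul_nhds_zero _
  refine tendsto_nhds_unique_of_eventuallyEq (hf.tendsto.comp ht) (hg.tendsto.comp ht) ?_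
  filter_upwards [ht.eventually h, self_mem_nhdsWithin] with r hr hr'
  exact hr (by simpa using hr')

/-- Here `t ^ k` is the exact common factor of the extensions of `a ^ n` and `b ^ n`. From `(ab) ^ n
= (w/(2γ)) ^ n`, the order `n N` of `w ^ n` is at least `2 k`, with equality exactly when both
cofactors are non-zero at `0`. The alternative separates `w` of size `|t|^{2k/n}` from `w` of
smaller size. -/
theorem IsBoundaryDisc.exists_orders (h : IsBoundaryDisc γ lam z w r) (hγ : 1 < γ)
    (hα : Real.cos α = -1 / γ) (hsin : Real.sin α ≠ 0) (hn : Even n) (hn0 : 0 < n)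
    (he : Complex.exp ((α / 2 : ℝ) * Complex.I) ^ n = 1) :
    ∃ (k N : ℕ) (p q W W₁ : ℂ → ℂ), 0 < k ∧ 0 < N ∧ AnalyticAt ℂ p 0 ∧ AnalyticAt ℂ q 0 ∧
      AnalyticAt ℂ W 0 ∧ AnalyticAt ℂ W₁ 0 ∧ p 0 ≠ 0 ∧
      ((q 0 ≠ 0 ∧ n * N = 2 * k ∧ W₁ 0 ≠ 0) ∨ (q 0 = 0 ∧ 2 * k < n * N)) ∧
      (∀ t, 0 ≤ t.im → W t = w t) ∧ (∀ᶠ t in 𝓝 0, W t = t ^ N * W₁ t) ∧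
      ∀ᶠ t in 𝓝 0, 0 ≤ t.im → ∀ a b : ℂ, a + b = Real.sin α * z t → a * b = w t / (2 * γ) →
        (a ^ n = t ^ k * p t ∧ b ^ n = t ^ k * q t) ∨
          (a ^ n = t ^ k * q t ∧ b ^ n = t ^ k * p t) := by
  obtain ⟨P, Q, W, hP, hQ, hW, hP0, hQ0, hWw, hPQ⟩ := h.exists_powers hγ hα hn hn0 he
  have hmem : ball (0 : ℂ) r ∈ 𝓝 0 := ball_mem_nhds 0 h.pos
  have hγ' : (2 * (γ : ℂ)) ≠ 0 := by
    have : (γ : ℂ) ≠ 0 := by exact_mod_cast (by positivity : γ ≠ 0)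
    simpa using this
  have hsin' : (Real.sin α : ℂ) ≠ 0 := by exact_mod_cast hsin
  -- Otherwise `a = b = 0`, so `z` and `w` would vanish together at interior points, against
  -- `ne_zero`.
  have hnot : ¬ ((∀ᶠ t in 𝓝 0, P t = 0) ∧ ∀ᶠ t in 𝓝 0, Q t = 0) := by
    rintro ⟨h1, h2⟩
    have ht : Tendsto (fun r : ℝ => (r : ℂ) * Complex.I) (𝓝[>] 0) (𝓝 0) :=
      tendsto_real_mul_nhds_zero _
    obtain ⟨x, hx, hx0⟩ := ((ht.eventually (h1.and (h2.and (hPQ.and hmem)))).and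
      self_mem_nhdsWithin).exists
    obtain ⟨e1, e2, e3, e4⟩ := hx
    have him : 0 < ((x : ℂ) * Complex.I).im := by simpa using hx0
    obtain ⟨a, b, hab, hab'⟩ := exists_add_eq_mul_eq (Real.sin α * z (x * Complex.I))
      (w (x * Complex.I) / (2 * γ))
    have h5 := e3 him.le a b hab hab'
    rw [e1, e2] at h5
    have h6 : a = 0 ∧ b = 0 := by
      rcases h5 with h5 | h5 <;> exact ⟨eq_zero_of_pow_eq_zero h5.1, eq_zero_of_pow_eq_zero h5.2⟩
    rw [h6.1, h6.2] at hab hab'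
    have h7 : z (x * Complex.I) = 0 := by
      have : (Real.sin α : ℂ) * z (x * Complex.I) = 0 := by rw [← hab, add_zero]
      exact (mul_eq_zero.1 this).resolve_left hsin'
    refine h.ne_zero _ e4 him h7 ?_
    have : w (x * Complex.I) / (2 * γ) = 0 := by rw [← hab', mul_zero]
    exact (div_eq_zero_iff.1 this).resolve_right hγ'
  obtain ⟨k, p, q, hp, hq, hpq, hPk, hQk⟩ := hP.exists_pow_dvd_pair hQ hnot
  have hk : 0 < k := by
    rcases Nat.eq_zero_or_pos k with rfl | hk
    · have h1 := hPk.self_of_nhds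
      have h2 := hQk.self_of_nhds
      simp only [pow_zero, one_mul] at h1 h2
      rw [hP0] at h1; rw [hQ0] at h2
      rcases hpq with h3 | h3
      · exact absurd h1.symm h3
      · exact absurd h2.symm h3
    · exact hk
  have hpq' : ∀ᶠ t in 𝓝 0, 0 ≤ t.im → ∀ a b : ℂ, a + b = Real.sin α * z t →
      a * b = w t / (2 * γ) → (a ^ n = t ^ k * p t ∧ b ^ n = t ^ k * q t) ∨
          (a ^ n = t ^ k * q t ∧ b ^ n = t ^ k * p t) := by
    filter_upwards [hPQ, hPk, hQk] with t h1 h2 h3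
    rw [← h2, ← h3]; exact h1
  clear hPQ hPk hQk hnot
  wlog hp0 : p 0 ≠ 0 generalizing p q with H
  · refine H q p hq hp hpq.symm ?_ (hpq.resolve_left hp0)
    filter_upwards [hpq'] with t ht h0 a b hab hab'
    exact (ht h0 a b hab hab').symm
  have hWn : ∀ᶠ t in 𝓝 (0 : ℂ), 0 < t.im →
      W t ^ n = (2 * γ) ^ n * (t ^ (2 * k) * (p t * q t)) := by
    filter_upwards [hpq'] with t ht h0
    obtain ⟨a, b, hab, hab'⟩ := exists_add_eq_mul_eq (Real.sin α * z t) (w t / (2 * γ))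
    have h1 : (a * b) ^ n = t ^ (2 * k) * (p t * q t) := by
      rcases ht h0.le a b hab hab' with ⟨h5, h6⟩ | ⟨h5, h6⟩ <;>
        · rw [mul_pow, h5, h6]; ring
    rw [← h1, hab', hWw t h0.le, ← mul_pow, mul_div_cancel₀ _ hγ']
  have hne : ∀ t : ℂ, 0 < t.im → t ≠ 0 := fun t ht h0 => by simp [h0] at ht
  rcases hW.exists_eventually_eq_pow_mul with hW0 | ⟨N, W₁, hW₁, hW₁0, hN⟩
  · have hq0 : q 0 = 0 := by
      have h1 := eq_at_zero_of_eventually_eq (f := fun t => p t * q t) (g := fun _ => 0)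
        (hp.continuousAt.mul hq.continuousAt) continuousAt_const (by
          filter_upwards [hWn, hW0] with t h1 h2 h3
          have h4 := h1 h3
          rw [h2, zero_pow hn0.ne'] at h4
          have h5 := (mul_eq_zero.1 h4.symm).resolve_left (pow_ne_zero _ hγ')
          exact (mul_eq_zero.1 h5).resolve_left (pow_ne_zero _ (hne t h3)))
      exact (mul_eq_zero.1 h1).resolve_left hp0
    -- When `W` vanishes identically it has no order; `2 * k + 1` with zero cofactor is one choice
    -- satisfying `2 k < n N`.
    refine ⟨k, 2 * k + 1, p, q, W, fun _ => 0, hk, by omega, hp, hq, hW, analyticAt_const, hp0,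
      Or.inr ⟨hq0, ?_⟩, hWw, ?_, hpq'⟩
    · nlinarith
    · filter_upwards [hW0] with t ht
      rw [ht, mul_zero]
  · have hNW : ∀ᶠ t in 𝓝 (0 : ℂ), 0 < t.im →
        t ^ (n * N) * W₁ t ^ n = (2 * γ) ^ n * (t ^ (2 * k) * (p t * q t)) := by
      filter_upwards [hWn, hN] with t h1 h2 h3
      rw [← h1 h3, h2]; ring
    have hcW : ContinuousAt (fun t => W₁ t ^ n) 0 := hW₁.continuousAt.pow n
    have hcpq : ContinuousAt (fun t => (2 * (γ : ℂ)) ^ n * (p t * q t)) 0 :=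
      continuousAt_const.mul (hp.continuousAt.mul hq.continuousAt)
    have hNpos : 0 < N := by
      rcases Nat.eq_zero_or_pos N with rfl | hN'
      · have h1 := hN.self_of_nhds
        rw [hWw 0 (by simp), h.w_zero, pow_zero, one_mul] at h1
        exact absurd h1.symm hW₁0
      · exact hN'
    rcases lt_trichotomy (n * N) (2 * k) with hlt | heq | hgt
    · exfalso
      obtain ⟨d, hd⟩ := Nat.exists_eq_add_of_lt hlt
      have h1 := eq_at_zero_of_eventually_eq (f := fun t => W₁ t ^ n)
        (g := fun t => t ^ (d + 1) * ((2 * (γ : ℂ)) ^ n * (p t * q t))) hcW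
        ((continuousAt_id.pow _).mul hcpq) (by
          filter_upwards [hNW] with t h1 h2
          have h3 := h1 h2
          rw [hd] at h3
          have h4 : t ^ (n * N) ≠ 0 := pow_ne_zero _ (hne t h2)
          apply mul_left_cancel₀ h4
          rw [h3]; ring)
      simp only [zero_pow (Nat.succ_ne_zero d), zero_mul] at h1
      exact pow_ne_zero n hW₁0 h1
    · have h1 := eq_at_zero_of_eventually_eq (f := fun t => W₁ t ^ n)
        (g := fun t => ((2 * (γ : ℂ)) ^ n * (p t * q t))) hcW hcpq (by
          filter_upwards [hNW] with t h1 h2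
          have h3 := h1 h2
          rw [heq] at h3
          have h4 : t ^ (2 * k) ≠ 0 := pow_ne_zero _ (hne t h2)
          apply mul_left_cancel₀ h4
          rw [h3]; ring)
      refine ⟨k, N, p, q, W, W₁, hk, hNpos, hp, hq, hW, hW₁, hp0, Or.inl ⟨?_, heq, hW₁0⟩, hWw, hN,
        hpq'⟩
      intro h0
      simp only [h0, mul_zero] at h1
      exact pow_ne_zero n hW₁0 h1
    · obtain ⟨d, hd⟩ := Nat.exists_eq_add_of_lt hgt
      have h1 := eq_at_zero_of_eventually_eq (f := fun t => ((2 * (γ : ℂ)) ^ n * (p t * q t)))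
        (g := fun t => t ^ (d + 1) * W₁ t ^ n) hcpq ((continuousAt_id.pow _).mul hcW) (by
          filter_upwards [hNW] with t h1 h2
          have h3 := h1 h2
          rw [hd] at h3
          have h4 : t ^ (2 * k) ≠ 0 := pow_ne_zero _ (hne t h2)
          apply mul_left_cancel₀ h4
          rw [mul_left_comm, ← h3]; ring)
      simp only [zero_pow (Nat.succ_ne_zero d), zero_mul] at h1
      refine ⟨k, N, p, q, W, W₁, hk, hNpos, hp, hq, hW, hW₁, hp0, Or.inr ⟨?_, hgt⟩, hWw, hN, hpq'⟩
      exact (mul_eq_zero.1 ((mul_eq_zero.1 h1).resolve_left (pow_ne_zero _ hγ'))).resolve_left hp0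

theorem polar_pow_mul (r φ : ℝ) (k : ℕ) (u : ℂ) :
    ((r : ℂ) * Complex.exp (φ * Complex.I)) ^ k * u =
      ((r ^ k : ℝ) : ℂ) * (Complex.exp ((k * φ : ℝ) * Complex.I) * u) := by
  rw [pow_polar, mul_assoc]

theorem exp_two_mul_eq_sq (k : ℕ) (φ : ℝ) :
    Complex.exp (((2 * k : ℕ) * φ : ℝ) * Complex.I) =
      Complex.exp ((k * φ : ℝ) * Complex.I) ^ 2 := by
  rw [← Complex.exp_nat_mul]; push_cast; ring_nf

/-- The Levi condition for the leading terms. -/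
theorem IsBoundaryDisc.levi_limit (h : IsBoundaryDisc γ lam z w r) (hn0 : 0 < n) {k : ℕ}
    {Z Ω : ℂ → ℂ} {c w₀ : ℂ} (hZ : Tendsto Z (𝓝[closedSector n] 0) (𝓝 c))
    (hΩ : Tendsto Ω (𝓝[closedSector n] 0) (𝓝 w₀))
    (hz : ∀ᶠ s in 𝓝[closedSector n] 0, z (s ^ n) = s ^ k * Z s)
    (hw : ∀ᶠ s in 𝓝[closedSector n] 0, w (s ^ n) = s ^ (2 * k) * Ω s)
    {φ : ℝ} (hφ : φ ∈ Icc 0 (Real.pi / n)) :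
    lam (Complex.exp ((k * φ : ℝ) * Complex.I) ^ 2 * w₀) +
      quadric γ (Complex.exp ((k * φ : ℝ) * Complex.I) * c) ≤ 0 := by
  set E := Complex.exp ((k * φ : ℝ) * Complex.I) with hE
  have ht := tendsto_polar_closedSector hφ
  have hZ' := hZ.comp ht
  have hΩ' := hΩ.comp ht
  -- The inequality is homogeneous with `z` of weight `k` and `w` of weight `2k`: dividing by `ρ ^
  -- (2 * k)` and letting `ρ → 0` along a ray leaves only the leading coefficients.
  have key : ∀ ε > 0, lam (E ^ 2 * w₀) + quadric γ (E * c) ≤ ε * (‖c‖ ^ 2 + ‖w₀‖) := by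
    intro ε hε
    have hL := (tendsto_pow_closedSector hn0).eventually (h.levi ε hε)
    refine le_of_tendsto_of_tendsto
      ((lam.continuous.tendsto _ |>.comp (hΩ'.const_mul (E ^ 2))).add
        ((continuous_quadric γ).tendsto _ |>.comp (hZ'.const_mul E)))
      (((hZ'.norm.pow 2).add hΩ'.norm).const_mul ε) ?_
    filter_upwards [ht.eventually hL, ht.eventually hz, ht.eventually hw, self_mem_nhdsWithin]
      with ρ h1 h2 h3 h4
    have h4' : (0 : ℝ) < ρ := h4
    have hlam : ∀ (x : ℝ) (u : ℂ), lam (x * u) = x * lam u := fun x u => by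
      rw [← Complex.real_smul, map_smul, smul_eq_mul]
    rw [h2, h3, polar_pow_mul, polar_pow_mul, exp_two_mul_eq_sq, ← hE, quadric_real_mul,
      hlam, norm_mul, norm_mul E, norm_mul, norm_mul (E ^ 2), norm_pow E,
      hE, Complex.norm_exp_ofReal_mul_I, ← hE, Complex.norm_real, Complex.norm_real,
      Real.norm_of_nonneg (by positivity), Real.norm_of_nonneg (by positivity)] at h1
    have h5 : (0 : ℝ) < ρ ^ (2 * k) := by positivity
    simp only [Function.comp_apply]
    refine le_of_mul_le_mul_left ?_ h5
    calc _ ≤ _ := le_of_eq ?_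
      _ ≤ _ := h1
      _ = _ := ?_
    · ring
    · ring
  have h0 : 0 ≤ ‖c‖ ^ 2 + ‖w₀‖ := by positivity
  by_contra! hlt
  have h1 := key ((lam (E ^ 2 * w₀) + quadric γ (E * c)) / (2 * (‖c‖ ^ 2 + ‖w₀‖ + 1)))
    (by positivity)
  set A := lam (E ^ 2 * w₀) + quadric γ (E * c)
  set B := ‖c‖ ^ 2 + ‖w₀‖
  rw [div_mul_eq_mul_div, le_div_iff₀ (by positivity)] at h1
  nlinarith

/-- The boundary condition for the leading terms. -/
theorem IsBoundaryDisc.boundary_limit (h : IsBoundaryDisc γ lam z w r) (hn0 : 0 < n) {k : ℕ}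
    {Z Ω : ℂ → ℂ} {c w₀ : ℂ} (hZ : Tendsto Z (𝓝[closedSector n] 0) (𝓝 c))
    (hΩ : Tendsto Ω (𝓝[closedSector n] 0) (𝓝 w₀))
    (hz : ∀ᶠ s in 𝓝[closedSector n] 0, z (s ^ n) = s ^ k * Z s)
    (hw : ∀ᶠ s in 𝓝[closedSector n] 0, w (s ^ n) = s ^ (2 * k) * Ω s)
    {φ : ℝ} (hφ : φ = 0 ∨ φ = Real.pi / n) :
    Complex.exp ((k * φ : ℝ) * Complex.I) ^ 2 * w₀ =
      quadric γ (Complex.exp ((k * φ : ℝ) * Complex.I) * c) := by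
  set E := Complex.exp ((k * φ : ℝ) * Complex.I) with hE
  have hn' : (n : ℝ) ≠ 0 := by exact_mod_cast hn0.ne'
  have hφ' : φ ∈ Icc 0 (Real.pi / n) := by
    rcases hφ with rfl | rfl
    · exact ⟨le_rfl, by positivity⟩
    · exact ⟨by positivity, le_rfl⟩
  -- The two edges of the sector are sent by `s ↦ s ^ n` into the real axis, where the boundary
  -- condition holds.
  have hreal : ∀ ρ : ℝ, ∃ x : ℝ, ((ρ : ℂ) * Complex.exp (φ * Complex.I)) ^ n = x := by
    intro ρ
    rw [pow_polar]
    rcases hφ with rfl | rfl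
    · exact ⟨ρ ^ n, by simp⟩
    · refine ⟨-ρ ^ n, ?_⟩
      rw [mul_div_cancel₀ _ hn', Complex.exp_pi_mul_I]
      push_cast; ring
  have ht := tendsto_polar_closedSector hφ'
  have hZ' := hZ.comp ht
  have hΩ' := hΩ.comp ht
  refine tendsto_nhds_unique_of_eventuallyEq (hΩ'.const_mul (E ^ 2))
    ((Complex.continuous_ofReal.comp (continuous_quadric γ)).tendsto _ |>.comp
      (hZ'.const_mul E)) ?_
  have hball := ((tendsto_pow_closedSector hn0).mono_right nhdsWithin_le_nhds).eventually
    (ball_mem_nhds (0 : ℂ) h.pos)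
  filter_upwards [ht.eventually hball, ht.eventually hz, ht.eventually hw, self_mem_nhdsWithin]
    with ρ h1 h2 h3 h4
  have h4' : (0 : ℝ) < ρ := h4
  obtain ⟨x, hx⟩ := hreal ρ
  rw [hx] at h1
  have h5 := h.boundary x h1
  rw [← hx, h2, h3, polar_pow_mul, polar_pow_mul, exp_two_mul_eq_sq, ← hE, quadric_real_mul] at h5
  have h6 : ((ρ ^ (2 * k) : ℝ) : ℂ) ≠ 0 := by exact_mod_cast (by positivity : ρ ^ (2 * k) ≠ 0)
  apply mul_left_cancel₀ h6
  simp only [Function.comp_apply]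
  rw [h5]
  push_cast
  ring

end

/-! ### Convergent series in `s`, and the direction of the leading term -/

section

variable {γ α r : ℝ} {lam : ℂ →L[ℝ] ℝ} {z w : ℂ → ℂ} {n : ℕ}

theorem eventually_pow_closedSector (hn : 0 < n) {p : ℂ → Prop} (h : ∀ᶠ t in 𝓝 (0 : ℂ), p t) :
    ∀ᶠ s in 𝓝[closedSector n] 0, p (s ^ n) :=
  ((tendsto_pow_closedSector hn).mono_right nhdsWithin_le_nhds).eventually h

theorem tendsto_comp_pow_closedSector (hn : 0 < n) {f : ℂ → ℂ} (h : ContinuousAt f 0) :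
    Tendsto (fun s => f (s ^ n)) (𝓝[closedSector n] 0) (𝓝 (f 0)) :=
  h.tendsto.comp ((tendsto_pow_closedSector hn).mono_right nhdsWithin_le_nhds)

theorem IsBoundaryDisc.continuousOn_div_pow (h : IsBoundaryDisc γ lam z w r) (hn : 0 < n) (k : ℕ) :
    ContinuousOn (fun s => z (s ^ n) / s ^ k) (closedSector n ∩ ball 0 (min 1 r)) := by
  refine ContinuousOn.div ?_ (by fun_prop) fun s hs => pow_ne_zero _ (ne_zero_of_mem_closedSector hs.1)
  refine h.continuousOn_z.comp (by fun_prop) ?_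
  rintro s ⟨hs, hs'⟩
  refine ⟨?_, im_pow_nonneg_of_mem_closedSector hn hs⟩
  rw [mem_ball_zero_iff] at hs' ⊢
  rw [norm_pow]
  calc ‖s‖ ^ n ≤ ‖s‖ ^ 1 := pow_le_pow_of_le_one (norm_nonneg _)
        (hs'.le.trans (min_le_left _ _)) hn
    _ = ‖s‖ := pow_one _
    _ < r := hs'.trans_le (min_le_right _ _)

/-- After the substitution `t = s ^ n`, an analytic disc is given by convergent power series. -/
theorem IsBoundaryDisc.exists_puiseux (h : IsBoundaryDisc γ lam z w r) (hγ : 1 < γ)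
    (hα : Real.cos α = -1 / γ) (hsin : Real.sin α ≠ 0) (hn : Even n) (hn0 : 0 < n)
    (he : Complex.exp ((α / 2 : ℝ) * Complex.I) ^ n = 1) :
    ∃ (k : ℕ) (V W : ℂ → ℂ), 0 < k ∧ AnalyticAt ℂ V 0 ∧ AnalyticAt ℂ W 0 ∧ V 0 ≠ 0 ∧ W 0 = 0 ∧
      (∀ t, 0 ≤ t.im → W t = w t) ∧
      (∀ᶠ s in 𝓝[closedSector n] 0, z (s ^ n) = s ^ k * V s) ∧
      (∀ φ ∈ Icc 0 (Real.pi / n), quadric γ (Complex.exp ((k * φ : ℝ) * Complex.I) * V 0) ≤ 0) ∧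
      quadric γ (V 0) = 0 ∧
      quadric γ (Complex.exp ((k * (Real.pi / n) : ℝ) * Complex.I) * V 0) = 0 := by
  obtain ⟨k, N, p, q, W, W₁, hk, hN, hp, hq, hW, hW₁, hp0, hcase, hWw, hWN, hab⟩ :=
    h.exists_orders hγ hα hsin hn hn0 he
  have hγ' : (2 * (γ : ℂ)) ≠ 0 := by
    have : (γ : ℂ) ≠ 0 := by exact_mod_cast (by positivity : γ ≠ 0)
    simpa using this
  have hsin' : (Real.sin α : ℂ) ≠ 0 := by exact_mod_cast hsin
  have hle : 2 * k ≤ n * N := by omega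
  obtain ⟨d, hd⟩ := Nat.exists_eq_add_of_le hle
  have hne := neBot_nhdsWithin_closedSector n
  have hS0 : ∀ᶠ s in 𝓝[closedSector n] (0 : ℂ), s ≠ 0 ∧ 0 ≤ (s ^ n).im := by
    filter_upwards [self_mem_nhdsWithin] with s hs
    exact ⟨ne_zero_of_mem_closedSector hs, im_pow_nonneg_of_mem_closedSector hn0 hs⟩
  have hid : Tendsto (fun s : ℂ => s) (𝓝[closedSector n] 0) (𝓝 0) :=
    tendsto_id.mono_left nhdsWithin_le_nhds
  -- With `d = n N - 2 k`, the factorisation `W = t ^ N W₁` reads `w (s ^ n) = s ^ (2 * k) * Ω s`.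
  set Ω : ℂ → ℂ := fun s => s ^ d * W₁ (s ^ n) with hΩdef
  have hΩ : Tendsto Ω (𝓝[closedSector n] 0) (𝓝 (0 ^ d * W₁ 0)) :=
    (hid.pow d).mul (tendsto_comp_pow_closedSector hn0 hW₁.continuousAt)
  have hwΩ : ∀ᶠ s in 𝓝[closedSector n] 0, w (s ^ n) = s ^ (2 * k) * Ω s := by
    filter_upwards [hS0, eventually_pow_closedSector hn0 hWN] with s h1 h2
    rw [← hWw _ h1.2, h2, ← pow_mul, hd, pow_add, mul_assoc]
  set Z : ℂ → ℂ := fun s => z (s ^ n) / s ^ k with hZdef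
  have hzZ : ∀ᶠ s in 𝓝[closedSector n] 0, z (s ^ n) = s ^ k * Z s := by
    filter_upwards [hS0] with s h1
    simp only [hZdef]
    rw [mul_div_cancel₀ _ (pow_ne_zero _ h1.1)]
  -- The rescaled numbers `a / s ^ k`, `b / s ^ k`, labelled so that the first has `n`-th power `p
  -- (s ^ n)`. Nothing makes this choice continuous in `s`.
  obtain ⟨U, hU⟩ : ∃ U : ℂ → ℂ × ℂ, ∀ᶠ s in 𝓝[closedSector n] 0,
      (U s).1 + (U s).2 = Real.sin α * Z s ∧ (U s).1 * (U s).2 = Ω s / (2 * γ) ∧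
      (U s).1 ^ n = p (s ^ n) ∧ (U s).2 ^ n = q (s ^ n) := by
    refine Filter.Eventually.choice (r := fun (s : ℂ) (u : ℂ × ℂ) =>
      u.1 + u.2 = Real.sin α * Z s ∧ u.1 * u.2 = Ω s / (2 * γ) ∧
      u.1 ^ n = p (s ^ n) ∧ u.2 ^ n = q (s ^ n)) ?_
    filter_upwards [hS0, hwΩ, hzZ, eventually_pow_closedSector hn0 hab] with s h1 h2 h3 h4
    have hsk : s ^ k ≠ 0 := pow_ne_zero _ h1.1
    obtain ⟨a, b, h5, h6⟩ := exists_add_eq_mul_eq (Real.sin α * z (s ^ n)) (w (s ^ n) / (2 * γ))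
    have h7 := h4 h1.2 a b h5 h6
    have hdivn : ∀ x y : ℂ, x ^ n = (s ^ n) ^ k * y → (x / s ^ k) ^ n = y := by
      intro x y hxy
      rw [div_pow, hxy, ← pow_mul, ← pow_mul, mul_comm k n, mul_div_cancel_left₀]
      exact pow_ne_zero _ h1.1
    have h8 : a / s ^ k + b / s ^ k = Real.sin α * Z s := by
      rw [← add_div, h5, h3]; field_simp
    have h9 : a / s ^ k * (b / s ^ k) = Ω s / (2 * γ) := by
      rw [div_mul_div_comm, h6, h2, ← pow_add, ← two_mul]
      have := pow_ne_zero (2 * k) h1.1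
      field_simp
    rcases h7 with h7 | h7
    · exact ⟨(a / s ^ k, b / s ^ k), h8, h9, hdivn _ _ h7.1, hdivn _ _ h7.2⟩
    · exact ⟨(b / s ^ k, a / s ^ k), by rw [add_comm]; exact h8, by rw [mul_comm]; exact h9,
        hdivn _ _ h7.2, hdivn _ _ h7.1⟩
  -- Unlike `U`, the quotient `Z` is continuous. Its values approach the finitely many numbers `(x +
  -- y) / sin α` with `x ^ n = p 0`, `y ^ n = q 0`, so connectedness of the sector makes it
  -- converge.
  obtain ⟨c, hcA, hZc⟩ : ∃ c ∈ (fun x : ℂ × ℂ => (x.1 + x.2) / Real.sin α) ''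
      ({x | x ^ n = p 0} ×ˢ {y | y ^ n = q 0}), Tendsto Z (𝓝[closedSector n] 0) (𝓝 c) := by
    refine exists_tendsto_of_approaches_finite
      (((finite_setOf_pow_eq hn0 _).prod (finite_setOf_pow_eq hn0 _)).image _)
      (fun r _ => isPreconnected_closedSector_inter_ball n r) hne
      (lt_min one_pos h.pos) (h.continuousOn_div_pow hn0 k) ?_
    intro ε hε
    have hε' : 0 < ε * ‖(Real.sin α : ℂ)‖ / 2 := by
      have := norm_pos_iff.2 hsin'
      positivity
    obtain ⟨δ₁, hδ₁, h1⟩ := exists_pow_eq_dist_lt hn0 (p 0) hε'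
    obtain ⟨δ₂, hδ₂, h2⟩ := exists_pow_eq_dist_lt hn0 (q 0) hε'
    filter_upwards [hU,
      (tendsto_comp_pow_closedSector hn0 hp.continuousAt).eventually (ball_mem_nhds _ hδ₁),
      (tendsto_comp_pow_closedSector hn0 hq.continuousAt).eventually (ball_mem_nhds _ hδ₂)]
      with s h3 h4 h5
    obtain ⟨e1, e2, e3, e4⟩ := h3
    obtain ⟨x, hx, hx'⟩ := h1 _ (e3 ▸ h4)
    obtain ⟨y, hy, hy'⟩ := h2 _ (e4 ▸ h5)
    refine ⟨_, ⟨(x, y), ⟨hx, hy⟩, rfl⟩, ?_⟩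
    have h6 : Z s = ((U s).1 + (U s).2) / Real.sin α := by
      rw [e1, mul_div_cancel_left₀ _ hsin']
    rw [h6, dist_eq_norm, ← sub_div, norm_div, div_lt_iff₀ (norm_pos_iff.2 hsin'), ← dist_eq_norm]
    calc _ ≤ dist (U s).1 x + dist (U s).2 y := dist_add_add_le _ _ _ _
      _ < _ := by linarith
  obtain ⟨⟨x, y⟩, ⟨hx, hy⟩, hxy⟩ := hcA
  simp only [mem_ofPred_eq] at hx hy
  have hlevi := fun φ hφ => h.levi_limit hn0 hZc hΩ hzZ hwΩ (φ := φ) hφ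
  have hbd := fun φ hφ => h.boundary_limit hn0 hZc hΩ hzZ hwΩ (φ := φ) hφ
  rcases hcase with ⟨hq0, hnN, hW₁0⟩ | ⟨hq0, hnN⟩
  -- Since `n ≤ 2 k`, the sector contains the ray on which `s ^ k` has turned by `i`. The Levi
  -- inequality there, with `w₀ = ψ(c)` from the edge `φ = 0`, gives `ψ(c) + ψ(ic) = 2|c|² ≤ 0`; so
  -- `c = 0`, and the leading coefficient `ψ(c)` of `w` vanishes, a contradiction.
  · exfalso
    have hd0 : d = 0 := by omega
    rw [hd0, pow_zero, one_mul] at hlevi hbd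
    have h1 := hbd 0 (Or.inl rfl)
    simp only [mul_zero, Complex.ofReal_zero, zero_mul, Complex.exp_zero, one_pow, one_mul] at h1
    have hk' : (0 : ℝ) < k := by exact_mod_cast hk
    have hn' : (0 : ℝ) < n := by exact_mod_cast hn0
    have h2 := hlevi (Real.pi / (2 * k)) ⟨by positivity, by
      apply div_le_div_of_nonneg_left Real.pi_pos.le hn'
      have : n ≤ 2 * k := by rw [← hnN]; exact Nat.le_mul_of_pos_right n hN
      exact_mod_cast this⟩
    have h3 : Complex.exp (((k * (Real.pi / (2 * k)) : ℝ) : ℂ) * Complex.I) = Complex.I := by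
      rw [show (k * (Real.pi / (2 * k)) : ℝ) = Real.pi / 2 by field_simp]
      push_cast
      exact Complex.exp_pi_div_two_mul_I
    rw [h3, Complex.I_sq, neg_one_mul, map_neg, h1] at h2
    have h4 : lam ((quadric γ c : ℝ) : ℂ) = - quadric γ c := by
      have : ((quadric γ c : ℝ) : ℂ) = (quadric γ c) • (1 : ℂ) := by simp
      rw [this, map_smul, h.lam_one, smul_eq_mul, mul_neg_one]
    rw [h4, neg_neg, quadric_add_quadric_I_mul] at h2
    have h5 : c = 0 := by
      have := Complex.normSq_nonneg c
      exact Complex.normSq_eq_zero.1 (by linarith)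
    rw [h5, quadric_zero] at h1
    exact hW₁0 (by simpa using h1)
  · have hd0 : d ≠ 0 := by omega
    rw [zero_pow hd0, zero_mul] at hlevi hbd hΩ
    simp only [mul_zero, map_zero, zero_add] at hlevi hbd
    have hy0 : y = 0 := by rw [hq0] at hy; exact eq_zero_of_pow_eq_zero hy
    have hx0 : x ≠ 0 := by
      rintro rfl
      rw [zero_pow hn0.ne'] at hx
      exact hp0 hx.symm
    have hcx : c = x / Real.sin α := by rw [← hxy, hy0]; simp
    obtain ⟨ϖ, hϖ, hϖ0, hϖp⟩ := hp.exists_pow_eq_of_ne_zero hn0 hx hp0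
    have hϖt := tendsto_comp_pow_closedSector hn0 hϖ.continuousAt
    rw [hϖ0] at hϖt
    -- Its `n`-th power tends to `q 0 = 0`. Convergence of `Z` then passes to the first component of
    -- `U`.
    have hv : Tendsto (fun s => (U s).2) (𝓝[closedSector n] 0) (𝓝 0) := by
      have hqt := tendsto_comp_pow_closedSector hn0 hq.continuousAt
      rw [hq0] at hqt
      rw [Metric.tendsto_nhds]
      intro ε hε
      filter_upwards [hU, Metric.tendsto_nhds.1 hqt (ε ^ n) (by positivity)] with s h1 h2
      rw [← h1.2.2.2, dist_zero_right, norm_pow] at h2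
      rw [dist_zero_right]
      exact lt_of_pow_lt_pow_left₀ n hε.le h2
    have hu : Tendsto (fun s => (U s).1) (𝓝[closedSector n] 0) (𝓝 x) := by
      have h1 : Tendsto (fun s => Real.sin α * Z s - (U s).2) (𝓝[closedSector n] 0)
          (𝓝 (Real.sin α * c - 0)) := (hZc.const_mul _).sub hv
      rw [hcx, mul_div_cancel₀ _ hsin', sub_zero] at h1
      refine h1.congr' ?_
      filter_upwards [hU] with s h2
      rw [← h2.1]; ring
    have hratio : Tendsto (fun s => (U s).1 / ϖ (s ^ n)) (𝓝[closedSector n] 0) (𝓝 1) := by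
      have := hu.div hϖt hx0
      rwa [div_self hx0] at this
    -- The ratio of `(U s).1` to the analytic root `ϖ (s ^ n)` is an `n`-th root of unity tending to
    -- `1`, hence eventually `1`.
    have hroots : ({y : ℂ | y ^ n = 1} \ {1})ᶜ ∈ 𝓝 (1 : ℂ) :=
      ((finite_setOf_pow_eq hn0 1).subset sdiff_subset).isClosed.isOpen_compl.mem_nhds (by simp)
    have huϖ : ∀ᶠ s in 𝓝[closedSector n] 0, (U s).1 = ϖ (s ^ n) ∧ ϖ (s ^ n) ≠ 0 := by
      filter_upwards [hU, eventually_pow_closedSector hn0 hϖp, hratio.eventually hroots,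
        hϖt.eventually_ne hx0] with s h1 h2 h3 h4
      refine ⟨?_, h4⟩
      have h5 : ((U s).1 / ϖ (s ^ n)) ^ n = 1 := by
        rw [div_pow, h1.2.2.1, h2, div_self]
        rw [← h2]; exact pow_ne_zero _ h4
      by_contra h6
      exact h3 ⟨h5, fun h7 => h6 ((div_eq_one_iff_eq h4).1 h7)⟩
    -- The first component is now analytic; the second is the product `Ω / (2γ)` divided by it, and
    -- their sum is `sin α · Z`.
    set V : ℂ → ℂ := fun s => (ϖ (s ^ n) + Ω s / (2 * γ) / ϖ (s ^ n)) / Real.sin α with hVdef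
    have hpow : AnalyticAt ℂ (fun s : ℂ => s ^ n) 0 := analyticAt_id.pow n
    have hϖa : AnalyticAt ℂ (fun s => ϖ (s ^ n)) 0 :=
      AnalyticAt.comp (g := ϖ) (by simpa [hn0.ne'] using hϖ) hpow
    have hΩa : AnalyticAt ℂ Ω 0 := (analyticAt_id.pow d).mul
      (AnalyticAt.comp (g := W₁) (by simpa [hn0.ne'] using hW₁) hpow)
    have hϖz : ϖ (0 ^ n) = x := by rw [zero_pow hn0.ne', hϖ0]
    have hVa : AnalyticAt ℂ V 0 :=
      (hϖa.add ((hΩa.div analyticAt_const hγ').div hϖa (by rw [hϖz]; exact hx0))).div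
        analyticAt_const hsin'
    have hV0 : V 0 = c := by
      simp only [hVdef, hΩdef]
      rw [zero_pow hn0.ne', zero_pow hd0, hϖ0, hcx]; simp
    have hc0 : c ≠ 0 := by rw [hcx]; exact div_ne_zero hx0 hsin'
    refine ⟨k, V, W, hk, hVa, hW, hV0 ▸ hc0, ?_, hWw, ?_, ?_, ?_, ?_⟩
    · rw [hWw 0 (by simp), h.w_zero]
    · filter_upwards [hU, huϖ, hzZ] with s h1 h2 h3
      rw [h3]
      congr 1
      obtain ⟨e1, e2, -, -⟩ := h1
      simp only [hVdef]
      rw [← e2, h2.1, mul_div_cancel_left₀ _ h2.2, ← h2.1, e1, mul_div_cancel_left₀ _ hsin']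
    · rw [hV0]; exact hlevi
    · rw [hV0]
      have := hbd 0 (Or.inl rfl)
      simpa using this.symm
    · rw [hV0]
      have := hbd (Real.pi / n) (Or.inr rfl)
      exact_mod_cast this.symm

/-- The directions in which the leading terms can point. -/
theorem arg_eq_of_quadric_nonpos {c : ℂ} {μ : ℝ} (hγ : 1 < γ) (hα : Real.cos α = -1 / γ)
    (hα₁ : Real.pi / 2 < α) (hα₂ : α < Real.pi) (hc : c ≠ 0) (hμ : 0 < μ)
    (hle : ∀ η ∈ Icc 0 μ, quadric γ (Complex.exp (η * Complex.I) * c) ≤ 0)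
    (h0 : quadric γ c = 0) (h1 : quadric γ (Complex.exp (μ * Complex.I) * c) = 0) :
    μ = Real.pi - α ∧ (c.arg = α / 2 ∨ c.arg = α / 2 - Real.pi) := by
  have hγ0 : 0 < γ := by linarith
  have hq : ∀ η : ℝ, quadric γ (Complex.exp (η * Complex.I) * c) =
      ‖c‖ ^ 2 * (1 + γ * Real.cos (2 * (c.arg + η))) := by
    intro η
    rw [← quadric_exp]
    congr 1
    conv_lhs => rw [← Complex.norm_mul_exp_arg_mul_I c]
    push_cast
    rw [add_mul, Complex.exp_add]; ring
  have hcn : 0 < ‖c‖ ^ 2 := by have := norm_pos_iff.2 hc; positivity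
  have hαγ : γ * Real.cos α = -1 := by rw [hα]; field_simp
  have hle' : ∀ η ∈ Icc 0 μ, Real.cos (2 * (c.arg + η)) ≤ Real.cos α := by
    intro η hη
    have h2 := hle η hη
    rw [hq] at h2
    have h3 : 1 + γ * Real.cos (2 * (c.arg + η)) ≤ 0 := by
      by_contra! h4
      exact absurd h2 (not_le.2 (mul_pos hcn h4))
    nlinarith
  have heq : ∀ η : ℝ, quadric γ (Complex.exp (η * Complex.I) * c) = 0 →
      Real.cos (2 * (c.arg + η)) = Real.cos α := by
    intro η h2
    rw [hq] at h2
    have h3 := (mul_eq_zero.1 h2).resolve_left hcn.ne'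
    have h4 : γ * (Real.cos (2 * (c.arg + η)) - Real.cos α) = 0 := by linarith
    exact sub_eq_zero.1 ((mul_eq_zero.1 h4).resolve_left hγ0.ne')
  have e0 := heq 0 (by simpa using h0)
  have e1 := heq μ h1
  rw [add_zero] at e0
  have ha1 := Complex.neg_pi_lt_arg c
  have ha2 := Complex.arg_le_pi c
  have hpi := Real.pi_pos
  have hcosgt : ∀ h : ℝ, 0 < h → h ≤ α / 4 → Real.cos α < Real.cos (α - 2 * h) := by
    intro h hh hh'
    apply Real.cos_lt_cos_of_nonneg_of_le_pi <;> linarith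
  -- `ψ ≤ 0` means that the cosine of the doubled angle is at most `cos α`. The motion starts at
  -- equality and increases the angle, so modulo `2π` it starts at `α`: from `-α` the cosine would
  -- grow at once. For the same reason it cannot pass `2π - α`, the next angle where equality holds.
  have harg : c.arg = α / 2 ∨ c.arg = α / 2 - Real.pi := by
    obtain ⟨j, hj⟩ := Real.cos_eq_cos_iff.1 e0.symm
    rcases hj with hj | hj
    · have hj0 : -2 < (j : ℝ) := by
        by_contra! h
        nlinarith
      have hj1 : (j : ℝ) < 1 := by
        by_contra! h
        nlinarith
      have : j = 0 ∨ j = -1 := by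
        have h2 : (-2 : ℤ) < j := by exact_mod_cast hj0
        have h3 : j < 1 := by exact_mod_cast hj1
        omega
      rcases this with rfl | rfl
      · left; push_cast at hj; linarith
      · right; push_cast at hj; linarith
    · exfalso
      have h2 := hle' (min μ (α / 4)) ⟨le_min hμ.le (by linarith), min_le_left _ _⟩
      have h3 := hcosgt (min μ (α / 4)) (lt_min hμ (by linarith)) (min_le_right _ _)
      have h4 : Real.cos (2 * (c.arg + min μ (α / 4))) = Real.cos (α - 2 * min μ (α / 4)) := by
        rw [Real.cos_eq_cos_iff]
        exact ⟨j, Or.inr (by linarith)⟩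
      linarith
  refine ⟨?_, harg⟩
  have hshift : ∀ η : ℝ, Real.cos (2 * (c.arg + η)) = Real.cos (α + 2 * η) := by
    intro η
    rcases harg with h2 | h2
    · rw [h2]; congr 1; ring
    · rw [h2, ← Real.cos_add_two_pi]; congr 1; ring
  simp only [hshift] at hle' e1
  have hμle : μ ≤ Real.pi - α := by
    by_contra! h2
    have h3 : 0 < min (μ - (Real.pi - α)) (α / 4) := lt_min (by linarith) (by linarith)
    have h4 := hcosgt _ h3 (min_le_right _ _)
    have h5 := hle' (Real.pi - α + min (μ - (Real.pi - α)) (α / 4))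
      ⟨by linarith, by linarith [min_le_left (μ - (Real.pi - α)) (α / 4)]⟩
    have h6 : Real.cos (α + 2 * (Real.pi - α + min (μ - (Real.pi - α)) (α / 4))) =
        Real.cos (α - 2 * min (μ - (Real.pi - α)) (α / 4)) := by
      rw [← Real.cos_neg, ← Real.cos_add_two_pi]; congr 1; ring
    linarith
  rcases le_total (α + 2 * μ) Real.pi with h2 | h2
  · have := Real.injOn_cos ⟨by linarith, h2⟩ ⟨by linarith, hα₂.le⟩ e1
    linarith
  · have h3 : Real.cos (2 * Real.pi - (α + 2 * μ)) = Real.cos α := by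
      rw [Real.cos_two_pi_sub, e1]
    have := Real.injOn_cos ⟨by linarith, by linarith⟩ ⟨by linarith, hα₂.le⟩ h3
    linarith

end

section

/-! ### Local inverses and implicit angles -/

theorem AnalyticAt.exists_local_inverse {f : ℂ → ℂ} (hf : AnalyticAt ℂ f 0) (h0 : f 0 = 0)
    (hd : deriv f 0 ≠ 0) :
    ∃ g : ℂ → ℂ, AnalyticAt ℂ g 0 ∧ g 0 = 0 ∧ (∀ᶠ y in 𝓝 0, f (g y) = y) ∧
      ∀ᶠ u in 𝓝 0, g (f u) = u := by
  have hs := hf.hasStrictDerivAt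
  have hs' := hs.hasStrictFDerivAt_equiv hd
  have h1 := hs.eventually_left_inverse hd
  have h2 := hs.eventually_right_inverse hd
  have h3 : AnalyticAt ℂ (hs.localInverse f (deriv f 0) 0 hd) (f 0) :=
    (hs'.toOpenPartialHomeomorph f).analyticAt_symm' hs'.mem_toOpenPartialHomeomorph_source hf
      hs'.hasFDerivAt.fderiv
  have h4 := h1.self_of_nhds
  rw [h0] at h2 h3 h4
  exact ⟨_, h3, h4, h2, h1⟩

/-- The solution `H ρ` of `B ρ η = T` for functions `B` which are increasing in the angle `η`. -/
theorem exists_continuousOn_implicit {B : ℝ → ℝ → ℝ} {R C : ℝ}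
    (hcont : ContinuousOn (Function.uncurry B) (Ico 0 R ×ˢ univ))
    (hmono : ∀ ρ ∈ Ico 0 R, StrictMono (B ρ)) (hC : ∀ ρ ∈ Ico 0 R, ∀ η, |B ρ η - η| ≤ C) (T : ℝ) :
    ∃ H : ℝ → ℝ, ContinuousOn H (Ico 0 R) ∧ ∀ ρ ∈ Ico 0 R, B ρ (H ρ) = T := by
  have hex : ∀ ρ, ∃ η, ρ ∈ Ico 0 R → B ρ η = T := by
    intro ρ
    by_cases hρ : ρ ∈ Ico 0 R
    · have hc : ContinuousOn (B ρ) (Icc (T - C) (T + C)) := by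
        have : ContinuousOn (fun η => Function.uncurry B (ρ, η)) univ :=
          hcont.comp (by fun_prop) fun η _ => ⟨hρ, mem_univ _⟩
        exact this.mono (subset_univ _)
      have h0 : 0 ≤ C := (abs_nonneg _).trans (hC ρ hρ 0)
      have h1 := abs_le.1 (hC ρ hρ (T - C))
      have h2 := abs_le.1 (hC ρ hρ (T + C))
      obtain ⟨η, -, hη⟩ := intermediate_value_Icc (by linarith) hc
        (show T ∈ Icc (B ρ (T - C)) (B ρ (T + C)) from ⟨by linarith, by linarith⟩)
      exact ⟨η, fun _ => hη⟩
    · exact ⟨0, fun h => absurd h hρ⟩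
  choose H hH using hex
  refine ⟨H, ?_, hH⟩
  intro ρ₀ hρ₀
  have hsec : ∀ η, ContinuousWithinAt (fun ρ => B ρ η) (Ico 0 R) ρ₀ := by
    intro η
    have : ContinuousOn (fun ρ => Function.uncurry B (ρ, η)) (Ico 0 R) :=
      hcont.comp (by fun_prop) fun ρ hρ => ⟨hρ, mem_univ _⟩
    exact this ρ₀ hρ₀
  rw [ContinuousWithinAt, Metric.tendsto_nhds]
  intro ε hε
  -- Strict monotonicity traps `H ρ` between `H ρ₀ - ε` and `H ρ₀ + ε` as soon as the values of `B
  -- ρ` at these two fixed angles lie on either side of `T`.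
  have h1 : B ρ₀ (H ρ₀ - ε) < T := by
    rw [← hH ρ₀ hρ₀]; exact hmono ρ₀ hρ₀ (by linarith)
  have h2 : T < B ρ₀ (H ρ₀ + ε) := by
    conv_lhs => rw [← hH ρ₀ hρ₀]
    exact hmono ρ₀ hρ₀ (by linarith)
  filter_upwards [(hsec (H ρ₀ - ε)).eventually (gt_mem_nhds h1),
    (hsec (H ρ₀ + ε)).eventually (lt_mem_nhds h2), self_mem_nhdsWithin] with ρ h3 h4 h5
  rw [← hH ρ h5] at h3 h4
  have h6 := (hmono ρ h5).lt_iff_lt.1 h3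
  have h7 := (hmono ρ h5).lt_iff_lt.1 h4
  rw [Real.dist_eq, abs_lt]
  constructor <;> linarith

/-! ### Domains bounded by two curves in polar coordinates -/

/-- The region between the curves with polar equations `θ₁` and `θ₂`. -/
noncomputable def polarRegion (δ : ℝ) (θ₁ θ₂ : ℝ → ℝ) : Set ℂ :=
  {z | ∃ r θ : ℝ, r ∈ Ioo 0 δ ∧ θ ∈ Ioo (θ₁ r) (θ₂ r) ∧ z = r * Complex.exp (θ * Complex.I)}

/-- The polar angle of `z`, measured near the direction `χ`. -/
noncomputable def polarAngle (χ : ℝ) (z : ℂ) : ℝ := χ + (z * Complex.exp (-χ * Complex.I)).arg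

theorem polar_mul_exp_neg (χ r θ : ℝ) :
    (r : ℂ) * Complex.exp (θ * Complex.I) * Complex.exp (-χ * Complex.I) =
      r * Complex.exp ((θ - χ : ℝ) * Complex.I) := by
  rw [mul_assoc, ← Complex.exp_add]; push_cast; ring_nf

theorem polarAngle_polar {χ r θ : ℝ} (hr : 0 < r) (h : |θ - χ| < Real.pi / 2) :
    polarAngle χ (r * Complex.exp (θ * Complex.I)) = θ := by
  have h' := abs_lt.1 h
  have := Real.pi_pos
  rw [polarAngle, polar_mul_exp_neg, Complex.arg_real_mul _ hr, Complex.exp_mul_I,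
    Complex.arg_cos_add_sin_mul_I ⟨by linarith, by linarith⟩]
  ring

theorem eq_polar_polarAngle (χ : ℝ) (z : ℂ) :
    z = (‖z‖ : ℂ) * Complex.exp (polarAngle χ z * Complex.I) := by
  have h1 := Complex.norm_mul_exp_arg_mul_I (z * Complex.exp (-χ * Complex.I))
  have h2 : ‖z * Complex.exp (-χ * Complex.I)‖ = ‖z‖ := by
    rw [norm_mul, ← Complex.ofReal_neg, Complex.norm_exp_ofReal_mul_I, mul_one]
  rw [h2] at h1
  have h3 : Complex.exp (-χ * Complex.I) * Complex.exp (χ * Complex.I) = 1 := by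
    rw [← Complex.exp_add]; simp
  calc z = z * Complex.exp (-χ * Complex.I) * Complex.exp (χ * Complex.I) := by
        rw [mul_assoc, h3, mul_one]
    _ = _ := by
        rw [← h1, polarAngle, Complex.ofReal_add, add_mul, Complex.exp_add]; ring

theorem re_polar_mul_exp_neg (χ r θ : ℝ) :
    ((r : ℂ) * Complex.exp (θ * Complex.I) * Complex.exp (-χ * Complex.I)).re =
      r * Real.cos (θ - χ) := by
  rw [polar_mul_exp_neg, Complex.re_ofReal_mul, Complex.exp_ofReal_mul_I_re]

theorem continuousAt_polarAngle {χ : ℝ} {z : ℂ}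
    (h : 0 < (z * Complex.exp (-χ * Complex.I)).re) : ContinuousAt (polarAngle χ) z := by
  unfold polarAngle
  have h1 : ContinuousAt Complex.arg (z * Complex.exp (-χ * Complex.I)) :=
    Complex.continuousAt_arg (Or.inl h)
  have h2 : ContinuousAt (fun z : ℂ => z * Complex.exp (-χ * Complex.I)) z := by fun_prop
  exact continuousAt_const.add (ContinuousAt.comp (f := fun z : ℂ => z * _) h1 h2)

variable {δ χ β : ℝ} {θ₁ θ₂ : ℝ → ℝ}

/-- The data of two polar curves near the direction `χ`. -/
structure IsPolarPair (δ χ β : ℝ) (θ₁ θ₂ : ℝ → ℝ) : Prop where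
  pos : 0 < δ
  lt_pi : β < Real.pi / 2
  cont₁ : ContinuousOn θ₁ (Ico 0 δ)
  cont₂ : ContinuousOn θ₂ (Ico 0 δ)
  lt : ∀ r ∈ Ico 0 δ, θ₁ r < θ₂ r
  near₁ : ∀ r ∈ Ico 0 δ, |θ₁ r - χ| ≤ β
  near₂ : ∀ r ∈ Ico 0 δ, |θ₂ r - χ| ≤ β

theorem IsPolarPair.near (h : IsPolarPair δ χ β θ₁ θ₂) {r θ : ℝ} (hr : r ∈ Ico 0 δ)
    (hθ : θ ∈ Icc (θ₁ r) (θ₂ r)) : |θ - χ| ≤ β := by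
  have h1 := abs_le.1 (h.near₁ r hr)
  have h2 := abs_le.1 (h.near₂ r hr)
  rw [abs_le]
  constructor
  · linarith [hθ.1]
  · linarith [hθ.2]

theorem IsPolarPair.nonneg (h : IsPolarPair δ χ β θ₁ θ₂) : 0 ≤ β :=
  (abs_nonneg _).trans (h.near₁ 0 ⟨le_rfl, h.pos⟩)

theorem IsPolarPair.cos_pos (h : IsPolarPair δ χ β θ₁ θ₂) : 0 < Real.cos β :=
  Real.cos_pos_of_mem_Ioo ⟨by linarith [h.nonneg, Real.pi_pos], h.lt_pi⟩

/-- A description by strict inequalities between functions continuous at the points concerned, from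
which openness and the frontier are read off. The condition on the real part is automatic in the
region and keeps `z` off the branch cut of `polarAngle`. -/
theorem IsPolarPair.mem_iff (h : IsPolarPair δ χ β θ₁ θ₂) {z : ℂ} :
    z ∈ polarRegion δ θ₁ θ₂ ↔ z ≠ 0 ∧ ‖z‖ < δ ∧ 0 < (z * Complex.exp (-χ * Complex.I)).re ∧
      θ₁ ‖z‖ < polarAngle χ z ∧ polarAngle χ z < θ₂ ‖z‖ := by
  constructor
  · rintro ⟨r, θ, hr, hθ, rfl⟩
    have h1 := h.near ⟨hr.1.le, hr.2⟩ (Ioo_subset_Icc_self hθ)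
    have h2 : |θ - χ| < Real.pi / 2 := h1.trans_lt h.lt_pi
    rw [norm_polar hr.1.le, polarAngle_polar hr.1 h2, re_polar_mul_exp_neg]
    refine ⟨mul_ne_zero (by exact_mod_cast hr.1.ne') (Complex.exp_ne_zero _), hr.2, ?_, hθ.1, hθ.2⟩
    exact mul_pos hr.1 (Real.cos_pos_of_mem_Ioo (abs_lt.1 h2))
  · rintro ⟨h0, h1, -, h3, h4⟩
    exact ⟨‖z‖, polarAngle χ z, ⟨norm_pos_iff.2 h0, h1⟩, ⟨h3, h4⟩, eq_polar_polarAngle χ z⟩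

theorem IsPolarPair.continuousAt_comp_norm {θ : ℝ → ℝ} (hθ : ContinuousOn θ (Ico 0 δ)) {z : ℂ}
    (h0 : z ≠ 0) (h1 : ‖z‖ < δ) : ContinuousAt (fun z : ℂ => θ ‖z‖) z := by
  have : ContinuousAt θ ‖z‖ :=
    (hθ.mono Ioo_subset_Ico_self).continuousAt (isOpen_Ioo.mem_nhds ⟨norm_pos_iff.2 h0, h1⟩)
  exact ContinuousAt.comp (f := fun z : ℂ => ‖z‖) this continuous_norm.continuousAt

theorem IsPolarPair.isOpen (h : IsPolarPair δ χ β θ₁ θ₂) : IsOpen (polarRegion δ θ₁ θ₂) := by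
  rw [isOpen_iff_mem_nhds]
  intro z hz
  obtain ⟨h0, h1, h2, h3, h4⟩ := h.mem_iff.1 hz
  have hc := continuousAt_polarAngle h2
  have hre : ContinuousAt (fun z : ℂ => (z * Complex.exp (-χ * Complex.I)).re) z := by fun_prop
  filter_upwards [isOpen_ne.mem_nhds h0, continuous_norm.continuousAt.eventually (gt_mem_nhds h1),
    hre.eventually (lt_mem_nhds h2), (IsPolarPair.continuousAt_comp_norm h.cont₁ h0 h1).eventually_lt hc h3,
    hc.eventually_lt (IsPolarPair.continuousAt_comp_norm h.cont₂ h0 h1) h4] with u e0 e1 e2 e3 e4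
  exact h.mem_iff.2 ⟨e0, e1, e2, e3, e4⟩

theorem IsPolarPair.isConnected (h : IsPolarPair δ χ β θ₁ θ₂) :
    IsConnected (polarRegion δ θ₁ θ₂) := by
  have : polarRegion δ θ₁ θ₂ = (fun x : ℝ × ℝ =>
      (x.1 : ℂ) * Complex.exp ((θ₁ x.1 + x.2 * (θ₂ x.1 - θ₁ x.1) : ℝ) * Complex.I)) ''
        (Ioo 0 δ ×ˢ Ioo 0 1) := by
    ext z
    constructor
    · rintro ⟨r, θ, hr, hθ, rfl⟩
      have h1 : 0 < θ₂ r - θ₁ r := sub_pos.2 (h.lt r ⟨hr.1.le, hr.2⟩)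
      refine ⟨(r, (θ - θ₁ r) / (θ₂ r - θ₁ r)), ⟨hr, ?_, ?_⟩, ?_⟩
      · exact div_pos (sub_pos.2 hθ.1) h1
      · rw [div_lt_one h1]; linarith [hθ.2]
      · simp only
        rw [div_mul_cancel₀ _ h1.ne', add_sub_cancel]
    · rintro ⟨⟨r, x⟩, ⟨hr, hx⟩, rfl⟩
      simp only at hr hx
      have h1 : 0 < θ₂ r - θ₁ r := sub_pos.2 (h.lt r ⟨hr.1.le, hr.2⟩)
      refine ⟨r, _, hr, ⟨?_, ?_⟩, rfl⟩
      · have := mul_pos hx.1 h1; linarith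
      · have := mul_lt_mul_of_pos_right hx.2 h1; linarith
  rw [this]
  have hc : (Ioo (0 : ℝ) δ ×ˢ Ioo (0 : ℝ) 1).Nonempty :=
    (nonempty_Ioo.2 h.pos).prod (nonempty_Ioo.2 one_pos)
  refine IsConnected.image ⟨hc, isPreconnected_Ioo.prod isPreconnected_Ioo⟩ _ ?_
  have c1 : ContinuousOn (fun x : ℝ × ℝ => θ₁ x.1) (Ioo 0 δ ×ˢ Ioo 0 1) :=
    h.cont₁.comp continuousOn_fst fun x hx => Ioo_subset_Ico_self hx.1
  have c2 : ContinuousOn (fun x : ℝ × ℝ => θ₂ x.1) (Ioo 0 δ ×ˢ Ioo 0 1) :=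
    h.cont₂.comp continuousOn_fst fun x hx => Ioo_subset_Ico_self hx.1
  have c3 : ContinuousOn (fun x : ℝ × ℝ => θ₁ x.1 + x.2 * (θ₂ x.1 - θ₁ x.1))
      (Ioo 0 δ ×ˢ Ioo 0 1) := c1.add (continuousOn_snd.mul (c2.sub c1))
  exact (Complex.continuous_ofReal.comp_continuousOn continuousOn_fst).mul
    (((Complex.continuous_ofReal.comp_continuousOn c3).mul continuousOn_const).cexp)

/-- The region lies in a cone of half-angle `β < π / 2` about the direction `χ`. The cone is closed,
so angles (away from `0`) and roots remain continuous on the closure. -/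
theorem IsPolarPair.closure_subset (h : IsPolarPair δ χ β θ₁ θ₂) {z : ℂ}
    (hz : z ∈ closure (polarRegion δ θ₁ θ₂)) :
    ‖z‖ ≤ δ ∧ Real.cos β * ‖z‖ ≤ (z * Complex.exp (-χ * Complex.I)).re := by
  have hcl : IsClosed {z : ℂ | ‖z‖ ≤ δ ∧
      Real.cos β * ‖z‖ ≤ (z * Complex.exp (-χ * Complex.I)).re} := by
    have c1 : Continuous fun z : ℂ => (z * Complex.exp (-χ * Complex.I)).re :=
      Complex.continuous_re.comp (by fun_prop)
    exact (isClosed_le continuous_norm continuous_const).inter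
      (isClosed_le (continuous_const.mul continuous_norm) c1)
  refine closure_minimal ?_ hcl hz
  rintro _ ⟨r, θ, hr, hθ, rfl⟩
  have h1 := h.near ⟨hr.1.le, hr.2⟩ (Ioo_subset_Icc_self hθ)
  refine ⟨by rw [norm_polar hr.1.le]; exact hr.2.le, ?_⟩
  rw [norm_polar hr.1.le, re_polar_mul_exp_neg, mul_comm]
  apply mul_le_mul_of_nonneg_left _ hr.1.le
  rw [← Real.cos_abs (θ - χ)]
  exact Real.cos_le_cos_of_nonneg_of_le_pi (abs_nonneg _) (by linarith [h.lt_pi, Real.pi_pos]) h1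

theorem IsPolarPair.re_pos_of_mem_closure (h : IsPolarPair δ χ β θ₁ θ₂) {z : ℂ}
    (hz : z ∈ closure (polarRegion δ θ₁ θ₂)) (h0 : z ≠ 0) :
    0 < (z * Complex.exp (-χ * Complex.I)).re :=
  (mul_pos h.cos_pos (norm_pos_iff.2 h0)).trans_le (h.closure_subset hz).2

theorem IsPolarPair.curve_mem_closure (h : IsPolarPair δ χ β θ₁ θ₂) {r θ : ℝ} (hr : r ∈ Ioo 0 δ)
    (hθ : θ ∈ Icc (θ₁ r) (θ₂ r)) :
    (r : ℂ) * Complex.exp (θ * Complex.I) ∈ closure (polarRegion δ θ₁ θ₂) := by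
  have h1 : θ ∈ closure (Ioo (θ₁ r) (θ₂ r)) := by
    rw [closure_Ioo (h.lt r ⟨hr.1.le, hr.2⟩).ne]; exact hθ
  have h2 : Continuous fun θ : ℝ => (r : ℂ) * Complex.exp (θ * Complex.I) := by fun_prop
  exact map_mem_closure (f := fun θ : ℝ => (r : ℂ) * Complex.exp (θ * Complex.I)) h2 h1
    fun θ hθ => ⟨r, θ, hr, hθ, rfl⟩

theorem IsPolarPair.zero_mem_closure (h : IsPolarPair δ χ β θ₁ θ₂) :
    (0 : ℂ) ∈ closure (polarRegion δ θ₁ θ₂) := by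
  rw [Metric.mem_closure_iff]
  intro ε hε
  have hm : 0 < min ε δ := lt_min hε h.pos
  have hr : min ε δ / 2 ∈ Ioo 0 δ := ⟨by linarith, by linarith [min_le_right ε δ]⟩
  have h1 := h.lt _ ⟨hr.1.le, hr.2⟩
  refine ⟨_, ⟨min ε δ / 2, (θ₁ (min ε δ / 2) + θ₂ (min ε δ / 2)) / 2, hr,
    ⟨by linarith, by linarith⟩, rfl⟩, ?_⟩
  rw [dist_zero_left, norm_polar hr.1.le]
  linarith [min_le_left ε δ]

/-- A non-zero limit point inside the ball satisfies the weak inequalities for the angle; if both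
were strict it would belong to the region. -/
theorem IsPolarPair.frontier_inter_ball (h : IsPolarPair δ χ β θ₁ θ₂) :
    frontier (polarRegion δ θ₁ θ₂) ∩ ball 0 δ =
      (fun r : ℝ => (r : ℂ) * Complex.exp (θ₁ r * Complex.I)) '' Ico 0 δ ∪
      (fun r : ℝ => (r : ℂ) * Complex.exp (θ₂ r * Complex.I)) '' Ico 0 δ := by
  rw [h.isOpen.frontier_eq]
  ext z
  constructor
  · rintro ⟨⟨hz, hz'⟩, hb⟩
    rw [mem_ball_zero_iff] at hb
    by_cases h0 : z = 0
    · left; exact ⟨0, ⟨le_rfl, h.pos⟩, by simp [h0]⟩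
    have hre := h.re_pos_of_mem_closure hz h0
    have hc := continuousAt_polarAngle hre
    have hmem : ‖z‖ ∈ Ico 0 δ := ⟨norm_nonneg _, hb⟩
    have hfreq := mem_closure_iff_frequently.1 hz
    have h3 : θ₁ ‖z‖ ≤ polarAngle χ z := by
      by_contra! hlt
      have := hc.eventually_lt (IsPolarPair.continuousAt_comp_norm h.cont₁ h0 hb) hlt
      obtain ⟨u, hu, hu'⟩ := (hfreq.and_eventually this).exists
      exact lt_asymm hu' (h.mem_iff.1 hu).2.2.2.1
    have h4 : polarAngle χ z ≤ θ₂ ‖z‖ := by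
      by_contra! hlt
      have := (IsPolarPair.continuousAt_comp_norm h.cont₂ h0 hb).eventually_lt hc hlt
      obtain ⟨u, hu, hu'⟩ := (hfreq.and_eventually this).exists
      exact lt_asymm hu' (h.mem_iff.1 hu).2.2.2.2
    rcases h3.eq_or_lt with h3 | h3
    · left; exact ⟨‖z‖, hmem, by simp only; rw [h3]; exact (eq_polar_polarAngle χ z).symm⟩
    rcases h4.eq_or_lt with h4 | h4
    · right; exact ⟨‖z‖, hmem, by simp only; rw [← h4]; exact (eq_polar_polarAngle χ z).symm⟩
    exact absurd (h.mem_iff.2 ⟨h0, hb, hre, h3, h4⟩) hz'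
  · have key : ∀ θ : ℝ → ℝ, (∀ r ∈ Ico 0 δ, θ r ∈ Icc (θ₁ r) (θ₂ r) ∧ θ r ∉ Ioo (θ₁ r) (θ₂ r)) →
        ∀ r ∈ Ico 0 δ, (r : ℂ) * Complex.exp (θ r * Complex.I) ∈
          (closure (polarRegion δ θ₁ θ₂) \ polarRegion δ θ₁ θ₂) ∩ ball 0 δ := by
      intro θ hθ r hr
      obtain ⟨h1, h2⟩ := hθ r hr
      have hb : (r : ℂ) * Complex.exp (θ r * Complex.I) ∈ ball (0 : ℂ) δ := by
        rw [mem_ball_zero_iff, norm_polar hr.1]; exact hr.2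
      rcases hr.1.eq_or_lt with h0 | h0
      · rw [← h0] at hb ⊢
        simp only [Complex.ofReal_zero, zero_mul] at hb ⊢
        exact ⟨⟨h.zero_mem_closure, fun h3 => (h.mem_iff.1 h3).1 rfl⟩, hb⟩
      · refine ⟨⟨h.curve_mem_closure ⟨h0, hr.2⟩ h1, fun h3 => h2 ?_⟩, hb⟩
        have h4 := (h.mem_iff.1 h3).2.2.2
        rwa [polarAngle_polar h0 ((h.near hr h1).trans_lt h.lt_pi), norm_polar hr.1] at h4
    rintro (⟨r, hr, rfl⟩ | ⟨r, hr, rfl⟩)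
    · exact key θ₁ (fun r hr => ⟨⟨le_rfl, (h.lt r hr).le⟩, fun h1 => lt_irrefl _ h1.1⟩) r hr
    · exact key θ₂ (fun r hr => ⟨⟨(h.lt r hr).le, le_rfl⟩, fun h1 => lt_irrefl _ h1.2⟩) r hr

theorem IsPolarPair.zero_mem_frontier (h : IsPolarPair δ χ β θ₁ θ₂) :
    (0 : ℂ) ∈ frontier (polarRegion δ θ₁ θ₂) := by
  have : (0 : ℂ) ∈ frontier (polarRegion δ θ₁ θ₂) ∩ ball 0 δ := by
    rw [h.frontier_inter_ball]
    exact Or.inl ⟨0, ⟨le_rfl, h.pos⟩, by simp⟩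
  exact this.1

theorem IsPolarPair.isAsymptoticToSector (h : IsPolarPair δ χ β θ₁ θ₂) {Q : Set ℂ}
    (hQ : Q = {z | ∃ r θ : ℝ, 0 < r ∧ θ ∈ Ioo (θ₁ 0) (θ₂ 0) ∧
      z = r * Complex.exp (θ * Complex.I)}) :
    IsAsymptoticToSector (polarRegion δ θ₁ θ₂) Q := by
  refine ⟨δ, θ₁, θ₂, h.pos, h.cont₁, h.cont₂, hQ, ?_, h.frontier_inter_ball⟩
  refine inter_eq_left.2 fun z hz => ?_
  rw [mem_ball_zero_iff]
  exact (h.mem_iff.1 hz).2.1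

/-- The sectors on which the quadric is negative, in polar coordinates. -/
theorem admissibleSector_one {γ α : ℝ} (hγ : 1 < γ) (hα : Real.cos α = -1 / γ) (hα₀ : 0 < α)
    (hα₂ : α < Real.pi) :
    admissibleSector γ 1 = {z | ∃ r θ : ℝ, 0 < r ∧ θ ∈ Ioo (α / 2) (Real.pi - α / 2) ∧
      z = r * Complex.exp (θ * Complex.I)} := by
  have hγ0 : 0 < γ := by linarith
  have hαγ : γ * Real.cos α = -1 := by rw [hα]; field_simp
  have key : ∀ r θ : ℝ, 0 < r → (quadric γ (r * Complex.exp (θ * Complex.I)) < 0 ↔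
      Real.cos (2 * θ) < Real.cos α) := by
    intro r θ hr
    rw [quadric_exp]
    have h1 : 0 < r ^ 2 := by positivity
    constructor
    · intro h
      by_contra! h2
      have := mul_nonneg h1.le (show 0 ≤ 1 + γ * Real.cos (2 * θ) by nlinarith)
      linarith
    · intro h
      exact mul_neg_of_pos_of_neg h1 (by nlinarith)
  ext z
  simp only [admissibleSector, one_mul, mem_ofPred_eq]
  constructor
  · rintro ⟨h1, h2⟩
    have hz : z ≠ 0 := by rintro rfl; simp at h2
    have h3 : 0 < z.arg := by
      rcases (Complex.arg_nonneg_iff.2 h2.le).eq_or_lt with h | h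
      · have := (Complex.arg_eq_zero_iff.1 h.symm).2
        linarith
      · exact h
    have h4 : z.arg < Real.pi := by
      refine lt_of_le_of_ne (Complex.arg_le_pi z) fun h => ?_
      have := (Complex.arg_eq_pi_iff.1 h).2
      linarith
    have hzz := Complex.norm_mul_exp_arg_mul_I z
    rw [← hzz, key _ _ (norm_pos_iff.2 hz)] at h1
    refine ⟨‖z‖, z.arg, norm_pos_iff.2 hz, ⟨?_, ?_⟩, hzz.symm⟩
    · by_contra! h
      exact absurd h1 (not_lt.2 (Real.cos_le_cos_of_nonneg_of_le_pi (by linarith) hα₂.le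
        (by linarith)))
    · by_contra! h
      rw [← Real.cos_two_pi_sub] at h1
      exact absurd h1 (not_lt.2 (Real.cos_le_cos_of_nonneg_of_le_pi (by linarith) hα₂.le
        (by linarith)))
  · rintro ⟨r, θ, hr, hθ, rfl⟩
    rw [key r θ hr, im_polar]
    refine ⟨?_, mul_pos hr (Real.sin_pos_of_pos_of_lt_pi (by linarith [hθ.1]) (by linarith [hθ.2]))⟩
    rcases le_total (2 * θ) Real.pi with h | h
    · exact Real.cos_lt_cos_of_nonneg_of_le_pi hα₀.le h (by linarith [hθ.1])
    · rw [← Real.cos_two_pi_sub]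
      exact Real.cos_lt_cos_of_nonneg_of_le_pi hα₀.le (by linarith) (by linarith [hθ.2])

/-- `ψ` is even, so `z ↦ -z` exchanges the two sectors. -/
theorem admissibleSector_neg_one {γ α : ℝ} (hγ : 1 < γ) (hα : Real.cos α = -1 / γ) (hα₀ : 0 < α)
    (hα₂ : α < Real.pi) :
    admissibleSector γ (-1) = {z | ∃ r θ : ℝ, 0 < r ∧ θ ∈ Ioo (α / 2 - Real.pi) (-(α / 2)) ∧
      z = r * Complex.exp (θ * Complex.I)} := by
  have h1 : ∀ z, z ∈ admissibleSector γ (-1) ↔ -z ∈ admissibleSector γ 1 := by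
    intro z
    simp [admissibleSector, quadric]
  have h2 : ∀ r θ : ℝ, -((r : ℂ) * Complex.exp (θ * Complex.I)) =
      r * Complex.exp ((θ + Real.pi : ℝ) * Complex.I) := by
    intro r θ
    push_cast
    rw [add_mul, Complex.exp_add, Complex.exp_pi_mul_I]; ring
  ext z
  rw [h1, admissibleSector_one hγ hα hα₀ hα₂]
  constructor
  · rintro ⟨r, θ, hr, hθ, hz⟩
    refine ⟨r, θ - Real.pi, hr, ⟨by linarith [hθ.1], by linarith [hθ.2]⟩, ?_⟩
    apply neg_injective
    rw [h2, hz, sub_add_cancel]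
  · rintro ⟨r, θ, hr, hθ, rfl⟩
    exact ⟨r, θ + Real.pi, hr, ⟨by linarith [hθ.1], by linarith [hθ.2]⟩, h2 r θ⟩

end

section

/-! ### Puiseux series on polar regions -/

/-- The branch of the `m`-th root of `z exp(-iχ)` near the direction `χ`. -/
noncomputable def rootFn (m : ℕ) (χ : ℝ) (z : ℂ) : ℂ := (z * Complex.exp (-χ * Complex.I)) ^ ((m : ℂ)⁻¹)

variable {m : ℕ} {χ δ β R R' : ℝ} {θ₁ θ₂ : ℝ → ℝ}

theorem rootFn_zero (hm : 0 < m) : rootFn m χ 0 = 0 := by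
  have : (m : ℂ)⁻¹ ≠ 0 := inv_ne_zero (by exact_mod_cast hm.ne')
  simp [rootFn, this]

theorem exp_neg_mul_exp (χ : ℝ) :
    Complex.exp (-χ * Complex.I) * Complex.exp (χ * Complex.I) = 1 := by
  rw [← Complex.exp_add]; simp

theorem rootFn_pow (hm : 0 < m) (z : ℂ) : rootFn m χ z ^ m = z * Complex.exp (-χ * Complex.I) :=
  Complex.cpow_nat_inv_pow _ hm.ne'

theorem exp_mul_rootFn_pow (hm : 0 < m) (z : ℂ) :
    Complex.exp (χ * Complex.I) * rootFn m χ z ^ m = z := by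
  rw [rootFn_pow hm, mul_left_comm, mul_comm (Complex.exp (χ * Complex.I)), exp_neg_mul_exp, mul_one]

theorem norm_rootFn_pow (hm : 0 < m) (z : ℂ) : ‖rootFn m χ z‖ ^ m = ‖z‖ := by
  rw [← norm_pow, rootFn_pow hm, norm_mul, ← Complex.ofReal_neg, Complex.norm_exp_ofReal_mul_I,
    mul_one]

theorem rootFn_exp_mul_pow (hm : 0 < m) {y : ℂ} (hy : m * |y.arg| < Real.pi) :
    rootFn m χ (Complex.exp (χ * Complex.I) * y ^ m) = y := by
  have hm' : (0 : ℝ) < m := by exact_mod_cast hm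
  have h1 : |y.arg| < Real.pi / m := by rw [lt_div_iff₀ hm']; linarith
  have h2 := abs_lt.1 h1
  rw [rootFn, mul_right_comm, mul_comm (Complex.exp (χ * Complex.I)), exp_neg_mul_exp, one_mul]
  exact Complex.pow_cpow_nat_inv hm.ne' h2.1 h2.2.le

theorem continuousAt_rootFn (hm : 0 < m) {z : ℂ} (h : 0 ≤ (z * Complex.exp (-χ * Complex.I)).re) :
    ContinuousAt (rootFn m χ) z := by
  have hm' : (0 : ℝ) < m := by exact_mod_cast hm
  have h1 : ContinuousAt (fun x : ℂ => x ^ ((m : ℂ)⁻¹)) (z * Complex.exp (-χ * Complex.I)) := by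
    refine Complex.continuousAt_cpow_const_of_re_pos (Or.inl h) ?_
    rw [← Complex.ofReal_natCast, ← Complex.ofReal_inv, Complex.ofReal_re]
    positivity
  have h2 : ContinuousAt (fun z : ℂ => z * Complex.exp (-χ * Complex.I)) z := by fun_prop
  exact ContinuousAt.comp (f := fun z : ℂ => z * _) h1 h2

theorem hasDerivAt_rootFn {z : ℂ} (h : 0 < (z * Complex.exp (-χ * Complex.I)).re) :
    HasDerivAt (rootFn m χ) (rootFn m χ z / (m * z)) z := by
  have h0 : z * Complex.exp (-χ * Complex.I) ≠ 0 := by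
    intro h0; rw [h0] at h; simp at h
  have h2 : HasDerivAt (fun z : ℂ => z * Complex.exp (-χ * Complex.I))
      (Complex.exp (-χ * Complex.I)) z := by
    simpa using (hasDerivAt_id z).mul_const (Complex.exp (-χ * Complex.I))
  have h3 := h2.cpow_const (c := (m : ℂ)⁻¹) (Or.inl h)
  have h4 := left_ne_zero_of_mul h0
  have h5 := right_ne_zero_of_mul h0
  refine HasDerivAt.congr_deriv (f := rootFn m χ) h3 ?_
  rw [Complex.cpow_sub _ _ h0, Complex.cpow_one, rootFn]
  field_simp

/-- The derivative of a composition with `rootFn`. -/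
theorem hasDerivAt_pow_mul_comp_rootFn (hm : 0 < m) (j : ℕ) {K : ℂ → ℂ} {z : ℂ}
    (h : 0 < (z * Complex.exp (-χ * Complex.I)).re)
    (hK : DifferentiableAt ℂ K (rootFn m χ z)) :
    HasDerivAt (fun z => rootFn m χ z ^ (m + j) * K (rootFn m χ z))
      (rootFn m χ z ^ j * (((m + j : ℕ) * K (rootFn m χ z) +
        rootFn m χ z * deriv K (rootFn m χ z)) / (m * Complex.exp (χ * Complex.I)))) z := by
  have hτ := hasDerivAt_rootFn (m := m) h
  have hz := exp_mul_rootFn_pow (χ := χ) hm z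
  have hz0 : z ≠ 0 := by rintro rfl; simp at h
  have hm' : (m : ℂ) ≠ 0 := by exact_mod_cast hm.ne'
  have h1 := (hτ.pow (m + j)).mul (HasDerivAt.comp z hK.hasDerivAt hτ)
  refine h1.congr_deriv ?_
  set t := rootFn m χ z
  have ht : t ≠ 0 := by
    intro h0
    rw [h0, zero_pow hm.ne', mul_zero] at hz
    exact hz0 hz.symm
  have hE := Complex.exp_ne_zero (χ * Complex.I)
  have h2 : t ^ (m + j - 1) * t = t ^ (m + j) := by
    rw [← pow_succ]; congr 1; omega
  change ((m + j : ℕ) : ℂ) * t ^ (m + j - 1) * (t / (m * z)) * K t +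
    t ^ (m + j) * (deriv K t * (t / (m * z))) = _
  rw [← hz]
  have htm : t ^ m ≠ 0 := pow_ne_zero _ ht
  field_simp
  linear_combination ((m + j : ℕ) : ℂ) * K t * h2

theorem IsPolarPair.re_nonneg_of_mem_closure (h : IsPolarPair δ χ β θ₁ θ₂) {z : ℂ}
    (hz : z ∈ closure (polarRegion δ θ₁ θ₂)) : 0 ≤ (z * Complex.exp (-χ * Complex.I)).re :=
  (mul_nonneg h.cos_pos.le (norm_nonneg z)).trans (h.closure_subset hz).2

theorem IsPolarPair.continuousOn_rootFn (h : IsPolarPair δ χ β θ₁ θ₂) (hm : 0 < m) :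
    ContinuousOn (rootFn m χ) (closure (polarRegion δ θ₁ θ₂)) := fun _ hz =>
  (continuousAt_rootFn hm (h.re_nonneg_of_mem_closure hz)).continuousWithinAt

theorem IsPolarPair.norm_rootFn_le (h : IsPolarPair δ χ β θ₁ θ₂) (hm : 0 < m) (hR : 0 < R)
    (hδ : δ = R ^ m) {z : ℂ} (hz : z ∈ closure (polarRegion δ θ₁ θ₂)) : ‖rootFn m χ z‖ ≤ R := by
  have h1 := (h.closure_subset hz).1
  rw [hδ, ← norm_rootFn_pow (χ := χ) hm z] at h1
  exact (pow_le_pow_iff_left₀ (norm_nonneg _) hR.le hm.ne').1 h1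

theorem IsPolarPair.norm_rootFn_lt (h : IsPolarPair δ χ β θ₁ θ₂) (hm : 0 < m) (hR : 0 < R)
    (hδ : δ = R ^ m) {z : ℂ} (hz : z ∈ polarRegion δ θ₁ θ₂) : ‖rootFn m χ z‖ < R := by
  have h1 := (h.mem_iff.1 hz).2.1
  rw [hδ, ← norm_rootFn_pow (χ := χ) hm z] at h1
  exact (pow_lt_pow_iff_left₀ (norm_nonneg _) hR.le hm.ne').1 h1

/-- The function `z ↦ G(z^{1/m})`, where `G(y) = y ^ (2 m + 1) G₁(y)`. -/
noncomputable def puiseuxFn (m : ℕ) (χ : ℝ) (G₁ : ℂ → ℂ) (z : ℂ) : ℂ :=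
  rootFn m χ z ^ (m + (m + 1)) * G₁ (rootFn m χ z)

/-- With `τ = rootFn m χ z`, `z` is a constant multiple of `τ ^ m` and `τ' = τ / (m z)`: each
derivative in `z` lowers the power of `τ` by `m`. The exponents `2m + 1`, `m + 1`, `1` are all
positive, so the three functions vanish at `0`. The gap `R < R'` keeps `τ` in the domain of `G₁` on
the whole closure. -/
theorem IsPolarPair.isC2UpToBoundary (h : IsPolarPair δ χ β θ₁ θ₂) (hm : 0 < m) (hR : 0 < R)
    (hδ : δ = R ^ m) (hRR : R < R') {G₁ : ℂ → ℂ} (hG : DifferentiableOn ℂ G₁ (ball 0 R')) :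
    IsC2UpToBoundary (polarRegion δ θ₁ θ₂) (puiseuxFn m χ G₁) := by
  set c : ℂ := m * Complex.exp (χ * Complex.I) with hc
  set G₂ : ℂ → ℂ := fun y => ((m + (m + 1) : ℕ) * G₁ y + y * deriv G₁ y) / c with hG₂
  set G₃ : ℂ → ℂ := fun y => ((m + 1 : ℕ) * G₂ y + y * deriv G₂ y) / c with hG₃
  have hd : ∀ (K : ℂ → ℂ) (a : ℂ), DifferentiableOn ℂ K (ball 0 R') →
      DifferentiableOn ℂ (fun y => (a * K y + y * deriv K y) / c) (ball 0 R') := by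
    intro K a hK
    exact (((differentiableOn_const a).mul hK).add
      (differentiableOn_id.mul (hK.deriv isOpen_ball))).div_const _
  have hG₂d : DifferentiableOn ℂ G₂ (ball 0 R') := hd G₁ _ hG
  have hG₃d : DifferentiableOn ℂ G₃ (ball 0 R') := hd G₂ _ hG₂d
  have hcont : ∀ (j : ℕ) (K : ℂ → ℂ), DifferentiableOn ℂ K (ball 0 R') →
      ContinuousOn (fun z => rootFn m χ z ^ j * K (rootFn m χ z))
        (closure (polarRegion δ θ₁ θ₂)) := by
    intro j K hK
    have h1 := h.continuousOn_rootFn hm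
    refine (h1.pow j).mul (hK.continuousOn.comp h1 fun z hz => ?_)
    rw [mem_ball_zero_iff]
    exact (h.norm_rootFn_le hm hR hδ hz).trans_lt hRR
  have hat : ∀ (K : ℂ → ℂ), DifferentiableOn ℂ K (ball 0 R') → ∀ z ∈ polarRegion δ θ₁ θ₂,
      DifferentiableAt ℂ K (rootFn m χ z) := by
    intro K hK z hz
    refine hK.differentiableAt (isOpen_ball.mem_nhds ?_)
    rw [mem_ball_zero_iff]
    exact (h.norm_rootFn_lt hm hR hδ hz).trans hRR
  refine ⟨fun z => rootFn m χ z ^ (m + 1) * G₂ (rootFn m χ z),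
    fun z => rootFn m χ z ^ 1 * G₃ (rootFn m χ z), hcont _ _ hG, hcont _ _ hG₂d, hcont _ _ hG₃d,
    ?_, ?_, ?_, ?_, ?_⟩
  · intro z hz
    exact hasDerivAt_pow_mul_comp_rootFn hm (m + 1) (h.mem_iff.1 hz).2.2.1 (hat _ hG z hz)
  · intro z hz
    exact hasDerivAt_pow_mul_comp_rootFn hm 1 (h.mem_iff.1 hz).2.2.1 (hat _ hG₂d z hz)
  · simp [puiseuxFn, rootFn_zero hm]
  · simp [rootFn_zero hm]
  · simp [rootFn_zero hm]

theorem IsPolarPair.hasPuiseuxExpansion (h : IsPolarPair δ χ β θ₁ θ₂) (hm : 0 < m) (hR : 0 < R)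
    (hδ : δ = R ^ m) (hRR : R < R') {G₁ : ℂ → ℂ} (hG : DifferentiableOn ℂ G₁ (ball 0 R')) :
    HasPuiseuxExpansion (polarRegion δ θ₁ θ₂) (puiseuxFn m χ G₁) := by
  lift R to NNReal using hR.le
  have hps := (hG.mono (closedBall_subset_ball hRR)).hasFPowerSeriesOnBall (by exact_mod_cast hR)
  set p := cauchyPowerSeries G₁ 0 R
  have hm' : (m : ℂ) ≠ 0 := by exact_mod_cast hm.ne'
  -- `rootFn` is a root of the rotated variable; multiplying by `E` gives a branch of `z^{1/m}`, and
  -- the coefficients are divided by `E ^ k` to compensate.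
  set E : ℂ := Complex.exp (χ / m * Complex.I) with hE
  have hEm : E ^ m = Complex.exp (χ * Complex.I) := by
    rw [hE, ← Complex.exp_nat_mul]; congr 1; field_simp
  have hE0 : E ≠ 0 := Complex.exp_ne_zero _
  refine ⟨m, fun k => if k ≤ 2 * m then 0 else p.coeff (k - (2 * m + 1)) / E ^ k,
    fun z => E * rootFn m χ z, hm, ?_, ?_, ?_, ?_⟩
  · intro z hz
    exact ((hasDerivAt_rootFn (m := m)
      (h.mem_iff.1 hz).2.2.1).differentiableAt.const_mul E).differentiableWithinAt
  · intro z _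
    rw [mul_pow, hEm, exp_mul_rootFn_pow hm]
  · intro k hk
    simp [hk]
  · intro z hz
    set t := rootFn m χ z with ht
    have htR : t ∈ Metric.eball (0 : ℂ) R := by
      rw [Metric.eball_coe, mem_ball_zero_iff]
      exact h.norm_rootFn_lt hm hR hδ hz
    have hs := (hps.hasSum htR).mul_left (t ^ (2 * m + 1))
    rw [zero_add] at hs
    have hg : puiseuxFn m χ G₁ z = t ^ (2 * m + 1) * G₁ t := by
      simp only [puiseuxFn, ← ht]; congr 2; ring
    rw [hg]
    have hsum := (hasSum_nat_add_iff (f := fun k => (if k ≤ 2 * m then 0 else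
      p.coeff (k - (2 * m + 1)) / E ^ k) * (E * t) ^ k) (g := t ^ (2 * m + 1) * G₁ t)
      (2 * m + 1)).1 (by
        refine hs.congr_fun fun k => ?_
        have h1 : ¬ (k + (2 * m + 1) ≤ 2 * m) := by omega
        have h2 : E ^ (k + (2 * m + 1)) ≠ 0 := pow_ne_zero _ hE0
        simp only [h1, if_false, Nat.add_sub_cancel, FormalMultilinearSeries.apply_eq_pow_smul_coeff,
          smul_eq_mul, mul_pow]
        rw [div_mul_eq_mul_div, div_eq_iff h2]
        ring)
    rw [Finset.sum_eq_zero, add_zero] at hsum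
    · exact hsum
    · intro k hk
      rw [Finset.mem_range] at hk
      simp [Nat.lt_succ_iff.1 hk]

theorem IsPolarPair.differentiableOn_puiseuxFn (h : IsPolarPair δ χ β θ₁ θ₂) (hm : 0 < m)
    (hR : 0 < R) (hδ : δ = R ^ m) (hRR : R < R') {G₁ : ℂ → ℂ}
    (hG : DifferentiableOn ℂ G₁ (ball 0 R')) :
    DifferentiableOn ℂ (puiseuxFn m χ G₁) (polarRegion δ θ₁ θ₂) := by
  obtain ⟨g₁, g₂, -, -, -, h1, -⟩ := h.isC2UpToBoundary hm hR hδ hRR hG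
  exact fun z hz => (h1 z hz).differentiableAt.differentiableWithinAt

end

section

variable {γ α r : ℝ} {lam : ℂ →L[ℝ] ℝ} {z w : ℂ → ℂ} {n : ℕ}

/-! ### The normal form of an analytic disc at a good point -/

theorem exp_half_angle_pow {n : ℕ} (hn0 : 0 < n) :
    Complex.exp ((Real.pi / (2 * n) : ℝ) * Complex.I) ^ n = Complex.I := by
  have hn' : (n : ℂ) ≠ 0 := by exact_mod_cast hn0.ne'
  have h1 : (n : ℂ) * ((Real.pi / (2 * n) : ℝ) * Complex.I) = Real.pi / 2 * Complex.I := by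
    push_cast; field_simp
  rw [← Complex.exp_nat_mul, h1, Complex.exp_pi_div_two_mul_I]

/-- Coordinates `y` in which `z = exp(iχ) y ^ m` and `t = i (y exp(ℓ(y))) ^ n`. -/
theorem IsBoundaryDisc.exists_normal_form (h : IsBoundaryDisc γ lam z w r) (hγ : 1 < γ)
    (hα : Real.cos α = -1 / γ) (hα₁ : Real.pi / 2 < α) (hα₂ : α < Real.pi) (hn : Even n)
    (hn0 : 0 < n) (he : Complex.exp ((α / 2 : ℝ) * Complex.I) ^ n = 1) :
    ∃ (m : ℕ) (χ : ℝ) (ℓ κ G₁ : ℂ → ℂ), 0 < m ∧ m * (Real.pi / n) = Real.pi - α ∧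
      (χ = Real.pi / 2 ∨ χ = -(Real.pi / 2)) ∧ AnalyticAt ℂ ℓ 0 ∧ (ℓ 0).im = 0 ∧
      AnalyticAt ℂ κ 0 ∧ κ 0 = 0 ∧ AnalyticAt ℂ G₁ 0 ∧
      (∀ᶠ y in 𝓝 0, κ (y * Complex.exp (ℓ y)) = y) ∧
      (∀ᶠ u in 𝓝 0, κ u * Complex.exp (ℓ (κ u)) = u) ∧
      ∀ᶠ y in 𝓝 0,
        Complex.exp ((Real.pi / (2 * n) : ℝ) * Complex.I) * (y * Complex.exp (ℓ y)) ∈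
          closedSector n →
        z (Complex.I * (y * Complex.exp (ℓ y)) ^ n) = Complex.exp (χ * Complex.I) * y ^ m ∧
        w (Complex.I * (y * Complex.exp (ℓ y)) ^ n) = y ^ (m + (m + 1)) * G₁ y := by
  have hsin : Real.sin α ≠ 0 := (Real.sin_pos_of_pos_of_lt_pi (by linarith [Real.pi_pos]) hα₂).ne'
  obtain ⟨m, V, W, hm, hV, hW, hV0, hW0, hWw, hzV, hlevi, hb0, hb1⟩ :=
    h.exists_puiseux hγ hα hsin hn hn0 he
  have hmR : (0 : ℝ) < m := by exact_mod_cast hm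
  have hnR : (0 : ℝ) < n := by exact_mod_cast hn0
  have hpi := Real.pi_pos
  obtain ⟨hμ, harg⟩ := arg_eq_of_quadric_nonpos hγ hα hα₁ hα₂ hV0
    (μ := m * (Real.pi / n)) (by positivity) (by
      intro η hη
      have := hlevi (η / m) ⟨by have := hη.1; positivity, by
        rw [div_le_iff₀ hmR]; linarith [hη.2]⟩
      rwa [mul_div_cancel₀ _ hmR.ne'] at this) hb0 hb1
  -- The opening `m π / n = π - α` is less than `π / 2`. This inequality is what pushes the
  -- exponents of `w` above `2m`.
  have hlt : 2 * m + 1 ≤ n := by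
    have h1 : m * (Real.pi / n) < Real.pi / 2 := by linarith
    rw [mul_div_assoc', div_lt_iff₀ hnR] at h1
    have h2 : (2 * m : ℝ) < n := by nlinarith
    have h3 : 2 * m < n := by exact_mod_cast h2
    omega
  set c := V 0 with hc
  set ρ₀ : ℝ := ‖c‖ ^ ((m : ℝ)⁻¹) with hρ₀
  have hρ₀pos : 0 < ρ₀ := Real.rpow_pos_of_pos (norm_pos_iff.2 hV0) _
  have hρ₀m : ρ₀ ^ m = ‖c‖ := Real.rpow_inv_natCast_pow (norm_nonneg _) hm.ne'
  obtain ⟨v, hv, hv0, hvV⟩ := hV.exists_pow_eq_of_ne_zero hm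
    (c := ρ₀ * Complex.exp ((c.arg / m : ℝ) * Complex.I)) (by
      rw [pow_polar, hρ₀m, mul_div_cancel₀ _ hmR.ne', Complex.norm_mul_exp_arg_mul_I]) hV0
  -- The substitution `s = ν u` centres the sector on the positive axis, with `s ^ n = i u ^ n`.
  set ν : ℂ := Complex.exp ((Real.pi / (2 * n) : ℝ) * Complex.I) with hν
  set ε : ℂ := Complex.exp ((c.arg / m : ℝ) * Complex.I) with hε
  have hε0 : ε ≠ 0 := Complex.exp_ne_zero _
  have hνa : AnalyticAt ℂ (fun u : ℂ => ν * u) 0 := analyticAt_const.mul analyticAt_id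
  set κ₁ : ℂ → ℂ := fun u => v (ν * u) / ε with hκ₁
  have hκ₁a : AnalyticAt ℂ κ₁ 0 :=
    (AnalyticAt.comp (g := v) (by simpa using hv) hνa).div analyticAt_const hε0
  have hκ₁0 : κ₁ 0 = ρ₀ := by
    simp only [hκ₁, mul_zero, hv0]; rw [mul_div_assoc, div_self hε0, mul_one]
  have hκ₁ne : κ₁ 0 ≠ 0 := by rw [hκ₁0]; exact_mod_cast hρ₀pos.ne'
  -- `z = (s v(s)) ^ m` equals `(ν ε) ^ m κ(u) ^ m`, and `κ'(0) = ρ₀ > 0`; thus `y = κ u` is a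
  -- coordinate in which `z` is a pure power.
  set κ : ℂ → ℂ := fun u => u * κ₁ u with hκ
  have hκa : AnalyticAt ℂ κ 0 := analyticAt_id.mul hκ₁a
  have hκd : deriv κ 0 = κ₁ 0 := by
    have : HasDerivAt κ (1 * κ₁ 0 + id 0 * deriv κ₁ 0) 0 :=
      (hasDerivAt_id (0 : ℂ)).mul hκ₁a.differentiableAt.hasDerivAt
    rw [this.deriv]; simp
  have hκ0 : κ 0 = 0 := by simp [hκ]
  obtain ⟨g, hga, hg0, hκg, hgκ⟩ := hκa.exists_local_inverse hκ0 (by rw [hκd]; exact hκ₁ne)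
  have hκ₁g : AnalyticAt ℂ (fun y => κ₁ (g y)) 0 :=
    AnalyticAt.comp (g := κ₁) (by rw [hg0]; exact hκ₁a) hga
  have hκ₁g0 : κ₁ (g 0) = ρ₀ := by rw [hg0, hκ₁0]
  -- From `g y * κ₁ (g y) = y` the inverse `g` of `κ` is `y exp(ℓ y)`; the value `ℓ 0 = -log ρ₀` is
  -- real.
  set ℓ : ℂ → ℂ := fun y => -Complex.log (κ₁ (g y)) with hℓ
  have hℓa : AnalyticAt ℂ ℓ 0 :=
    (hκ₁g.clog (by rw [hκ₁g0]; exact Or.inl (by simpa using hρ₀pos))).neg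
  have hgℓ : ∀ᶠ y in 𝓝 0, y * Complex.exp (ℓ y) = g y := by
    filter_upwards [hκg, hκ₁g.continuousAt.eventually_ne (by rw [hκ₁g0, ← hκ₁0]; exact hκ₁ne)]
      with y h1 h2
    simp only [hℓ, Complex.exp_neg, Complex.exp_log h2]
    rw [← div_eq_mul_inv, div_eq_iff h2]
    exact h1.symm
  have hg0' : Tendsto g (𝓝 0) (𝓝 0) := by
    have := hga.continuousAt.tendsto; rwa [hg0] at this
  have hκ0' : Tendsto κ (𝓝 0) (𝓝 0) := by
    have := hκa.continuousAt.tendsto; rwa [hκ0] at this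
  -- `W 0 = 0` makes `w` divisible by `t = i y ^ n exp(n ℓ)`, hence by `y ^ (2 * m + 1)`.
  obtain ⟨W₁, hW₁, hWW⟩ : ∃ W₁ : ℂ → ℂ, AnalyticAt ℂ W₁ 0 ∧ ∀ᶠ t in 𝓝 0, W t = t * W₁ t := by
    rcases hW.exists_eventually_eq_pow_mul with h1 | ⟨k, W₁, h1, h2, h3⟩
    · exact ⟨fun _ => 0, analyticAt_const, by simpa using h1⟩
    · rcases k with _ | k
      · exfalso
        have := h3.self_of_nhds
        rw [hW0, pow_zero, one_mul] at this
        exact h2 this.symm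
      · refine ⟨fun t => t ^ k * W₁ t, (analyticAt_id.pow k).mul h1, ?_⟩
        filter_upwards [h3] with t ht
        rw [ht]; ring
  have hpowa : AnalyticAt ℂ (fun y => Complex.I * g y ^ n) 0 := analyticAt_const.mul (hga.pow n)
  have hpow0 : Complex.I * g 0 ^ n = 0 := by rw [hg0, zero_pow hn0.ne', mul_zero]
  have hpow0' : Tendsto (fun y => Complex.I * g y ^ n) (𝓝 0) (𝓝 0) := by
    have := hpowa.continuousAt.tendsto; rwa [hpow0] at this
  set G₁ : ℂ → ℂ := fun y => y ^ (n - (2 * m + 1)) *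
    (Complex.I * Complex.exp (n * ℓ y) * W₁ (Complex.I * g y ^ n)) with hG₁
  have hG₁a : AnalyticAt ℂ G₁ 0 := by
    refine (analyticAt_id.pow _).mul ((analyticAt_const.mul (analyticAt_const.mul hℓa).cexp).mul ?_)
    exact AnalyticAt.comp (g := W₁) (by rw [hpow0]; exact hW₁) hpowa
  refine ⟨m, c.arg + m * (Real.pi / (2 * n)), ℓ, κ, G₁, hm, hμ, ?_, hℓa, ?_, hκa, hκ0, hG₁a, ?_, ?_,
    ?_⟩
  -- `χ` is the bisector: the initial direction `c.arg` plus half of the opening `π - α`.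
  · have h1 : m * (Real.pi / (2 * n)) = (Real.pi - α) / 2 := by rw [← hμ]; ring
    rcases harg with h2 | h2
    · left; rw [h1, h2]; ring
    · right; rw [h1, h2]; ring
  · simp only [hℓ, hκ₁g0]
    rw [← Complex.ofReal_log hρ₀pos.le, ← Complex.ofReal_neg, Complex.ofReal_im]
  · filter_upwards [hgℓ, hκg] with y h1 h2
    rw [h1, h2]
  · filter_upwards [hκ0'.eventually hgℓ, hgκ] with u h1 h2
    rw [h1, h2]
  · have hνg : Tendsto (fun y => ν * g y) (𝓝 0) (𝓝 0) := by
      have := hg0'.const_mul ν; rwa [mul_zero] at this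
    have hz' := eventually_nhdsWithin_iff.1 hzV
    filter_upwards [hgℓ, hκg, hνg.eventually hz', hνg.eventually hvV, hpow0'.eventually hWW]
      with y h1 h2 h3 h4 h5 h6
    rw [h1] at h6 ⊢
    have h7 : (ν * g y) ^ n = Complex.I * g y ^ n := by rw [mul_pow, exp_half_angle_pow hn0]
    have h8 := h3 h6
    have him := im_pow_nonneg_of_mem_closedSector hn0 h6
    rw [h7] at h8 him
    constructor
    · have h9 : ν * g y * v (ν * g y) = ν * ε * y := by
        have h10 : g y * (v (ν * g y) / ε) = y := h2
        rw [← mul_div_assoc, div_eq_iff hε0] at h10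
        linear_combination ν * h10
      rw [h8, ← h4, ← mul_pow, h9, mul_pow, mul_pow, hν, hε, ← Complex.exp_nat_mul,
        ← Complex.exp_nat_mul, ← Complex.exp_add]
      congr 2
      have hmC : (m : ℂ) ≠ 0 := by exact_mod_cast hm.ne'
      push_cast; field_simp; ring
    · rw [← hWw _ him, h5]
      simp only [hG₁]
      nth_rewrite 1 [← h1]
      obtain ⟨d, hd⟩ := Nat.exists_eq_add_of_le hlt
      have h10 : n - (2 * m + 1) = d := by omega
      rw [h10, mul_pow, ← Complex.exp_nat_mul]
      have h11 : y ^ n = y ^ (m + (m + 1)) * y ^ d := by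
        rw [← pow_add]; congr 1; omega
      rw [h11]; ring

end

/-! ### From the normal form to a graph over a polar region -/

section

variable {γ α r : ℝ} {lam : ℂ →L[ℝ] ℝ} {z w : ℂ → ℂ} {n : ℕ}

theorem exp_I_lipschitz (a b : ℝ) :
    ‖Complex.exp (a * Complex.I) - Complex.exp (b * Complex.I)‖ ≤ |a - b| := by
  have h1 : Complex.exp (a * Complex.I) - Complex.exp (b * Complex.I) =
      Complex.exp (b * Complex.I) * (Complex.exp (Complex.I * (a - b : ℝ)) - 1) := by
    rw [mul_sub, ← Complex.exp_add]; push_cast; ring_nf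
  rw [h1, norm_mul, Complex.norm_exp_ofReal_mul_I, one_mul]
  exact Real.norm_exp_I_mul_ofReal_sub_one_le

/-- The angular function `η ↦ η + Im ℓ(ρ exp(iη))` is a small perturbation of the identity. -/
theorem exists_radius_angular {ℓ : ℂ → ℂ} (hℓ : AnalyticAt ℂ ℓ 0) (h0 : (ℓ 0).im = 0) {ε : ℝ}
    (hε : 0 < ε) :
    ∃ R₀ > 0, ContinuousOn ℓ (ball 0 R₀) ∧ (∀ y ∈ ball (0 : ℂ) R₀, |(ℓ y).im| ≤ ε) ∧
      ∀ ρ ∈ Ico 0 R₀, StrictMono fun η : ℝ => η + (ℓ (ρ * Complex.exp (η * Complex.I))).im := by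
  obtain ⟨K, s, hs, hK⟩ := hℓ.hasStrictDerivAt.hasStrictFDerivAt.exists_lipschitzOnWith
  have hc : ∀ᶠ y in 𝓝 0, |(ℓ y).im| ≤ ε := by
    have h1 : ContinuousAt (fun y => |(ℓ y).im|) 0 :=
      (Complex.continuous_im.continuousAt.comp hℓ.continuousAt).abs
    have h2 : |(ℓ 0).im| < ε := by rw [h0, abs_zero]; exact hε
    filter_upwards [h1.eventually (gt_mem_nhds h2)] with y hy using hy.le
  have hc2 : ∀ᶠ y in 𝓝 0, ContinuousAt ℓ y :=
    hℓ.eventually_analyticAt.mono fun y hy => hy.continuousAt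
  obtain ⟨R₁, hR₁, hsub⟩ := Metric.mem_nhds_iff.1 (inter_mem hs (hc.and hc2))
  have hK0 : (0 : ℝ) ≤ K := K.2
  -- For `ρ (K + 1) < 1` the Lipschitz bound makes the perturbation vary strictly less than `η`
  -- itself, so the sum stays increasing.
  refine ⟨min R₁ (1 / (K + 1)), by positivity, ?_, ?_, ?_⟩
  · intro y hy
    exact (hsub (ball_subset_ball (min_le_left _ _) hy)).2.2.continuousWithinAt
  · intro y hy
    exact (hsub (ball_subset_ball (min_le_left _ _) hy)).2.1
  · intro ρ hρ a b hab
    have hmem : ∀ η : ℝ, (ρ : ℂ) * Complex.exp (η * Complex.I) ∈ s := by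
      intro η
      refine (hsub ?_).1
      rw [mem_ball_zero_iff, norm_polar hρ.1]
      exact hρ.2.trans_le (min_le_left _ _)
    have h1 := hK.dist_le_mul _ (hmem a) _ (hmem b)
    rw [dist_eq_norm, dist_eq_norm, ← mul_sub, norm_mul, Complex.norm_real,
      Real.norm_of_nonneg hρ.1] at h1
    have h2 := exp_I_lipschitz a b
    have h3 := Complex.abs_im_le_norm (ℓ (ρ * Complex.exp (a * Complex.I)) -
      ℓ (ρ * Complex.exp (b * Complex.I)))
    rw [Complex.sub_im] at h3
    have h4 : ρ * (K + 1) < 1 := by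
      have := hρ.2.trans_le (min_le_right _ _)
      rwa [lt_div_iff₀ (by positivity)] at this
    have h5 : |a - b| = b - a := by rw [abs_sub_comm, abs_of_pos (sub_pos.2 hab)]
    rw [h5] at h2
    have h6 : (K : ℝ) * (ρ * ‖Complex.exp (a * Complex.I) - Complex.exp (b * Complex.I)‖) ≤
        K * (ρ * (b - a)) := by
      apply mul_le_mul_of_nonneg_left _ hK0
      exact mul_le_mul_of_nonneg_left h2 hρ.1
    have h7 : K * (ρ * (b - a)) < b - a := by
      have h8 : ρ * K < 1 := by nlinarith [hρ.1]
      have h9 : 0 < b - a := sub_pos.2 hab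
      nlinarith
    have h10 := abs_lt.1 ((h3.trans h1).trans_lt (h6.trans_lt h7))
    simp only
    linarith [h10.2]

theorem closedSector_of_polar {n : ℕ} (hn0 : 0 < n) {ρ φ : ℝ} (hρ : 0 < ρ)
    (hφ : φ ∈ Ioo (-(Real.pi / (2 * n))) (Real.pi / (2 * n))) :
    Complex.exp ((Real.pi / (2 * n) : ℝ) * Complex.I) * (ρ * Complex.exp (φ * Complex.I)) ∈
      closedSector n := by
  have hnR : (0 : ℝ) < n := by exact_mod_cast hn0
  refine ⟨ρ, Real.pi / (2 * n) + φ, hρ, ⟨by linarith [hφ.1], ?_⟩, ?_⟩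
  · have : Real.pi / n = Real.pi / (2 * n) + Real.pi / (2 * n) := by field_simp; norm_num
    rw [this]; linarith [hφ.2]
  · rw [mul_left_comm, ← Complex.exp_add]; push_cast; ring_nf

theorem im_I_mul_polar_pow {n : ℕ} (hn0 : 0 < n) {ρ φ : ℝ} (hρ : 0 < ρ)
    (hφ : φ ∈ Ioo (-(Real.pi / (2 * n))) (Real.pi / (2 * n))) :
    0 < (Complex.I * ((ρ : ℂ) * Complex.exp (φ * Complex.I)) ^ n).im := by
  have hnR : (0 : ℝ) < n := by exact_mod_cast hn0
  rw [pow_polar, Complex.I_mul_im, Complex.re_ofReal_mul, Complex.exp_ofReal_mul_I_re]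
  refine mul_pos (by positivity) (Real.cos_pos_of_mem_Ioo ⟨?_, ?_⟩)
  · have := mul_lt_mul_of_pos_left hφ.1 hnR
    have h2 : (n : ℝ) * -(Real.pi / (2 * n)) = -(Real.pi / 2) := by field_simp
    linarith
  · have := mul_lt_mul_of_pos_left hφ.2 hnR
    have h2 : (n : ℝ) * (Real.pi / (2 * n)) = Real.pi / 2 := by field_simp
    linarith

/-- Every point of the upper half plane is of the form `i u ^ n` with `u` in a thin sector. -/
theorem exists_polar_of_im_pos {n : ℕ} (hn0 : 0 < n) {t : ℂ} (ht : 0 < t.im) :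
    ∃ ρ φ : ℝ, 0 < ρ ∧ ρ ^ n = ‖t‖ ∧ φ ∈ Ioo (-(Real.pi / (2 * n))) (Real.pi / (2 * n)) ∧
      t = Complex.I * ((ρ : ℂ) * Complex.exp (φ * Complex.I)) ^ n := by
  have hnR : (0 : ℝ) < n := by exact_mod_cast hn0
  have ht0 : t ≠ 0 := by rintro rfl; simp at ht
  set q : ℂ := -Complex.I * t with hq
  have hqn : ‖q‖ = ‖t‖ := by simp [hq]
  have hqa : |q.arg| < Real.pi / 2 := by
    rw [Complex.abs_arg_lt_pi_div_two_iff]; left; simpa [hq] using ht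
  have hqa' := abs_lt.1 hqa
  have hpow : (‖t‖ ^ ((n : ℝ)⁻¹)) ^ n = ‖t‖ := Real.rpow_inv_natCast_pow (norm_nonneg _) hn0.ne'
  refine ⟨‖t‖ ^ ((n : ℝ)⁻¹), q.arg / n, Real.rpow_pos_of_pos (norm_pos_iff.2 ht0) _, hpow,
    ⟨?_, ?_⟩, ?_⟩
  · rw [lt_div_iff₀ hnR]
    have h2 : -(Real.pi / (2 * n)) * (n : ℝ) = -(Real.pi / 2) := by field_simp
    linarith
  · rw [div_lt_iff₀ hnR]
    have h2 : (Real.pi / (2 * n)) * (n : ℝ) = Real.pi / 2 := by field_simp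
    linarith
  · rw [pow_polar, hpow, mul_div_cancel₀ _ hnR.ne', ← hqn, Complex.norm_mul_exp_arg_mul_I, hq,
      ← mul_assoc]
    simp

/-- `y ↦ exp(iχ) y ^ m` multiplies angles by `m` and raises radii to the power `m`, so the curves
`H₁`, `H₂` in `y` become the boundary curves in `z`. -/
theorem mem_polarRegion_pow_iff {m : ℕ} (hm : 0 < m) {χ R : ℝ} {H₁ H₂ : ℝ → ℝ} {ζ : ℂ} (hR : 0 < R) :
    ζ ∈ polarRegion (R ^ m) (fun r => χ + m * H₁ (r ^ ((m : ℝ)⁻¹)))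
      (fun r => χ + m * H₂ (r ^ ((m : ℝ)⁻¹))) ↔
    ∃ ρ η : ℝ, ρ ∈ Ioo 0 R ∧ η ∈ Ioo (H₁ ρ) (H₂ ρ) ∧
      ζ = Complex.exp (χ * Complex.I) * ((ρ : ℂ) * Complex.exp (η * Complex.I)) ^ m := by
  have hmR : (0 : ℝ) < m := by exact_mod_cast hm
  constructor
  · rintro ⟨s, θ, hs, hθ, rfl⟩
    have hpow : (s ^ ((m : ℝ)⁻¹)) ^ m = s := Real.rpow_inv_natCast_pow hs.1.le hm.ne'
    refine ⟨s ^ ((m : ℝ)⁻¹), (θ - χ) / m, ⟨Real.rpow_pos_of_pos hs.1 _, ?_⟩, ⟨?_, ?_⟩, ?_⟩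
    · refine lt_of_pow_lt_pow_left₀ m hR.le ?_
      rw [hpow]; exact hs.2
    · rw [lt_div_iff₀ hmR]; linarith [hθ.1]
    · rw [div_lt_iff₀ hmR]; linarith [hθ.2]
    · rw [pow_polar, hpow, mul_div_cancel₀ _ hmR.ne', mul_left_comm, ← Complex.exp_add]
      push_cast; ring_nf
  · rintro ⟨ρ, η, hρ, hη, rfl⟩
    have hpow : (ρ ^ m) ^ ((m : ℝ)⁻¹) = ρ := Real.pow_rpow_inv_natCast hρ.1.le hm.ne'
    refine ⟨ρ ^ m, χ + m * η, ⟨pow_pos hρ.1 m, pow_lt_pow_left₀ hρ.2 hρ.1.le hm.ne'⟩, ?_, ?_⟩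
    · simp only [hpow]
      have h1 := mul_lt_mul_of_pos_left hη.1 hmR
      have h2 := mul_lt_mul_of_pos_left hη.2 hmR
      exact ⟨by linarith, by linarith⟩
    · rw [pow_polar, mul_left_comm, ← Complex.exp_add]
      push_cast; ring_nf

theorem polar_mul_exp (ρ φ : ℝ) (l : ℂ) :
    (ρ : ℂ) * Complex.exp (φ * Complex.I) * Complex.exp l =
      (ρ * Real.exp l.re : ℝ) * Complex.exp ((φ + l.im : ℝ) * Complex.I) := by
  conv_lhs => rw [← Complex.re_add_im l, Complex.exp_add]
  push_cast
  rw [add_mul, Complex.exp_add]; ring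

/-- Near a boundary point which is mapped to the hyperbolic point, an analytic disc is a graph over
a domain asymptotic to one of the two sectors. -/
theorem IsBoundaryDisc.exists_graph (h : IsBoundaryDisc γ lam z w r) (hγ : 1 < γ)
    (hα : Real.cos α = -1 / γ) (hα₁ : Real.pi / 2 < α) (hα₂ : α < Real.pi) (hn : Even n)
    (hn0 : 0 < n) (he : Complex.exp ((α / 2 : ℝ) * Complex.I) ^ n = 1) :
    ∃ V ∈ 𝓝 (0 : ℂ), V ⊆ ball 0 r ∧ ∃ (D : Set ℂ) (g : ℂ → ℂ),
      IsHolomorphicGraph ((fun t => (z t, w t)) '' (V ∩ {t | 0 < t.im})) D g ∧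
      HasPuiseuxExpansion D g ∧
      (IsAsymptoticToSector D (admissibleSector γ 1) ∨
        IsAsymptoticToSector D (admissibleSector γ (-1))) ∧
      IsC2UpToBoundary D g := by
  obtain ⟨m, χ, ℓ, κ, G₁, hm, hμ, hχ, hℓ, hℓ0, hκa, hκ0, hG₁, hκℓ, hℓκ, hzw⟩ :=
    h.exists_normal_form hγ hα hα₁ hα₂ hn hn0 he
  have hmR : (0 : ℝ) < m := by exact_mod_cast hm
  have hnR : (0 : ℝ) < n := by exact_mod_cast hn0
  have hpi := Real.pi_pos
  -- An angular error `π / (8m)` in `y` costs at most `π / 8` in `z`, and `(π - α) / 2 + π / 8 < π /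
  -- 2`.
  obtain ⟨R₀, hR₀, hℓc, hℓε, hmono⟩ := exists_radius_angular hℓ hℓ0
    (ε := Real.pi / (8 * m)) (by positivity)
  set T : ℝ := Real.pi / (2 * n) with hT
  have hTpos : 0 < T := by positivity
  have hmT : m * T = (Real.pi - α) / 2 := by rw [← hμ, hT]; field_simp
  -- An argument of `u = y exp(ℓ y)` at `y = ρ exp(iη)`. Since `t = i u ^ n`, arguments in `(-T, T)`
  -- give the upper half plane, and the solutions `H₁`, `H₂` of `B = -T`, `B = T` bound the region
  -- in `y`.
  set B : ℝ → ℝ → ℝ := fun ρ η => η + (ℓ (ρ * Complex.exp (η * Complex.I))).im with hB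
  have hBcont : ContinuousOn (Function.uncurry B) (Ico 0 R₀ ×ˢ univ) := by
    have c1 : Continuous fun x : ℝ × ℝ => (x.1 : ℂ) * Complex.exp (x.2 * Complex.I) := by fun_prop
    refine continuousOn_snd.add (Complex.continuous_im.comp_continuousOn
      (hℓc.comp c1.continuousOn ?_))
    rintro ⟨ρ, η⟩ ⟨hρ, -⟩
    rw [mem_ball_zero_iff, norm_polar hρ.1]; exact hρ.2
  have hBε : ∀ ρ ∈ Ico 0 R₀, ∀ η, |B ρ η - η| ≤ Real.pi / (8 * m) := by
    intro ρ hρ η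
    simp only [hB, add_sub_cancel_left]
    apply hℓε
    rw [mem_ball_zero_iff, norm_polar hρ.1]; exact hρ.2
  obtain ⟨H₁, hH₁c, hH₁⟩ := exists_continuousOn_implicit hBcont hmono hBε (-T)
  obtain ⟨H₂, hH₂c, hH₂⟩ := exists_continuousOn_implicit hBcont hmono hBε T
  -- the radii
  obtain ⟨R₁, hR₁, hsubκ⟩ := Metric.eventually_nhds_iff_ball.1
    (hκℓ.and (hzw.and hG₁.eventually_analyticAt))
  have hκ0' : Tendsto κ (𝓝 0) (𝓝 0) := by
    have := hκa.continuousAt.tendsto; rwa [hκ0] at this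
  set R' := min R₀ R₁ with hR'
  have hR'pos : 0 < R' := lt_min hR₀ hR₁
  obtain ⟨ru, hru, hsubu⟩ := Metric.eventually_nhds_iff_ball.1
    (hℓκ.and (hκ0'.eventually (ball_mem_nhds 0 hR'pos)))
  set ru' := min ru (min 1 r) with hru'
  have hru'pos : 0 < ru' := lt_min hru (lt_min one_pos h.pos)
  have hh0 : Tendsto (fun y => y * Complex.exp (ℓ y)) (𝓝 0) (𝓝 0) := by
    have h1 : ContinuousAt (fun y => y * Complex.exp (ℓ y)) 0 :=
      continuousAt_id.mul hℓ.continuousAt.cexp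
    have h2 := h1.tendsto
    rwa [zero_mul] at h2
  obtain ⟨R₂, hR₂, hsubh⟩ := Metric.eventually_nhds_iff_ball.1
    (hh0.eventually (ball_mem_nhds 0 hru'pos))
  set R := min (R' / 2) R₂ with hR
  have hRpos : 0 < R := lt_min (by positivity) hR₂
  have hRR' : R < R' := (min_le_left _ _).trans_lt (by linarith)
  have hRR₀ : R < R₀ := hRR'.trans_le (min_le_left _ _)
  set θ₁ : ℝ → ℝ := fun r => χ + m * H₁ (r ^ ((m : ℝ)⁻¹)) with hθ₁
  set θ₂ : ℝ → ℝ := fun r => χ + m * H₂ (r ^ ((m : ℝ)⁻¹)) with hθ₂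
  have hroot : ∀ s ∈ Ico 0 (R ^ m), s ^ ((m : ℝ)⁻¹) ∈ Ico 0 R₀ := by
    intro s hs
    refine ⟨Real.rpow_nonneg hs.1 _, lt_trans ?_ hRR₀⟩
    refine lt_of_pow_lt_pow_left₀ m hRpos.le ?_
    rw [Real.rpow_inv_natCast_pow hs.1 hm.ne']; exact hs.2
  have hrootc : ContinuousOn (fun s : ℝ => s ^ ((m : ℝ)⁻¹)) (Ico 0 (R ^ m)) :=
    (Real.continuous_rpow_const (by positivity)).continuousOn
  have hnear : ∀ (H : ℝ → ℝ) (S : ℝ), |S| = T → (∀ ρ ∈ Ico 0 R₀, B ρ (H ρ) = S) →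
      ∀ s ∈ Ico 0 (R ^ m), |χ + m * H (s ^ ((m : ℝ)⁻¹)) - χ| ≤ (Real.pi - α) / 2 + Real.pi / 8 := by
    intro H S hS hH s hs
    have h1 := hBε _ (hroot s hs) (H (s ^ ((m : ℝ)⁻¹)))
    rw [hH _ (hroot s hs)] at h1
    rw [add_sub_cancel_left, abs_mul, abs_of_pos hmR]
    have h2 : |H (s ^ ((m : ℝ)⁻¹))| ≤ T + Real.pi / (8 * m) := by
      have := abs_sub_abs_le_abs_sub (H (s ^ ((m : ℝ)⁻¹))) S
      rw [abs_sub_comm] at this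
      linarith
    calc _ ≤ m * (T + Real.pi / (8 * m)) := mul_le_mul_of_nonneg_left h2 hmR.le
      _ = _ := by rw [mul_add, hmT]; field_simp
  have hpair : IsPolarPair (R ^ m) χ ((Real.pi - α) / 2 + Real.pi / 8) θ₁ θ₂ := by
    refine ⟨by positivity, by linarith, ?_, ?_, ?_, ?_, ?_⟩
    · exact continuousOn_const.add (continuousOn_const.mul (hH₁c.comp hrootc hroot))
    · exact continuousOn_const.add (continuousOn_const.mul (hH₂c.comp hrootc hroot))
    · intro s hs
      have h1 : H₁ (s ^ ((m : ℝ)⁻¹)) < H₂ (s ^ ((m : ℝ)⁻¹)) := by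
        rw [← (hmono _ (hroot s hs)).lt_iff_lt]
        have e1 := hH₁ _ (hroot s hs)
        have e2 := hH₂ _ (hroot s hs)
        simp only [hB] at e1 e2
        simp only [e1, e2]
        linarith
      have := mul_lt_mul_of_pos_left h1 hmR
      simp only [hθ₁, hθ₂]; linarith
    · exact hnear H₁ (-T) (by rw [abs_neg, abs_of_pos hTpos]) hH₁
    · exact hnear H₂ T (abs_of_pos hTpos) hH₂
  have hH0 : ∀ (H : ℝ → ℝ) (S : ℝ), (∀ ρ ∈ Ico 0 R₀, B ρ (H ρ) = S) → H 0 = S := by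
    intro H S hH
    have := hH 0 ⟨le_rfl, hR₀⟩
    simp only [hB, Complex.ofReal_zero, zero_mul, hℓ0, add_zero] at this
    exact this
  have hG₁d : DifferentiableOn ℂ G₁ (ball 0 R') := fun y hy =>
    (hsubκ y (ball_subset_ball (min_le_right _ _) hy)).2.2.differentiableAt.differentiableWithinAt
  have hB_iff : ∀ ρ ∈ Ioo 0 R, ∀ η, η ∈ Ioo (H₁ ρ) (H₂ ρ) ↔ B ρ η ∈ Ioo (-T) T := by
    intro ρ hρ η
    have hρ' : ρ ∈ Ico 0 R₀ := ⟨hρ.1.le, hρ.2.trans hRR₀⟩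
    have a := (hmono ρ hρ').lt_iff_lt (a := H₁ ρ) (b := η)
    have b := (hmono ρ hρ').lt_iff_lt (a := η) (b := H₂ ρ)
    rw [← hH₁ _ hρ', ← hH₂ _ hρ']
    exact and_congr a.symm b.symm
  -- the values of `z` and `w`
  have hval : ∀ ρ ∈ Ioo 0 R, ∀ η, η ∈ Ioo (H₁ ρ) (H₂ ρ) → ∀ y t : ℂ,
      y = ρ * Complex.exp (η * Complex.I) → t = Complex.I * (y * Complex.exp (ℓ y)) ^ n →
      0 < t.im ∧ t ∈ ball 0 (ru' ^ n) ∧ ‖z t‖ < R ^ m ∧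
        z t = Complex.exp (χ * Complex.I) * y ^ m ∧ w t = puiseuxFn m χ G₁ (z t) := by
    intro ρ hρ η hη y t hy ht
    have hynorm : ‖y‖ = ρ := by rw [hy, norm_polar hρ.1.le]
    have hyR : y ∈ ball (0 : ℂ) R := by rw [mem_ball_zero_iff, hynorm]; exact hρ.2
    have hu : y * Complex.exp (ℓ y) = (ρ * Real.exp (ℓ y).re : ℝ) *
        Complex.exp ((η + (ℓ y).im : ℝ) * Complex.I) := by
      conv_lhs => rw [hy]
      rw [← hy, hy, polar_mul_exp]
    have hφ : η + (ℓ y).im ∈ Ioo (-T) T := by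
      have := (hB_iff ρ hρ η).1 hη
      simp only [hB] at this
      rwa [← hy] at this
    have hρu : 0 < ρ * Real.exp (ℓ y).re := mul_pos hρ.1 (Real.exp_pos _)
    obtain ⟨-, hz, -⟩ := hsubκ y (ball_subset_ball (hRR'.le.trans (min_le_right _ _)) hyR)
    have hz' := hz (by rw [hu]; exact closedSector_of_polar hn0 hρu hφ)
    rw [← ht] at hz'
    have hroot' : rootFn m χ (Complex.exp (χ * Complex.I) * y ^ m) = y := by
      refine rootFn_exp_mul_pow hm ?_
      have hs : ρ ^ m ∈ Ioo 0 (R ^ m) := ⟨pow_pos hρ.1 m, pow_lt_pow_left₀ hρ.2 hρ.1.le hm.ne'⟩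
      have hpw : (ρ ^ m) ^ ((m : ℝ)⁻¹) = ρ := Real.pow_rpow_inv_natCast hρ.1.le hm.ne'
      have h1 := hpair.near ⟨hs.1.le, hs.2⟩ (θ := χ + m * η) (by
        simp only [hθ₁, hθ₂, hpw]
        have h1 := mul_lt_mul_of_pos_left hη.1 hmR
        have h2 := mul_lt_mul_of_pos_left hη.2 hmR
        exact ⟨by linarith, by linarith⟩)
      rw [add_sub_cancel_left, abs_mul, abs_of_pos hmR] at h1
      have hm1 : (1 : ℝ) ≤ m := by exact_mod_cast hm
      have h2 : |η| < Real.pi := by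
        have := mul_le_mul_of_nonneg_right hm1 (abs_nonneg η)
        linarith
      have h3 : y.arg = η := by
        have h4 := abs_lt.1 h2
        rw [hy, Complex.arg_real_mul _ hρ.1, Complex.exp_mul_I,
          Complex.arg_cos_add_sin_mul_I ⟨h4.1, h4.2.le⟩]
      rw [h3]; linarith
    refine ⟨?_, ?_, ?_, hz'.1, ?_⟩
    · rw [ht, hu]; exact im_I_mul_polar_pow hn0 hρu hφ
    · have h1 := hsubh y (ball_subset_ball (min_le_right _ _) hyR)
      rw [dist_zero_right] at h1
      rw [mem_ball_zero_iff, ht, norm_mul, Complex.norm_I, one_mul, norm_pow]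
      exact pow_lt_pow_left₀ h1 (norm_nonneg _) hn0.ne'
    · rw [hz'.1, norm_mul, Complex.norm_exp_ofReal_mul_I, one_mul, norm_pow, hynorm]
      exact pow_lt_pow_left₀ hρ.2 hρ.1.le hm.ne'
    · rw [hz'.1, puiseuxFn, hroot', hz'.2]
  have hru'r : ru' ^ n ≤ r := by
    calc ru' ^ n ≤ ru' ^ 1 := pow_le_pow_of_le_one hru'pos.le
          ((min_le_right _ _).trans (min_le_left _ _)) hn0
      _ = ru' := pow_one _
      _ ≤ r := (min_le_right _ _).trans (min_le_right _ _)
  -- Cutting off by `‖z t‖ < R ^ m`, and not by `‖t‖` alone, makes the projection exactly the polar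
  -- region. The disc is controlled only for `0 ≤ t.im`, hence the implication.
  refine ⟨{t | t ∈ ball (0 : ℂ) (ru' ^ n) ∧ (0 ≤ t.im → ‖z t‖ < R ^ m)}, ?_,
    fun t ht => ball_subset_ball hru'r ht.1, polarRegion (R ^ m) θ₁ θ₂, puiseuxFn m χ G₁, ?_,
    hpair.hasPuiseuxExpansion hm hRpos rfl hRR' hG₁d, ?_,
    hpair.isC2UpToBoundary hm hRpos rfl hRR' hG₁d⟩
  · refine inter_mem (ball_mem_nhds 0 (by positivity)) ?_
    have h0 : (0 : ℂ) ∈ ball (0 : ℂ) r ∩ {t | 0 ≤ t.im} := ⟨by simpa using h.pos, by simp⟩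
    have h1 := (h.continuousOn_z 0 h0).norm
    have h2 : ‖z 0‖ < R ^ m := by rw [h.z_zero, norm_zero]; positivity
    have h3 := eventually_nhdsWithin_iff.1 (h1.eventually (gt_mem_nhds h2))
    filter_upwards [h3, ball_mem_nhds (0 : ℂ) h.pos] with t h4 h5 h6
    exact h4 ⟨h5, h6⟩
  · refine ⟨hpair.isOpen, hpair.isConnected, hpair.zero_mem_frontier,
      hpair.differentiableOn_puiseuxFn hm hRpos rfl hRR' hG₁d, ?_⟩
    ext x
    constructor
    · rintro ⟨t, ⟨⟨ht, htz⟩, him⟩, rfl⟩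
      obtain ⟨ρu, φ, hρu, hρun, hφ, htu⟩ := exists_polar_of_im_pos hn0 him
      set u : ℂ := (ρu : ℂ) * Complex.exp (φ * Complex.I) with hu
      have hub : u ∈ ball (0 : ℂ) ru := by
        rw [mem_ball_zero_iff, hu, norm_polar hρu.le]
        refine lt_of_lt_of_le ?_ (min_le_left ru (min 1 r))
        refine lt_of_pow_lt_pow_left₀ n hru'pos.le ?_
        rw [hρun]; rwa [mem_ball_zero_iff] at ht
      obtain ⟨h1, h2⟩ := hsubu u hub
      set y := κ u with hy
      set ρ : ℝ := ρu * Real.exp (-ℓ y).re with hρ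
      set η : ℝ := φ + (-ℓ y).im with hη
      have hy' : y = ρ * Complex.exp (η * Complex.I) := by
        rw [hρ, hη, ← polar_mul_exp, ← hu]
        conv_rhs => rw [← h1]
        rw [mul_assoc, ← Complex.exp_add, add_neg_cancel, Complex.exp_zero, mul_one]
      have hρpos : 0 < ρ := mul_pos hρu (Real.exp_pos _)
      have hynorm : ‖y‖ = ρ := by rw [hy', norm_polar hρpos.le]
      obtain ⟨-, hzy, -⟩ := hsubκ y (ball_subset_ball (min_le_right _ _) h2)
      rw [h1] at hzy
      have hz' := hzy (closedSector_of_polar hn0 hρu hφ)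
      rw [← htu] at hz'
      have hρR : ρ < R := by
        have h3 := htz him.le
        rw [hz'.1, norm_mul, Complex.norm_exp_ofReal_mul_I, one_mul, norm_pow, hynorm] at h3
        exact lt_of_pow_lt_pow_left₀ m hRpos.le h3
      have hηmem : η ∈ Ioo (H₁ ρ) (H₂ ρ) := by
        rw [hB_iff ρ ⟨hρpos, hρR⟩]
        simp only [hB]
        rw [← hy', hη, Complex.neg_im, neg_add_cancel_right]
        exact hφ
      have hv := hval ρ ⟨hρpos, hρR⟩ η hηmem y t hy' (by rw [h1]; exact htu)
      refine ⟨z t, (mem_polarRegion_pow_iff hm hRpos).2 ⟨ρ, η, ⟨hρpos, hρR⟩, hηmem, ?_⟩, ?_⟩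
      · rw [← hy']; exact hv.2.2.2.1
      · simp only [hv.2.2.2.2]
    · rintro ⟨ζ, hζ, rfl⟩
      obtain ⟨ρ, η, hρ, hη, hζ'⟩ := (mem_polarRegion_pow_iff hm hRpos).1 hζ
      obtain ⟨h1, h2, h3, h4, h5⟩ := hval ρ hρ η hη _ _ rfl rfl
      rw [← hζ'] at h4
      refine ⟨_, ⟨⟨h2, fun _ => h3⟩, h1⟩, ?_⟩
      simp only [h5, h4]
  · have h1 : θ₁ 0 = χ - (Real.pi - α) / 2 := by
      simp only [hθ₁]
      rw [Real.zero_rpow (by positivity), hH0 H₁ (-T) hH₁, mul_neg, hmT]; ring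
    have h2 : θ₂ 0 = χ + (Real.pi - α) / 2 := by
      simp only [hθ₂]
      rw [Real.zero_rpow (by positivity), hH0 H₂ T hH₂, hmT]
    rcases hχ with hχ | hχ
    · left
      apply hpair.isAsymptoticToSector
      rw [admissibleSector_one hγ hα (by linarith) hα₂, h1, h2, hχ]
      rw [show Real.pi / 2 - (Real.pi - α) / 2 = α / 2 by ring,
        show Real.pi / 2 + (Real.pi - α) / 2 = Real.pi - α / 2 by ring]
    · right
      apply hpair.isAsymptoticToSector
      rw [admissibleSector_neg_one hγ hα (by linarith) hα₂, h1, h2, hχ]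
      rw [show -(Real.pi / 2) - (Real.pi - α) / 2 = α / 2 - Real.pi by ring,
        show -(Real.pi / 2) + (Real.pi - α) / 2 = -(α / 2) by ring]

end

/-! ### The Levi inequality -/

theorem quadric_eq_norm_sq_add (γ : ℝ) (z : ℂ) :
    quadric γ z = ‖z ^ 2‖ + γ * (z ^ 2).re := by
  rw [quadric, norm_pow, Complex.sq_norm]

/-- A holomorphic disc which satisfies the Levi inequality and touches the origin at an interior
point is constant. -/
theorem eventually_eq_zero_of_levi {γ : ℝ} {lam : ℂ →L[ℝ] ℝ} {z w : ℂ → ℂ}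
    (hz : AnalyticAt ℂ z 0) (hw : AnalyticAt ℂ w 0) (hz0 : z 0 = 0) (hw0 : w 0 = 0)
    (hlam : lam 1 = -1)
    (levi : ∀ ε > 0, ∀ᶠ t in 𝓝 (0 : ℂ),
      lam (w t) + quadric γ (z t) ≤ ε * (‖z t‖ ^ 2 + ‖w t‖)) :
    ∀ᶠ t in 𝓝 (0 : ℂ), z t = 0 ∧ w t = 0 := by
  by_contra hcon
  -- In the Levi inequality `z ^ 2` and `w` have equal weight, so a common power `t ^ k` is removed
  -- from this pair.
  have hne : ¬ ((∀ᶠ t in 𝓝 (0 : ℂ), z t ^ 2 = 0) ∧ ∀ᶠ t in 𝓝 (0 : ℂ), w t = 0) := by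
    rintro ⟨h1, h2⟩
    exact hcon (by filter_upwards [h1, h2] with t h3 h4 using ⟨by simpa using h3, h4⟩)
  obtain ⟨k, p, q, hp, hq, hpq, hP, hQ⟩ := (hz.pow 2).exists_pow_dvd_pair hw hne
  simp only [Pi.pow_apply] at hP
  have hk : k ≠ 0 := by
    rintro rfl
    have h1 := hP.self_of_nhds
    have h2 := hQ.self_of_nhds
    rw [hz0] at h1
    rw [hw0] at h2
    rcases hpq with h | h
    · exact h (by simpa using h1.symm)
    · exact h (by simpa using h2.symm)
  -- As `t` approaches `0` along rays, `t ^ k` takes every phase `u`, because `k > 0`. The choices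
  -- `u = 1` and `u = -1` together give `p 0 = 0`; a phase with `u * q 0 = -‖q 0‖`, where `lam` is
  -- positive, then contradicts `q 0 ≠ 0`.
  have main : ∀ u : ℂ, ‖u‖ = 1 → lam (u * q 0) + (‖p 0‖ + γ * (u * p 0).re) ≤ 0 := by
    intro u hu
    obtain ⟨e, he⟩ := IsAlgClosed.exists_pow_nat_eq u (Nat.pos_of_ne_zero hk)
    have hte := tendsto_real_mul_nhds_zero e
    have hpt := hp.continuousAt.tendsto.comp hte
    have hqt := hq.continuousAt.tendsto.comp hte
    have key : ∀ ε > 0, lam (u * q 0) + (‖u * p 0‖ + γ * (u * p 0).re) ≤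
        ε * (‖u * p 0‖ + ‖u * q 0‖) := by
      intro ε hε
      have L1 : Tendsto (fun r : ℝ => lam (u * q (r * e)) +
          (‖u * p (r * e)‖ + γ * (u * p (r * e)).re)) (𝓝[>] 0)
          (𝓝 (lam (u * q 0) + (‖u * p 0‖ + γ * (u * p 0).re))) := by
        have hq1 := (hqt.const_mul u)
        have hp1 := (hpt.const_mul u)
        exact ((lam.continuous.tendsto _).comp hq1).add
          (hp1.norm.add (((Complex.continuous_re.tendsto _).comp hp1).const_mul γ))
      have L2 : Tendsto (fun r : ℝ => ε * (‖u * p (r * e)‖ + ‖u * q (r * e)‖)) (𝓝[>] 0)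
          (𝓝 (ε * (‖u * p 0‖ + ‖u * q 0‖))) :=
        ((hpt.const_mul u).norm.add (hqt.const_mul u).norm).const_mul ε
      refine le_of_tendsto_of_tendsto L1 L2 ?_
      filter_upwards [hte.eventually (levi ε hε), hte.eventually hP, hte.eventually hQ,
        self_mem_nhdsWithin] with r h1 h2 h3 hr
      have hr' : (0 : ℝ) < r := hr
      have e1 : ∀ x : ℂ, (r * e) ^ k * x = (r ^ k : ℝ) • (u * x) := by
        intro x; rw [mul_pow, he, Complex.real_smul]; push_cast; ring
      rw [e1] at h2 h3
      rw [quadric_eq_norm_sq_add, ← norm_pow, h2, h3, map_smul, norm_smul, norm_smul,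
        Complex.smul_re, smul_eq_mul, smul_eq_mul, Real.norm_of_nonneg (by positivity)] at h1
      have hrk : 0 < r ^ k := by positivity
      refine le_of_mul_le_mul_left ?_ hrk
      linarith
    have h0 : Tendsto (fun ε : ℝ => ε * (‖u * p 0‖ + ‖u * q 0‖)) (𝓝[>] 0) (𝓝 0) := by
      have : Tendsto (fun ε : ℝ => ε * (‖u * p 0‖ + ‖u * q 0‖)) (𝓝 0)
          (𝓝 (0 * (‖u * p 0‖ + ‖u * q 0‖))) := (Continuous.tendsto (by fun_prop) 0)
      rw [zero_mul] at this
      exact this.mono_left nhdsWithin_le_nhds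
    have := ge_of_tendsto h0 (by filter_upwards [self_mem_nhdsWithin] with ε hε using key ε hε)
    rwa [norm_mul u (p 0), hu, one_mul] at this
  have hp0 : p 0 = 0 := by
    have h1 := main 1 (by simp)
    have h2 := main (-1) (by simp)
    simp only [neg_mul, one_mul, map_neg, Complex.neg_re] at h1 h2
    have h3 : ‖p 0‖ ≤ 0 := by linarith
    simpa using h3
  have hq0 : q 0 ≠ 0 := hpq.resolve_left (by simp [hp0])
  have hn : ‖q 0‖ ≠ 0 := by simpa using hq0
  have h1 := main (-(starRingEnd ℂ (q 0)) / ‖q 0‖) (by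
    rw [norm_div, norm_neg, RCLike.norm_conj, Complex.norm_real, norm_norm, div_self hn])
  have h2 : -(starRingEnd ℂ (q 0)) / ‖q 0‖ * q 0 = (-‖q 0‖ : ℝ) • (1 : ℂ) := by
    have hn' : (‖q 0‖ : ℂ) ≠ 0 := by exact_mod_cast hn
    have h3 : starRingEnd ℂ (q 0) * q 0 = (‖q 0‖ : ℂ) ^ 2 := Complex.conj_mul' _
    rw [Complex.real_smul]
    push_cast
    field_simp
    linear_combination -h3
  rw [h2, map_smul, hlam, hp0] at h1
  simp only [smul_eq_mul, mul_zero, norm_zero, Complex.zero_re, add_zero] at h1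
  have := norm_pos_iff.2 hq0
  linarith

/-- Second order Taylor expansion. -/
theorem ContDiffAt.isLittleO_taylor_two {E : Type*} [NormedAddCommGroup E] [NormedSpace ℝ E]
    {ρ : E → ℝ} {a : E} (h : ContDiffAt ℝ 2 ρ a) :
    (fun x => ρ x - ρ a - fderiv ℝ ρ a (x - a) -
      (1 / 2 : ℝ) * fderiv ℝ (fderiv ℝ ρ) a (x - a) (x - a)) =o[𝓝 a] fun x => ‖x - a‖ ^ 2 := by
  set ℓ := fderiv ℝ ρ a
  set H := fderiv ℝ (fderiv ℝ ρ) a with hH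
  have hsymm : ∀ u v, H u v = H v u := fun u v =>
    (h.isSymmSndFDerivAt (by simp)).eq u v
  have hd : ∀ᶠ x in 𝓝 a, DifferentiableAt ℝ ρ x := by
    filter_upwards [h.eventually (by simp)] with x hx
    exact hx.differentiableAt (by simp)
  have hd2 : HasFDerivAt (fderiv ℝ ρ) H a :=
    ((h.fderiv_right (m := 1) (by norm_num)).differentiableAt (by simp)).hasFDerivAt
  rw [isLittleO_iff]
  intro c hc
  have h1 := hd2.isLittleO.def hc
  obtain ⟨δ, hδ, hball⟩ := Metric.eventually_nhds_iff_ball.1 (hd.and h1)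
  filter_upwards [ball_mem_nhds a hδ] with x hx
  have hsub : closedBall a ‖x - a‖ ⊆ ball a δ :=
    closedBall_subset_ball (by rwa [mem_ball_iff_norm] at hx)
  -- By symmetry of `H` the remainder has derivative `fderiv ℝ ρ y - ℓ - H (y - a)`, of norm at most
  -- `c * ‖x - a‖` on the ball; the mean value inequality supplies the second factor.
  set G : E → ℝ := fun y => ρ y - ρ a - ℓ (y - a) - (1 / 2 : ℝ) * H (y - a) (y - a) with hG
  have hGd : ∀ y ∈ closedBall a ‖x - a‖, HasFDerivWithinAt G
      (fderiv ℝ ρ y - ℓ - H (y - a)) (closedBall a ‖x - a‖) y := by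
    intro y hy
    have e0 : HasFDerivAt (fun y => y - a) (ContinuousLinearMap.id ℝ E) y :=
      (hasFDerivAt_id y).sub_const a
    have e1 : HasFDerivAt (fun y => ℓ (y - a)) (ℓ.comp (ContinuousLinearMap.id ℝ E)) y :=
      ℓ.hasFDerivAt.comp y e0
    have e2 : HasFDerivAt (fun y => H (y - a)) (H.comp (ContinuousLinearMap.id ℝ E)) y :=
      H.hasFDerivAt.comp y e0
    have e3 := e2.clm_apply e0
    have e4 := (((hball y (hsub hy)).1.hasFDerivAt.sub_const (ρ a)).sub e1).sub
      (e3.const_mul (1 / 2 : ℝ))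
    refine HasFDerivAt.hasFDerivWithinAt (e4.congr_fderiv ?_)
    ext v
    simp [hsymm v y, hsymm v a]
    ring
  have hbound : ∀ y ∈ closedBall a ‖x - a‖, ‖fderiv ℝ ρ y - ℓ - H (y - a)‖ ≤ c * ‖x - a‖ := by
    intro y hy
    refine (hball y (hsub hy)).2.trans ?_
    rw [mem_closedBall_iff_norm] at hy
    gcongr
  have hx' : x ∈ closedBall a ‖x - a‖ := by rw [mem_closedBall_iff_norm]
  have ha : a ∈ closedBall a ‖x - a‖ := by simp
  have := (convex_closedBall a ‖x - a‖).norm_image_sub_le_of_norm_hasFDerivWithin_le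
    hGd hbound ha hx'
  have hGa : G a = 0 := by simp [hG]
  rw [hGa, sub_zero] at this
  calc _ ≤ c * ‖x - a‖ * ‖x - a‖ := this
    _ = _ := by rw [Real.norm_of_nonneg (by positivity)]; ring

/-! ### The supporting functional given by strict Levi convexity -/

section

/-- The points `(r z, r² ψ(z)) = r • y r` lie in `{ρ = 0}`; the terms of order `r` and `r ^ 2` of
the Taylor expansion along them must vanish separately. -/
theorem quadric_coefficient_of_eventually_eq_zero {ρ : ℂ × ℂ → ℝ} {γ : ℝ}
    (hρ : ContDiffAt ℝ 2 ρ 0) (hS : ∀ᶠ z in 𝓝 (0 : ℂ), ρ (z, (quadric γ z : ℂ)) = 0) (z : ℂ) :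
    fderiv ℝ ρ 0 (z, 0) = 0 ∧
      quadric γ z * fderiv ℝ ρ 0 (0, 1) +
        (1 / 2 : ℝ) * fderiv ℝ (fderiv ℝ ρ) 0 (z, 0) (z, 0) = 0 := by
  set ℓ := fderiv ℝ ρ 0
  set H := fderiv ℝ (fderiv ℝ ρ) 0
  set y : ℝ → ℂ × ℂ := fun r => (z, (r * quadric γ z : ℝ)) with hy
  have hyc : Continuous y := by fun_prop
  have hy0 : y 0 = (z, 0) := by simp [hy]
  have hxt : Tendsto (fun r : ℝ => r • y r) (𝓝[>] 0) (𝓝 0) := by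
    have : Tendsto (fun r : ℝ => r • y r) (𝓝 0) (𝓝 ((0 : ℝ) • y 0)) :=
      Continuous.tendsto (by fun_prop) 0
    rw [zero_smul] at this
    exact this.mono_left nhdsWithin_le_nhds
  have hrz : Tendsto (fun r : ℝ => (r : ℂ) * z) (𝓝[>] 0) (𝓝 0) := tendsto_real_mul_nhds_zero z
  have hρ0 : ρ 0 = 0 := by simpa [quadric_zero, Prod.mk_zero_zero] using hS.self_of_nhds
  have hrem : ∀ᶠ r : ℝ in 𝓝[>] 0, ρ (r • y r) = 0 := by
    filter_upwards [hrz.eventually hS] with r hr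
    have : r • y r = (r * z, (quadric γ (r * z) : ℂ)) := by
      simp only [hy, Prod.smul_mk, Complex.real_smul, quadric_real_mul]
      ext1
      · rfl
      · push_cast; ring
    rw [this, hr]
  have key : Tendsto (fun r : ℝ => (ℓ (y r) + r * ((1 / 2 : ℝ) * H (y r) (y r))) / r) (𝓝[>] 0)
      (𝓝 0) := by
    have h1 := hρ.isLittleO_taylor_two.comp_tendsto hxt
    have hK : (fun r : ℝ => ‖r • y r‖ ^ 2) =O[𝓝[>] 0] fun r : ℝ => r ^ 2 := by
      refine IsBigO.pow ?_ 2
      have : (fun r : ℝ => r • y r) =O[𝓝[>] 0] fun r : ℝ => r • (1 : ℝ) :=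
        (isBigO_refl _ _).smul
          (((hyc.tendsto 0).mono_left nhdsWithin_le_nhds).isBigO_one ℝ)
      simpa using this.norm_left
    have h2 := (h1.trans_isBigO (by simpa [Function.comp_def] using hK)).tendsto_div_nhds_zero
    have h3 := h2.neg
    rw [neg_zero] at h3
    refine h3.congr' ?_
    filter_upwards [hrem, self_mem_nhdsWithin] with r hr hr0
    have hr0' : (0 : ℝ) < r := hr0
    simp only [Function.comp_def, hρ0, hr, sub_zero, map_smul, smul_apply,
      smul_eq_mul]
    field_simp
    ring
  have hid : Tendsto (fun r : ℝ => r) (𝓝[>] 0) (𝓝 0) := tendsto_id.mono_left nhdsWithin_le_nhds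
  have hH : Tendsto (fun r : ℝ => (1 / 2 : ℝ) * H (y r) (y r)) (𝓝[>] 0)
      (𝓝 ((1 / 2 : ℝ) * H (z, 0) (z, 0))) := by
    have : Continuous fun r : ℝ => (1 / 2 : ℝ) * H (y r) (y r) := by fun_prop
    simpa [hy0] using (this.tendsto 0).mono_left nhdsWithin_le_nhds
  have hfirst : ℓ (z, 0) = 0 := by
    have h1 : Tendsto (fun r : ℝ => ℓ (y r) + r * ((1 / 2 : ℝ) * H (y r) (y r))) (𝓝[>] 0)
        (𝓝 (ℓ (z, 0) + 0 * ((1 / 2 : ℝ) * H (z, 0) (z, 0)))) := by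
      refine Tendsto.add ?_ (hid.mul hH)
      have : Continuous fun r : ℝ => ℓ (y r) := by fun_prop
      simpa [hy0] using (this.tendsto 0).mono_left nhdsWithin_le_nhds
    have h2 := key.mul hid
    rw [zero_mul] at h2
    have h3 := tendsto_nhds_unique (h2.congr' (by
      filter_upwards [self_mem_nhdsWithin] with r hr
      exact div_mul_cancel₀ _ (ne_of_gt hr))) h1
    simpa using h3.symm
  refine ⟨hfirst, ?_⟩
  have hsplit : ∀ r : ℝ, ℓ (y r) = r * (quadric γ z * ℓ (0, 1)) := by
    intro r
    have : y r = (z, 0) + (r * quadric γ z) • ((0, 1) : ℂ × ℂ) := by simp [hy]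
    rw [this, map_add, hfirst, map_smul, smul_eq_mul]
    ring
  have h4 : Tendsto (fun r : ℝ => quadric γ z * ℓ (0, 1) + (1 / 2 : ℝ) * H (y r) (y r)) (𝓝[>] 0)
      (𝓝 0) := by
    refine key.congr' ?_
    filter_upwards [self_mem_nhdsWithin] with r hr
    have hr0' : r ≠ 0 := ne_of_gt hr
    rw [hsplit]
    field_simp
  exact tendsto_nhds_unique (hH.const_add _) h4

/-- The inequality satisfied near a quadratic point of `∂M` by the points of a strictly Levi convex
domain `M = {ρ ≤ 0}`. -/
theorem exists_levi_functional {ρ : ℂ × ℂ → ℝ} {γ : ℝ} (hρ : ContDiffAt ℝ 2 ρ 0)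
    (hS : ∀ᶠ z in 𝓝 (0 : ℂ), ρ (z, (quadric γ z : ℂ)) = 0)
    (hlevi : ∀ v : ℂ × ℂ, v ≠ 0 → fderiv ℝ ρ 0 v = 0 → fderiv ℝ ρ 0 (Complex.I • v) = 0 →
        0 < fderiv ℝ (fderiv ℝ ρ) 0 v v +
          fderiv ℝ (fderiv ℝ ρ) 0 (Complex.I • v) (Complex.I • v)) :
    ∃ lam : ℂ →L[ℝ] ℝ, lam 1 = -1 ∧ ∀ ε > 0, ∀ᶠ x in 𝓝 (0 : ℂ × ℂ), ρ x ≤ 0 →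
      lam x.2 + quadric γ x.1 ≤ ε * (‖x.1‖ ^ 2 + ‖x.2‖) := by
  have hq := quadric_coefficient_of_eventually_eq_zero hρ hS
  have hT := hρ.isLittleO_taylor_two
  have hρ0 : ρ 0 = 0 := by simpa [quadric_zero, Prod.mk_zero_zero] using hS.self_of_nhds
  set ℓ := fderiv ℝ ρ 0
  set H := fderiv ℝ (fderiv ℝ ρ) 0
  -- The Hessian at `(z, 0)` is `-2 ψ(z) ℓ (0, 1)`. Because `ψ(1) + ψ(i) = 2`, the Levi form on the
  -- complex line `w = 0` has the sign of `-ℓ (0, 1)`.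
  have hneg : ℓ (0, 1) < 0 := by
    have hI : Complex.I • ((1, 0) : ℂ × ℂ) = (Complex.I * 1, 0) := by simp
    have h1 := hlevi (1, 0) (by simp) (hq 1).1 (by rw [hI]; exact (hq _).1)
    rw [hI] at h1
    have h2 := (hq 1).2
    have h3 := (hq (Complex.I * 1)).2
    have h4 := quadric_add_quadric_I_mul γ 1
    rw [map_one] at h4
    have h5 : quadric γ 1 * ℓ (0, 1) + quadric γ (Complex.I * 1) * ℓ (0, 1) = 2 * ℓ (0, 1) := by
      rw [← add_mul, h4]; ring
    linarith
  set d := -ℓ (0, 1) with hd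
  have hdpos : 0 < d := by linarith
  refine ⟨d⁻¹ • ℓ.comp (ContinuousLinearMap.inr ℝ ℂ ℂ), ?_, fun ε hε => ?_⟩
  · simp only [smul_apply, ContinuousLinearMap.comp_apply,
      ContinuousLinearMap.inr_apply, smul_eq_mul]
    rw [show ℓ (0, 1) = -d by linarith]
    field_simp
  · have hsmall : ∀ᶠ x : ℂ × ℂ in 𝓝 0, ‖H‖ * ‖x‖ < d * ε / 2 := by
      have : Tendsto (fun x : ℂ × ℂ => ‖H‖ * ‖x‖) (𝓝 0) (𝓝 (‖H‖ * ‖(0 : ℂ × ℂ)‖)) :=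
        Continuous.tendsto (by fun_prop) 0
      rw [norm_zero, mul_zero] at this
      exact this.eventually (gt_mem_nhds (by positivity))
    filter_upwards [hT.def (show 0 < d * ε / 2 by positivity), hsmall,
      ball_mem_nhds (0 : ℂ × ℂ) one_pos] with x h1 h2 h3 h4
    obtain ⟨z, w⟩ := x
    simp only [hρ0, sub_zero] at h1
    rw [Real.norm_eq_abs, Real.norm_of_nonneg (by positivity : (0 : ℝ) ≤ ‖(z, w)‖ ^ 2)] at h1
    have h5 := (abs_le.1 h1).1
    have hx : (z, w) = (z, 0) + ((0, w) : ℂ × ℂ) := by simp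
    have hℓ : ℓ (z, w) = ℓ (0, w) := by rw [hx, map_add, (hq z).1, zero_add]
    -- Every second-order term involving `w` is `O(‖x‖ ‖w‖)` and is absorbed in `ε ‖w‖`; the pure
    -- `z` term is `2 d ψ(z)`.
    have hHx : H (z, w) (z, w) = H (z, 0) (z, 0) + (H (z, 0) (0, w) + H (0, w) (z, w)) := by
      have e1 : H (z, w) = H (z, 0) + H (0, w) := by rw [← map_add, ← hx]
      have e2 : H (z, 0) (z, w) = H (z, 0) (z, 0) + H (z, 0) (0, w) := by rw [← map_add, ← hx]
      rw [e1, add_apply, e2, add_assoc]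
    have hz : ‖((z, 0) : ℂ × ℂ)‖ ≤ ‖(z, w)‖ := by simp [Prod.norm_def]
    have hw : ‖((0, w) : ℂ × ℂ)‖ = ‖w‖ := by simp [Prod.norm_def]
    have hc1 : |H (z, 0) (0, w)| ≤ ‖H‖ * ‖(z, w)‖ * ‖w‖ := by
      refine (H.le_opNorm₂ _ _).trans ?_
      rw [hw]; gcongr
    have hc2 : |H (0, w) (z, w)| ≤ ‖H‖ * ‖(z, w)‖ * ‖w‖ := by
      refine (H.le_opNorm₂ _ _).trans_eq ?_
      rw [hw]; ring
    have hc3 : ‖H‖ * ‖(z, w)‖ * ‖w‖ ≤ d * ε / 2 * ‖w‖ :=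
      mul_le_mul_of_nonneg_right h2.le (norm_nonneg _)
    have hn : ‖(z, w)‖ ^ 2 ≤ ‖z‖ ^ 2 + ‖w‖ := by
      rw [mem_ball_zero_iff] at h3
      have hw1 : ‖w‖ ≤ 1 := (le_max_right _ _).trans h3.le
      rcases max_choice ‖z‖ ‖w‖ with h | h
      · rw [Prod.norm_def, h]; nlinarith [norm_nonneg w]
      · rw [Prod.norm_def, h]; nlinarith [norm_nonneg w, sq_nonneg ‖z‖]
    have hc4 : d * ε / 2 * ‖(z, w)‖ ^ 2 ≤ d * ε / 2 * (‖z‖ ^ 2 + ‖w‖) :=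
      mul_le_mul_of_nonneg_left hn (by positivity)
    have hqz := (hq z).2
    rw [show ℓ (0, 1) = -d by linarith] at hqz
    have hfin : ℓ (0, w) + d * quadric γ z ≤ d * (ε * (‖z‖ ^ 2 + ‖w‖)) := by
      have a1 := (abs_le.1 hc1).1
      have a2 := (abs_le.1 hc2).1
      have a3 : 0 ≤ d * ε / 2 * ‖z‖ ^ 2 := by positivity
      rw [hℓ] at h5
      rw [hHx] at h5
      nlinarith
    have hgoal : d⁻¹ * ℓ (0, w) + quadric γ z = d⁻¹ * (ℓ (0, w) + d * quadric γ z) := by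
      field_simp
    change d⁻¹ * ℓ (0, w) + quadric γ z ≤ ε * (‖z‖ ^ 2 + ‖w‖)
    rw [hgoal, inv_mul_le_iff₀ hdpos]
    exact hfin

section

variable {X : Type*} [TopologicalSpace X] [ChartedSpace (ℂ × ℂ) X]
  [IsManifold 𝓘(ℝ, ℂ × ℂ) ∞ X] {J : AlmostComplexStructure X} {M : Set X} {ι : TwoSphere → X}
  {p : X} {Φ : OpenPartialHomeomorph X (ℂ × ℂ)} {γ : ℝ}

/-- Where `ρ < 0` a point is interior to `M`, where `ρ > 0` it is exterior. So `ρ` vanishes on `∂M`,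
in particular on the quadric. -/
theorem IsGoodHyperbolicPoint.exists_levi_functional (hp : IsGoodHyperbolicPoint J M ι p Φ γ)
    (hιM : range ι ⊆ frontier M) :
    ∃ lam : ℂ →L[ℝ] ℝ, lam 1 = -1 ∧ ∀ ε > 0, ∀ᶠ x in 𝓝 (0 : ℂ × ℂ), Φ.symm x ∈ M →
      lam x.2 + quadric γ x.1 ≤ ε * (‖x.1‖ ^ 2 + ‖x.2‖) := by
  obtain ⟨W, ρ, hWo, h0W, hWΦ, hρ, hM, hL⟩ := hp.leviConvex
  have hzero : ∀ x ∈ W, Φ.symm x ∈ frontier M → ρ x = 0 := by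
    intro x hx hfr
    have hs : Φ.symm x ∈ Φ.source := Φ.map_target (hWΦ hx)
    have hΦx : Φ (Φ.symm x) = x := Φ.right_inv (hWΦ hx)
    have hρc : ContinuousAt ρ x := hρ.continuousOn.continuousAt (hWo.mem_nhds hx)
    have hc : Tendsto Φ (𝓝 (Φ.symm x)) (𝓝 x) := by
      have := (Φ.continuousAt hs).tendsto
      rwa [hΦx] at this
    have hW : ∀ᶠ y in 𝓝 (Φ.symm x), y ∈ Φ.source ∧ Φ y ∈ W :=
      (Φ.open_source.eventually_mem hs).and (hc.eventually (hWo.eventually_mem hx))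
    rcases lt_trichotomy (ρ x) 0 with h | h | h
    · refine absurd ?_ hfr.2
      rw [mem_interior_iff_mem_nhds]
      filter_upwards [hW, hc.eventually (hρc.eventually (gt_mem_nhds h))] with y hy hy2
      have := (hM _ hy.2).2 hy2.le
      rwa [Φ.left_inv hy.1] at this
    · exact h
    · refine absurd hfr.1 ?_
      rw [mem_closure_iff_frequently, not_frequently]
      filter_upwards [hW, hc.eventually (hρc.eventually (lt_mem_nhds h))] with y hy hy2 hyM
      rw [← Φ.left_inv hy.1, hM _ hy.2] at hyM
      exact absurd hyM (not_le.2 hy2)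
  have hS : ∀ᶠ z in 𝓝 (0 : ℂ), ρ (z, (quadric γ z : ℂ)) = 0 := by
    have hc : Continuous fun z : ℂ => ((z, (quadric γ z : ℂ)) : ℂ × ℂ) :=
      continuous_id.prodMk (Complex.continuous_ofReal.comp (continuous_quadric γ))
    have hW : ∀ᶠ z in 𝓝 (0 : ℂ), ((z, (quadric γ z : ℂ)) : ℂ × ℂ) ∈ W :=
      hc.continuousAt.eventually (hWo.mem_nhds (by simpa [quadric_zero, Prod.mk_zero_zero] using h0W))
    filter_upwards [hW] with z hz
    refine hzero _ hz (hιM ?_)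
    rw [hp.sphere_eq _ (Φ.map_target (hWΦ hz)), Φ.right_inv (hWΦ hz)]
  have hρ0 : ρ 0 = 0 := by simpa [quadric_zero, Prod.mk_zero_zero] using hS.self_of_nhds
  obtain ⟨lam, h1, h2⟩ := _root_.exists_levi_functional
    (hρ.contDiffAt (hWo.mem_nhds h0W)) hS (hL 0 h0W hρ0).2
  refine ⟨lam, h1, fun ε hε => ?_⟩
  filter_upwards [h2 ε hε, hWo.mem_nhds h0W] with x hx hxW hxM
  exact hx ((hM x hxW).1 hxM)

end

end

/-! ### Good parameters -/

/-- `(a, 1)` is an eigenvector of `τ₁τ₂` with eigenvalue `a ^ 2`; the factor `c` allows iteration.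
-/
theorem tauOne_mul_tauTwo_apply {γ : ℝ} {a b : ℂ} (hab : a * b = 1)
    (hγ : ((2 / γ : ℝ) : ℂ) = -(a + b)) (c : ℂ) :
    (tauOne * tauTwo γ) (c * a, c) = (c * a ^ 2 * a, c * a ^ 2) := by
  have h : (tauOne * tauTwo γ) (c * a, c) =
      ((((2 / γ : ℝ) : ℂ) ^ 2 - 1) * (c * a) + ((2 / γ : ℝ) : ℂ) * c,
        -((2 / γ : ℝ) : ℂ) * (c * a) - c) := by
    change (starRingEnd ℂ (starRingEnd ℂ _), starRingEnd ℂ (starRingEnd ℂ _)) = _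
    simp only [Complex.conj_conj]
  rw [h, hγ]
  ext1
  · simp only
    linear_combination (2 * c * a + c * b) * hab
  · simp only
    linear_combination c * hab

/-- A good parameter `γ` is of the form `-1 / cos α`, where `α` is a rational multiple of `π`. -/
theorem IsGoodParameter.exists_pow_eq_one {γ α : ℝ} (h : IsGoodParameter γ)
    (hα : Real.cos α = -1 / γ) :
    ∃ n : ℕ, 0 < n ∧ Even n ∧ Complex.exp ((α / 2 : ℝ) * Complex.I) ^ n = 1 := by
  obtain ⟨k, hk, ⟨φ⟩⟩ := h
  have : NeZero k := ⟨hk.ne'⟩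
  have : Finite (Subgroup.closure {tauOne, tauTwo γ}) := Finite.of_equiv _ φ.symm.toEquiv
  set τ : Subgroup.closure {tauOne, tauTwo γ} :=
    ⟨tauOne * tauTwo γ, mul_mem (Subgroup.subset_closure (by simp))
      (Subgroup.subset_closure (by simp))⟩
  set N := orderOf τ
  have hN : 0 < N := orderOf_pos τ
  have hτ : (tauOne * tauTwo γ) ^ N = 1 := by
    have := pow_orderOf_eq_one τ
    exact congrArg Subtype.val this
  set a := Complex.exp (α * Complex.I) with ha
  set b := Complex.exp (-α * Complex.I)
  have hab : a * b = 1 := by rw [← Complex.exp_add]; simp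
  have hγ : ((2 / γ : ℝ) : ℂ) = -(a + b) := by
    rw [← Complex.two_cos, ← Complex.ofReal_cos, hα]
    push_cast; ring
  have hpow : ∀ j : ℕ, ((tauOne * tauTwo γ) ^ j) (a, 1) = (a ^ (2 * j) * a, a ^ (2 * j)) := by
    intro j
    induction j with
    | zero => simp
    | succ j ih =>
      rw [pow_succ', Equiv.Perm.mul_apply, ih, tauOne_mul_tauTwo_apply hab hγ]
      ring_nf
  have h1 := hpow N
  rw [hτ] at h1
  have h2 : a ^ (2 * N) = 1 := (congrArg Prod.snd h1).symm
  -- With `a = exp(iα)` one has `exp(iα/2) ^ (4N) = a ^ (2N) = 1`; the exponent is even as well.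
  refine ⟨4 * N, by positivity, ⟨2 * N, by ring⟩, ?_⟩
  rw [show 4 * N = 2 * (2 * N) by ring, pow_mul, ← Complex.exp_nat_mul, ← h2, ha]
  congr 2
  push_cast; ring

theorem exists_angle {γ : ℝ} (hγ : 1 < γ) :
    ∃ α : ℝ, Real.cos α = -1 / γ ∧ Real.pi / 2 < α ∧ α < Real.pi := by
  have h0 : 0 < γ := by linarith
  have h1 : -1 / γ < 0 := div_neg_of_neg_of_pos (by norm_num) h0
  have h2 : -1 < -1 / γ := by
    rw [lt_div_iff₀ h0]; linarith
  refine ⟨Real.arccos (-1 / γ), Real.cos_arccos h2.le (by linarith), ?_, ?_⟩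
  · by_contra h
    have := Real.arccos_le_pi_div_two.1 (not_lt.1 h)
    linarith
  · refine lt_of_le_of_ne (Real.arccos_le_pi _) ?_
    intro h
    exact absurd (Real.arccos_eq_pi.1 h) (not_le.2 h2)

section

/-! ### Complex points of the sphere -/

/-- The differential of a smooth immersion is injective. -/
theorem Manifold.IsImmersionAt.mfderiv_injective {E E' : Type*} [NormedAddCommGroup E]
    [NormedSpace ℝ E] [NormedAddCommGroup E'] [NormedSpace ℝ E'] {Y X : Type*} [TopologicalSpace Y]
    [ChartedSpace E Y] [IsManifold 𝓘(ℝ, E) ∞ Y] [TopologicalSpace X]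
    [ChartedSpace E' X] [IsManifold 𝓘(ℝ, E') ∞ X] {ι : Y → X} {y : Y}
    (h : IsImmersionAt 𝓘(ℝ, E) 𝓘(ℝ, E') ∞ ι y) :
    Function.Injective (mfderiv 𝓘(ℝ, E) 𝓘(ℝ, E') ι y) := by
  have hdom : h.domChart.MDifferentiable 𝓘(ℝ, E) 𝓘(ℝ, E) :=
    ⟨(contMDiffOn_of_mem_maximalAtlas h.domChart_mem_maximalAtlas).mdifferentiableOn (by simp),
      (contMDiffOn_symm_of_mem_maximalAtlas h.domChart_mem_maximalAtlas).mdifferentiableOn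
        (by simp)⟩
  have hcod : MDifferentiableAt 𝓘(ℝ, E') 𝓘(ℝ, E') h.codChart (ι y) :=
    (contMDiffAt_of_mem_maximalAtlas h.codChart_mem_maximalAtlas
      h.mem_codChart_source).mdifferentiableAt (by simp)
  have hι : MDifferentiableAt 𝓘(ℝ, E) 𝓘(ℝ, E') ι y := h.contMDiffAt.mdifferentiableAt (by simp)
  -- In the charts of the immersion `ι` is a linear inclusion, so `P ∘ h.codChart ∘ ι` is
  -- `h.domChart` near `y`; the latter has injective differential, and the chain rule concludes.
  set P : E' →L[ℝ] E :=
    (ContinuousLinearMap.fst ℝ E h.complement).comp (h.equiv.symm : E' →L[ℝ] E × h.complement)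
    with hP
  have hPd : MDifferentiableAt 𝓘(ℝ, E') 𝓘(ℝ, E) P (h.codChart (ι y)) :=
    P.differentiableAt.mdifferentiableAt
  have heq : (fun x => P (h.codChart (ι x))) =ᶠ[𝓝 y] h.domChart := by
    filter_upwards [h.domChart.open_source.mem_nhds h.mem_domChart_source] with x hx
    have hx' : h.domChart x ∈ (h.domChart.extend 𝓘(ℝ, E)).target := by
      simpa using h.domChart.map_source hx
    have := h.writtenInCharts hx'
    simp only [Function.comp_apply, OpenPartialHomeomorph.extend_coe, modelWithCornersSelf_coe,
      id_eq, OpenPartialHomeomorph.extend_coe_symm, modelWithCornersSelf_coe_symm,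
      h.domChart.left_inv hx] at this
    simp [hP, this]
  have hcomp : mfderiv 𝓘(ℝ, E) 𝓘(ℝ, E) h.domChart y =
      (mfderiv 𝓘(ℝ, E') 𝓘(ℝ, E) (P ∘ h.codChart) (ι y)).comp
        (mfderiv 𝓘(ℝ, E) 𝓘(ℝ, E') ι y) := by
    rw [← heq.mfderiv_eq]
    exact mfderiv_comp y (hPd.comp (ι y) hcod) hι
  have hinj := hdom.mfderiv_injective h.mem_domChart_source
  rw [hcomp] at hinj
  exact Function.Injective.of_comp hinj

section

variable {X : Type*} [TopologicalSpace X] [ChartedSpace (ℂ × ℂ) X]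
  [IsManifold 𝓘(ℝ, ℂ × ℂ) ∞ X] {J : AlmostComplexStructure X} {M : Set X} {ι : TwoSphere → X}
  {p : X} {Φ : OpenPartialHomeomorph X (ℂ × ℂ)} {γ : ℝ}

theorem IsHolomorphicChartAt.mdifferentiable (h : IsHolomorphicChartAt J p Φ) :
    Φ.MDifferentiable 𝓘(ℝ, ℂ × ℂ) 𝓘(ℝ, ℂ × ℂ) :=
  ⟨(contMDiffOn_of_mem_maximalAtlas h.mem_atlas).mdifferentiableOn (by simp),
    (contMDiffOn_symm_of_mem_maximalAtlas h.mem_atlas).mdifferentiableOn (by simp)⟩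

theorem hasFDerivAt_quadric_zero (γ : ℝ) : HasFDerivAt (quadric γ) (0 : ℂ →L[ℝ] ℝ) 0 := by
  have h0 : HasFDerivAt (fun z : ℂ => ‖z‖ ^ 2) (0 : ℂ →L[ℝ] ℝ) 0 := by
    have := (hasStrictFDerivAt_norm_sq (0 : ℂ)).hasFDerivAt
    simpa using this
  have h1 : HasFDerivAt (fun z : ℂ => (z ^ 2).re) (0 : ℂ →L[ℝ] ℝ) 0 := by
    have h2 : HasDerivAt (fun z : ℂ => z ^ 2) 0 0 := by simpa using hasDerivAt_pow 2 (0 : ℂ)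
    have h3 := Complex.reCLM.hasFDerivAt.comp (0 : ℂ) (h2.hasFDerivAt.restrictScalars ℝ)
    refine h3.congr_fderiv ?_
    ext
    simp
  have h4 := h0.add (h1.const_mul γ)
  rw [smul_zero, add_zero] at h4
  refine h4.congr_of_eventuallyEq (Eventually.of_forall fun z => ?_)
  simp [quadric, Complex.normSq_eq_norm_sq]

/-- A quadratic complex point of a sphere is not totally real. -/
theorem IsGoodHyperbolicPoint.not_isTotallyRealPoint (hp : IsGoodHyperbolicPoint J M ι p Φ γ)
    (hι : IsSmoothEmbedding (𝓡 2) 𝓘(ℝ, ℂ × ℂ) ∞ ι) : ¬ IsTotallyRealPoint J ι p := by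
  rintro ⟨y, rfl, hy⟩
  have hιd : MDifferentiableAt (𝓡 2) 𝓘(ℝ, ℂ × ℂ) ι y :=
    (hι.contMDiff y).mdifferentiableAt (by simp)
  have hΦd := hp.chart.mdifferentiable.mdifferentiableAt hp.chart.mem_source
  have hΦinj : Function.Injective (coordDeriv Φ (ι y)) :=
    hp.chart.mdifferentiable.mfderiv_injective hp.chart.mem_source
  have hιinj := (hι.isImmersion.isImmersionAt y).mfderiv_injective
  set A : TangentSpace (𝓡 2) y →L[ℝ] ℂ × ℂ := mfderiv (𝓡 2) 𝓘(ℝ, ℂ × ℂ) (Φ ∘ ι) y with hA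
  have hAcomp : ∀ v, A v = coordDeriv Φ (ι y) (mfderiv (𝓡 2) 𝓘(ℝ, ℂ × ℂ) ι y v) := by
    intro v
    rw [hA, mfderiv_comp y hΦd hιd]
    rfl
  have hAinj : Function.Injective A := by
    intro u v huv
    rw [hAcomp, hAcomp] at huv
    exact hιinj (hΦinj huv)
  have hAd : HasMFDerivAt (𝓡 2) 𝓘(ℝ, ℂ × ℂ) (Φ ∘ ι) y A := (hΦd.comp y hιd).hasMFDerivAt
  -- `ψ` has zero differential at `0`, so the tangent plane at `p` is the complex line `w = 0`.
  have hsnd : ∀ v, (A v).2 = 0 := by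
    have h1 : HasFDerivAt (fun x : ℂ × ℂ => x.2 - (quadric γ x.1 : ℂ))
        (ContinuousLinearMap.snd ℝ ℂ ℂ) ((Φ ∘ ι) y) := by
      have e : (Φ ∘ ι) y = 0 := hp.chart.map_eq_zero
      rw [e]
      have h2 : HasFDerivAt (fun x : ℂ × ℂ => (quadric γ x.1 : ℂ))
          (Complex.ofRealCLM.comp ((0 : ℂ →L[ℝ] ℝ).comp (ContinuousLinearMap.fst ℝ ℂ ℂ))) 0 :=
        Complex.ofRealCLM.hasFDerivAt.comp (0 : ℂ × ℂ)
          (HasFDerivAt.comp (g := quadric γ) (f := Prod.fst) (0 : ℂ × ℂ)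
            (hasFDerivAt_quadric_zero γ) hasFDerivAt_fst)
      refine (hasFDerivAt_snd.sub h2).congr_fderiv ?_
      ext <;> simp
    have h3 := h1.hasMFDerivAt.comp y hAd
    have h4 : (fun x : ℂ × ℂ => x.2 - (quadric γ x.1 : ℂ)) ∘ (Φ ∘ ι) =ᶠ[𝓝 y] fun _ => (0 : ℂ) := by
      filter_upwards [hιd.continuousAt.eventually
        (Φ.open_source.mem_nhds hp.chart.mem_source)] with x hx
      simp [(hp.sphere_eq _ hx).1 ⟨x, rfl⟩]
    have h5 := (hasMFDerivAt_const (I := 𝓡 2) (I' := 𝓘(ℝ, ℂ)) (0 : ℂ) y).congr_of_eventuallyEq h4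
    have h6 := hasMFDerivAt_unique h3 h5
    intro v
    exact congrArg (fun L => L v) h6
  set B : TangentSpace (𝓡 2) y →ₗ[ℝ] ℂ := (LinearMap.fst ℝ ℂ ℂ).comp A.toLinearMap with hB
  have hBA : ∀ v, A v = (B v, 0) := fun v => Prod.ext rfl (hsnd v)
  have hBinj : Function.Injective B := by
    intro u v huv
    exact hAinj (by rw [hBA, hBA, huv])
  have hBsurj : Function.Surjective B := by
    have : FiniteDimensional ℝ (TangentSpace (𝓡 2) y) :=
      inferInstanceAs (FiniteDimensional ℝ (EuclideanSpace ℝ (Fin 2)))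
    refine (LinearMap.injective_iff_surjective_of_finrank_eq_finrank ?_).1 hBinj
    change Module.finrank ℝ (EuclideanSpace ℝ (Fin 2)) = _
    simp [Complex.finrank_real_complex]
  obtain ⟨v, hv⟩ := hBsurj 1
  obtain ⟨u, hu⟩ := hBsurj Complex.I
  have h1 : mfderiv (𝓡 2) 𝓘(ℝ, ℂ × ℂ) ι y u =
      J.toFun (ι y) (mfderiv (𝓡 2) 𝓘(ℝ, ℂ × ℂ) ι y v) := by
    apply hΦinj
    rw [hp.chart.map_J _ hp.chart.mem_source, ← hAcomp, ← hAcomp, hBA, hBA, hu, hv]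
    simp
  have h2 := hy u v h1
  have h3 : A u = 0 := by rw [hAcomp, h2, map_zero]
  rw [hBA, hu] at h3
  exact Complex.I_ne_zero (congrArg Prod.fst h3)

end

end

section

/-! ### Hyperbolic discs near a good hyperbolic point -/

section

variable {X : Type*} [TopologicalSpace X] [ChartedSpace (ℂ × ℂ) X]
  [IsManifold 𝓘(ℝ, ℂ × ℂ) ∞ X] {J : AlmostComplexStructure X} {M : Set X} {ι : TwoSphere → X}
  {p : X} {Φ : OpenPartialHomeomorph X (ℂ × ℂ)} {γ : ℝ} {f : ℂ → X}

/-- The differentials of `f` and `Φ` intertwine multiplication by `i`, `J` and multiplication by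
`i`: these are the Cauchy–Riemann equations. -/
theorem IsHyperbolicDisc.differentiableAt_chart_comp (hf : IsHyperbolicDisc J M ι f)
    (hΦ : IsHolomorphicChartAt J p Φ) {ζ : ℂ} (hζ : ζ ∈ ball (0 : ℂ) 1) (hs : f ζ ∈ Φ.source) :
    DifferentiableAt ℂ (fun ζ => Φ (f ζ)) ζ := by
  have hfd : MDifferentiableAt 𝓘(ℝ, ℂ) 𝓘(ℝ, ℂ × ℂ) f ζ :=
    (hf.contMDiffOn.contMDiffAt (isOpen_ball.mem_nhds hζ)).mdifferentiableAt (by simp)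
  have hΦd := hΦ.mdifferentiable.mdifferentiableAt hs
  have hd : DifferentiableAt ℝ (Φ ∘ f) ζ := (hΦd.comp ζ hfd).differentiableAt
  have hL : ∀ v : ℂ, fderiv ℝ (Φ ∘ f) ζ v =
      coordDeriv Φ (f ζ) (mfderiv 𝓘(ℝ, ℂ) 𝓘(ℝ, ℂ × ℂ) f ζ v) := by
    intro v
    rw [← mfderiv_eq_fderiv, mfderiv_comp ζ hΦd hfd]
    rfl
  have key : fderiv ℝ (Φ ∘ f) ζ Complex.I = Complex.I • fderiv ℝ (Φ ∘ f) ζ 1 := by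
    have h1 := hf.holomorphic ζ hζ 1
    rw [mul_one] at h1
    rw [hL, hL, h1, hΦ.map_J _ hs]
  exact differentiableAt_complex_iff_differentiableAt_real.2 ⟨hd, key⟩

theorem IsHyperbolicDisc.tendsto_chart_comp (hf : IsHyperbolicDisc J M ι f)
    (hΦ : IsHolomorphicChartAt J p Φ) {ζ : ℂ} (hζ : ζ ∈ closedBall (0 : ℂ) 1) (hp : f ζ = p) :
    Tendsto (fun ζ => Φ (f ζ)) (𝓝[closedBall 0 1] ζ) (𝓝 0) := by
  have h1 := hf.continuousOn ζ hζ
  have h2 : Tendsto Φ (𝓝 (f ζ)) (𝓝 0) := by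
    rw [← hΦ.map_eq_zero, hp]
    exact Φ.continuousAt hΦ.mem_source
  exact h2.comp h1

theorem IsHyperbolicDisc.eventually_mem_source (hf : IsHyperbolicDisc J M ι f)
    (hΦ : IsHolomorphicChartAt J p Φ) {ζ : ℂ} (hζ : ζ ∈ closedBall (0 : ℂ) 1) (hp : f ζ = p) :
    ∀ᶠ x in 𝓝[closedBall 0 1] ζ, f x ∈ Φ.source :=
  (hf.continuousOn ζ hζ).eventually
    (Φ.open_source.mem_nhds (by rw [hp]; exact hΦ.mem_source))

theorem IsHyperbolicDisc.eventually_levi (hf : IsHyperbolicDisc J M ι f)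
    (hΦ : IsHolomorphicChartAt J p Φ) {lam : ℂ →L[ℝ] ℝ}
    (levi : ∀ ε > 0, ∀ᶠ x in 𝓝 (0 : ℂ × ℂ), Φ.symm x ∈ M →
      lam x.2 + quadric γ x.1 ≤ ε * (‖x.1‖ ^ 2 + ‖x.2‖))
    {ζ : ℂ} (hζ : ζ ∈ closedBall (0 : ℂ) 1) (hp : f ζ = p) {ε : ℝ} (hε : 0 < ε) :
    ∀ᶠ x in 𝓝[closedBall 0 1] ζ, lam (Φ (f x)).2 + quadric γ (Φ (f x)).1 ≤
      ε * (‖(Φ (f x)).1‖ ^ 2 + ‖(Φ (f x)).2‖) := by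
  filter_upwards [(hf.tendsto_chart_comp hΦ hζ hp).eventually (levi ε hε),
    hf.eventually_mem_source hΦ hζ hp, self_mem_nhdsWithin] with x h1 h2 h3
  exact h1 (by rw [Φ.left_inv h2]; exact hf.mapsTo h3)

/-- A hyperbolic disc does not pass through a good hyperbolic point in its interior. -/
theorem IsHyperbolicDisc.ne_of_mem_ball [T2Space X] (hf : IsHyperbolicDisc J M ι f)
    (hp : IsGoodHyperbolicPoint J M ι p Φ γ) (hι : IsSmoothEmbedding (𝓡 2) 𝓘(ℝ, ℂ × ℂ) ∞ ι)
    (hιM : range ι ⊆ frontier M) {ζ : ℂ} (hζ : ζ ∈ ball (0 : ℂ) 1) : f ζ ≠ p := by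
  intro hfζ
  obtain ⟨lam, hlam, levi⟩ := hp.exists_levi_functional hιM
  -- This set is closed in the disc, and open by `eventually_eq_zero_of_levi`. If non-empty, it is
  -- the whole disc, so `f = p` on the circle too; but `p` is not totally real, while all but
  -- finitely many boundary points are.
  set u : Set ℂ := ball 0 1 ∩ {x | f x = p} with hu
  have hcont : ContinuousOn f (ball 0 1) := hf.continuousOn.mono ball_subset_closedBall
  have huo : IsOpen u := by
    rw [isOpen_iff_mem_nhds]
    rintro x ⟨hx, hxp⟩
    have hxp : f x = p := hxp
    have hx' := ball_subset_closedBall hx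
    have hnhds : 𝓝[closedBall 0 1] x = 𝓝 x :=
      nhdsWithin_eq_nhds.2 (mem_of_superset (isOpen_ball.mem_nhds hx) ball_subset_closedBall)
    have hshift : Tendsto (fun t : ℂ => x + t) (𝓝 0) (𝓝 x) := by
      have : Tendsto (fun t : ℂ => x + t) (𝓝 0) (𝓝 (x + 0)) := Continuous.tendsto (by fun_prop) 0
      rwa [add_zero] at this
    have hsrc := hf.eventually_mem_source hp.chart hx' hxp
    rw [hnhds] at hsrc
    have hd : ∀ᶠ t in 𝓝 (0 : ℂ), DifferentiableAt ℂ (fun t => Φ (f (x + t))) t := by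
      filter_upwards [hshift.eventually hsrc, hshift.eventually (isOpen_ball.mem_nhds hx)]
        with t h1 h2
      exact (hf.differentiableAt_chart_comp hp.chart h2 h1).comp t
        ((differentiableAt_const x).add differentiableAt_id)
    have h0 : Φ (f (x + 0)) = 0 := by rw [add_zero, hxp, hp.chart.map_eq_zero]
    have hza : AnalyticAt ℂ (fun t => (Φ (f (x + t))).1) 0 := by
      rw [Complex.analyticAt_iff_eventually_differentiableAt]
      filter_upwards [hd] with t ht using ht.fst
    have hwa : AnalyticAt ℂ (fun t => (Φ (f (x + t))).2) 0 := by
      rw [Complex.analyticAt_iff_eventually_differentiableAt]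
      filter_upwards [hd] with t ht using ht.snd
    have hlevi := fun ε hε => hf.eventually_levi hp.chart levi hx' hxp (ε := ε) hε
    rw [hnhds] at hlevi
    have hzero := eventually_eq_zero_of_levi hza hwa (by rw [h0]; rfl) (by rw [h0]; rfl) hlam
      fun ε hε => hshift.eventually (hlevi ε hε)
    have hback : Tendsto (fun y : ℂ => y - x) (𝓝 x) (𝓝 0) := by
      have : Tendsto (fun y : ℂ => y - x) (𝓝 x) (𝓝 (x - x)) := Continuous.tendsto (by fun_prop) x
      rwa [sub_self] at this
    filter_upwards [hback.eventually hzero, hsrc, isOpen_ball.mem_nhds hx] with y h1 h2 h3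
    rw [add_sub_cancel] at h1
    refine ⟨h3, Φ.injOn h2 hp.chart.mem_source ?_⟩
    rw [hp.chart.map_eq_zero]
    exact Prod.ext h1.1 h1.2
  have hsub : ball (0 : ℂ) 1 ⊆ u := by
    refine (convex_ball (0 : ℂ) 1).isPreconnected.subset_of_closure_inter_subset huo
      ⟨ζ, hζ, hζ, hfζ⟩ ?_
    rintro x ⟨hx, hxb⟩
    refine ⟨hxb, ?_⟩
    have h1 : ContinuousWithinAt f u x :=
      (hcont x hxb).mono inter_subset_left
    have h2 := h1.mem_closure hx (t := {p}) fun y hy => hy.2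
    simpa using h2
  have hcl : ∀ x ∈ closedBall (0 : ℂ) 1, f x = p := by
    intro x hx
    rw [← closure_ball (0 : ℂ) one_ne_zero] at hx
    have h1 : ContinuousWithinAt f (ball 0 1) x :=
      (hf.continuousOn x (by rwa [closure_ball (0 : ℂ) one_ne_zero] at hx)).mono
        ball_subset_closedBall
    simpa using h1.mem_closure hx (t := {p}) fun y hy => (hsub hy).2
  obtain ⟨F, hF, -, -, hreal⟩ := hf.boundary
  have hinf : (sphere (0 : ℂ) 1).Infinite := by
    refine IsPreconnected.infinite_of_nontrivial ?_ ⟨1, by simp, -1, by simp, by norm_num⟩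
    exact isPreconnected_sphere (by rw [Complex.rank_real_complex]; norm_num) 0 1
  obtain ⟨x, hx, hxF⟩ := (hinf.sdiff hF).nonempty
  have h1 := hreal x ⟨hx, hxF⟩
  rw [hcl x (sphere_subset_closedBall hx)] at h1
  exact hp.not_isTotallyRealPoint hι h1

end

end

/-! ### Cayley transform, passage to half discs, and the conclusion -/

section

/-- The Cayley transform, which maps the upper half plane to the unit disc and `0` to `ζ₀`. -/
noncomputable def cayley (ζ₀ t : ℂ) : ℂ := ζ₀ * (1 + Complex.I * t) / (1 - Complex.I * t)

/-- The inverse of the Cayley transform. -/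
noncomputable def cayleyInv (ζ₀ ζ : ℂ) : ℂ := -Complex.I * (ζ - ζ₀) / (ζ + ζ₀)

theorem one_sub_I_mul_ne_zero {t : ℂ} (ht : t ∈ ball (0 : ℂ) 1) : 1 - Complex.I * t ≠ 0 := by
  intro h
  rw [mem_ball_zero_iff] at ht
  have : ‖Complex.I * t‖ = 1 := by rw [← sub_eq_zero.1 h, norm_one]
  rw [norm_mul, Complex.norm_I, one_mul] at this
  linarith

theorem norm_sq_one_sub_I_mul (t : ℂ) :
    ‖1 - Complex.I * t‖ ^ 2 = ‖1 + Complex.I * t‖ ^ 2 + 4 * t.im := by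
  rw [Complex.sq_norm, Complex.sq_norm, Complex.normSq_apply, Complex.normSq_apply]
  simp
  ring

theorem norm_cayley {ζ₀ : ℂ} (h0 : ‖ζ₀‖ = 1) (t : ℂ) :
    ‖cayley ζ₀ t‖ = ‖1 + Complex.I * t‖ / ‖1 - Complex.I * t‖ := by
  rw [cayley, norm_div, norm_mul, h0, one_mul]

theorem cayley_mem_ball_iff {ζ₀ t : ℂ} (h0 : ‖ζ₀‖ = 1) (ht : t ∈ ball (0 : ℂ) 1) :
    cayley ζ₀ t ∈ ball (0 : ℂ) 1 ↔ 0 < t.im := by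
  have h1 := norm_pos_iff.2 (one_sub_I_mul_ne_zero ht)
  rw [mem_ball_zero_iff, norm_cayley h0, div_lt_one h1,
    ← pow_lt_pow_iff_left₀ (norm_nonneg _) (norm_nonneg _) two_ne_zero, norm_sq_one_sub_I_mul]
  constructor <;> intro h <;> linarith

theorem cayley_mem_closedBall {ζ₀ t : ℂ} (h0 : ‖ζ₀‖ = 1) (ht : t ∈ ball (0 : ℂ) 1)
    (him : 0 ≤ t.im) : cayley ζ₀ t ∈ closedBall (0 : ℂ) 1 := by
  have h1 := norm_pos_iff.2 (one_sub_I_mul_ne_zero ht)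
  rw [mem_closedBall_zero_iff, norm_cayley h0, div_le_one h1,
    ← pow_le_pow_iff_left₀ (norm_nonneg _) (norm_nonneg _) two_ne_zero, norm_sq_one_sub_I_mul]
  linarith

theorem cayley_ofReal_mem_sphere {ζ₀ : ℂ} (h0 : ‖ζ₀‖ = 1) {x : ℝ} (hx : (x : ℂ) ∈ ball (0 : ℂ) 1) :
    cayley ζ₀ x ∈ sphere (0 : ℂ) 1 := by
  have h1 := norm_pos_iff.2 (one_sub_I_mul_ne_zero hx)
  have h2 := norm_sq_one_sub_I_mul x
  rw [Complex.ofReal_im, mul_zero, add_zero] at h2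
  rw [mem_sphere_zero_iff_norm, norm_cayley h0,
    ← (pow_left_inj₀ (norm_nonneg _) (norm_nonneg _) two_ne_zero).1 h2, div_self h1.ne']

theorem differentiableAt_cayley (ζ₀ : ℂ) {t : ℂ} (ht : t ∈ ball (0 : ℂ) 1) :
    DifferentiableAt ℂ (cayley ζ₀) t := by
  unfold cayley
  exact DifferentiableAt.div (by fun_prop) (by fun_prop) (one_sub_I_mul_ne_zero ht)

theorem cayley_zero (ζ₀ : ℂ) : cayley ζ₀ 0 = ζ₀ := by simp [cayley]

theorem cayley_cayleyInv {ζ₀ ζ : ℂ} (h0 : ζ₀ ≠ 0) (h : ζ + ζ₀ ≠ 0) :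
    cayley ζ₀ (cayleyInv ζ₀ ζ) = ζ := by
  have h1 : Complex.I * cayleyInv ζ₀ ζ = (ζ - ζ₀) / (ζ + ζ₀) := by
    rw [cayleyInv, ← mul_div_assoc, ← mul_assoc, mul_neg, Complex.I_mul_I, neg_neg, one_mul]
  have h2 : 1 - (ζ - ζ₀) / (ζ + ζ₀) = 2 * ζ₀ / (ζ + ζ₀) := by field_simp; ring
  rw [cayley, h1, h2]
  field_simp
  ring

theorem tendsto_cayleyInv {ζ₀ : ℂ} (h0 : ζ₀ ≠ 0) : Tendsto (cayleyInv ζ₀) (𝓝 ζ₀) (𝓝 0) := by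
  have h : ζ₀ + ζ₀ ≠ 0 := by rw [← two_mul]; exact mul_ne_zero two_ne_zero h0
  have : ContinuousAt (cayleyInv ζ₀) ζ₀ := by
    unfold cayleyInv
    exact ContinuousAt.div (by fun_prop) (by fun_prop) h
  simpa [ContinuousAt, cayleyInv] using this

theorem cayley_image_mem_nhds {ζ₀ : ℂ} (h0 : ζ₀ ≠ 0) {V : Set ℂ} (hV : V ∈ 𝓝 (0 : ℂ)) :
    cayley ζ₀ '' V ∈ 𝓝 ζ₀ := by
  have h : ζ₀ + ζ₀ ≠ 0 := by rw [← two_mul]; exact mul_ne_zero two_ne_zero h0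
  have h1 : ∀ᶠ ζ in 𝓝 ζ₀, ζ + ζ₀ ≠ 0 :=
    ContinuousAt.eventually_ne (g := fun ζ => ζ + ζ₀) (by fun_prop) h
  filter_upwards [(tendsto_cayleyInv h0).eventually hV, h1] with ζ h2 h3
  exact ⟨_, h2, cayley_cayleyInv h0 h3⟩

section

variable {X : Type*} [TopologicalSpace X] [ChartedSpace (ℂ × ℂ) X]
  [IsManifold 𝓘(ℝ, ℂ × ℂ) ∞ X] {J : AlmostComplexStructure X} {M : Set X} {ι : TwoSphere → X}
  {p : X} {Φ : OpenPartialHomeomorph X (ℂ × ℂ)} {γ : ℝ} {f : ℂ → X}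

/-- The Cayley transform turns the circle near `ζ₀` into the real axis. Non-vanishing in the
interior comes from `ne_of_mem_ball`. -/
theorem IsHyperbolicDisc.exists_isBoundaryDisc [T2Space X] (hf : IsHyperbolicDisc J M ι f)
    (hp : IsGoodHyperbolicPoint J M ι p Φ γ) (hι : IsSmoothEmbedding (𝓡 2) 𝓘(ℝ, ℂ × ℂ) ∞ ι)
    (hιM : range ι ⊆ frontier M) {ζ₀ : ℂ} (hζ₀ : ζ₀ ∈ sphere (0 : ℂ) 1) (hζ₀p : f ζ₀ = p) :
    ∃ (lam : ℂ →L[ℝ] ℝ) (r : ℝ), r ≤ 1 ∧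
      (∀ t ∈ ball (0 : ℂ) r, 0 ≤ t.im → f (cayley ζ₀ t) ∈ Φ.source) ∧
      IsBoundaryDisc γ lam (fun t => (Φ (f (cayley ζ₀ t))).1)
        (fun t => (Φ (f (cayley ζ₀ t))).2) r := by
  obtain ⟨lam, hlam, levi⟩ := hp.exists_levi_functional hιM
  have hnorm : ‖ζ₀‖ = 1 := by simpa using hζ₀
  have hζc := sphere_subset_closedBall hζ₀
  have hct : Tendsto (cayley ζ₀) (𝓝[{t : ℂ | 0 ≤ t.im}] 0) (𝓝[closedBall 0 1] ζ₀) := by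
    refine tendsto_nhdsWithin_iff.2 ⟨?_, ?_⟩
    · have := (differentiableAt_cayley ζ₀ (mem_ball_self one_pos)).continuousAt.tendsto
      rw [cayley_zero] at this
      exact this.mono_left nhdsWithin_le_nhds
    · filter_upwards [self_mem_nhdsWithin, nhdsWithin_le_nhds (ball_mem_nhds (0 : ℂ) one_pos)]
        with t h1 h2 using cayley_mem_closedBall hnorm h2 h1
  obtain ⟨r', hr', hsrc'⟩ := Metric.eventually_nhds_iff_ball.1
    (eventually_nhdsWithin_iff.1 (hct.eventually (hf.eventually_mem_source hp.chart hζc hζ₀p)))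
  set r := min r' 1
  have hr : 0 < r := lt_min hr' one_pos
  have hb1 : ball (0 : ℂ) r ⊆ ball 0 1 := ball_subset_ball (min_le_right _ _)
  have hsrc : ∀ t ∈ ball (0 : ℂ) r, 0 ≤ t.im → f (cayley ζ₀ t) ∈ Φ.source := fun t ht him =>
    hsrc' t (ball_subset_ball (min_le_left _ _) ht) him
  have hcont : ContinuousOn (fun t => Φ (f (cayley ζ₀ t))) (ball 0 r ∩ {t | 0 ≤ t.im}) := by
    refine Φ.continuousOn.comp (hf.continuousOn.comp (fun t ht =>
      (differentiableAt_cayley ζ₀ (hb1 ht.1)).continuousAt.continuousWithinAt) ?_) ?_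
    · exact fun t ht => cayley_mem_closedBall hnorm (hb1 ht.1) ht.2
    · exact fun t ht => hsrc t ht.1 ht.2
  have hdiff : ∀ t ∈ ball (0 : ℂ) r ∩ {t | 0 < t.im},
      DifferentiableAt ℂ (fun t => Φ (f (cayley ζ₀ t))) t := by
    rintro t ⟨ht, him⟩
    have him : 0 < t.im := him
    exact (hf.differentiableAt_chart_comp hp.chart ((cayley_mem_ball_iff hnorm (hb1 ht)).2 him)
      (hsrc t ht him.le)).comp t (differentiableAt_cayley ζ₀ (hb1 ht))
  refine ⟨lam, r, min_le_right _ _, hsrc, hr, hcont.fst, hcont.snd,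
    fun t ht => (hdiff t ht).fst.differentiableWithinAt,
    fun t ht => (hdiff t ht).snd.differentiableWithinAt, ?_, ?_, ?_, hlam, ?_⟩
  · simp only [cayley_zero, hζ₀p, hp.chart.map_eq_zero, Prod.fst_zero]
  · intro x hx
    exact (hp.sphere_eq _ (hsrc x hx (by simp))).1
      (hf.mapsTo_sphere (cayley_ofReal_mem_sphere hnorm (hb1 hx)))
  · intro t ht him hz hw
    refine hf.ne_of_mem_ball hp hι hιM ((cayley_mem_ball_iff hnorm (hb1 ht)).2 him)
      (Φ.injOn (hsrc t ht him.le) hp.chart.mem_source ?_)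
    rw [hp.chart.map_eq_zero]
    exact Prod.ext hz hw
  · exact fun ε hε => hct.eventually (hf.eventually_levi hp.chart levi hζc hζ₀p hε)

theorem IsHyperbolicDisc.exists_graph [T2Space X] (hf : IsHyperbolicDisc J M ι f)
    (hp : IsGoodHyperbolicPoint J M ι p Φ γ) (hι : IsSmoothEmbedding (𝓡 2) 𝓘(ℝ, ℂ × ℂ) ∞ ι)
    (hιM : range ι ⊆ frontier M) {ζ₀ : ℂ} (hζ₀ : ζ₀ ∈ sphere (0 : ℂ) 1) (hζ₀p : f ζ₀ = p) :
    ∃ (V D : Set ℂ) (g : ℂ → ℂ),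
      V ∈ 𝓝 ζ₀ ∧ MapsTo f (V ∩ ball 0 1) Φ.source ∧
      IsHolomorphicGraph ((fun ζ => Φ (f ζ)) '' (V ∩ ball 0 1)) D g ∧
      HasPuiseuxExpansion D g ∧
      (IsAsymptoticToSector D (admissibleSector γ 1) ∨
        IsAsymptoticToSector D (admissibleSector γ (-1))) ∧
      IsC2UpToBoundary D g := by
  obtain ⟨lam, r, hr1, hsrc, hdisc⟩ := hf.exists_isBoundaryDisc hp hι hιM hζ₀ hζ₀p
  obtain ⟨α, hα, hα₁, hα₂⟩ := exists_angle hp.one_lt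
  obtain ⟨n, hn0, hn, he⟩ := hp.good.exists_pow_eq_one hα
  obtain ⟨V, hV, hVr, D, g, h1, h2, h3, h4⟩ :=
    hdisc.exists_graph hp.one_lt hα hα₁ hα₂ hn hn0 he
  have hnorm : ‖ζ₀‖ = 1 := by simpa using hζ₀
  have hne : ζ₀ ≠ 0 := norm_ne_zero_iff.1 (by rw [hnorm]; exact one_ne_zero)
  have hVb : V ⊆ ball 0 1 := hVr.trans (ball_subset_ball hr1)
  have himage : cayley ζ₀ '' V ∩ ball 0 1 = cayley ζ₀ '' (V ∩ {t | 0 < t.im}) := by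
    ext ζ
    constructor
    · rintro ⟨⟨t, ht, rfl⟩, hb⟩
      exact ⟨t, ⟨ht, (cayley_mem_ball_iff hnorm (hVb ht)).1 hb⟩, rfl⟩
    · rintro ⟨t, ⟨ht, him⟩, rfl⟩
      exact ⟨⟨t, ht, rfl⟩, (cayley_mem_ball_iff hnorm (hVb ht)).2 him⟩
  refine ⟨cayley ζ₀ '' V, D, g, cayley_image_mem_nhds hne hV, ?_, ?_, h2, h3, h4⟩
  · rw [himage]
    rintro _ ⟨t, ⟨ht, him⟩, rfl⟩
    exact hsrc t (hVr ht) (le_of_lt him)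
  · rw [himage, image_image]
    exact h1

end

end

theorem mainTheorem5 {X : Type*} [TopologicalSpace X] [T2Space X] [ChartedSpace (ℂ × ℂ) X]
    [IsManifold 𝓘(ℝ, ℂ × ℂ) ∞ X] (J : AlmostComplexStructure X) (M : Set X)
    (ι : TwoSphere → X) (hι : IsSmoothEmbedding (𝓡 2) 𝓘(ℝ, ℂ × ℂ) ∞ ι)
    (hιM : range ι ⊆ frontier M)
    (p : X) (Φ : OpenPartialHomeomorph X (ℂ × ℂ)) (γ : ℝ)
    (hp : IsGoodHyperbolicPoint J M ι p Φ γ)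
    (f : ℂ → X) (hf : IsHyperbolicDisc J M ι f) :
    ∃ (V D : ℂ → Set ℂ) (g : ℂ → ℂ → ℂ),
      (∀ ζ₀ ∈ sphere (0 : ℂ) 1, f ζ₀ = p →
        V ζ₀ ∈ 𝓝 ζ₀ ∧ MapsTo f (V ζ₀ ∩ ball 0 1) Φ.source ∧
        IsHolomorphicGraph ((fun ζ => Φ (f ζ)) '' (V ζ₀ ∩ ball 0 1)) (D ζ₀) (g ζ₀) ∧
        HasPuiseuxExpansion (D ζ₀) (g ζ₀) ∧
        (IsAsymptoticToSector (D ζ₀) (admissibleSector γ 1) ∨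
          IsAsymptoticToSector (D ζ₀) (admissibleSector γ (-1))) ∧
        IsC2UpToBoundary (D ζ₀) (g ζ₀)) ∧
      ∃ N ∈ 𝓝 p, ∀ ζ ∈ ball (0 : ℂ) 1, f ζ ∈ N →
        ∃ ζ₀ ∈ sphere (0 : ℂ) 1, f ζ₀ = p ∧ ζ ∈ V ζ₀ := by
  have hex : ∀ ζ₀ : ℂ, ∃ (V D : Set ℂ) (g : ℂ → ℂ), ζ₀ ∈ sphere (0 : ℂ) 1 → f ζ₀ = p →
      V ∈ 𝓝 ζ₀ ∧ MapsTo f (V ∩ ball 0 1) Φ.source ∧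
      IsHolomorphicGraph ((fun ζ => Φ (f ζ)) '' (V ∩ ball 0 1)) D g ∧
      HasPuiseuxExpansion D g ∧
      (IsAsymptoticToSector D (admissibleSector γ 1) ∨
        IsAsymptoticToSector D (admissibleSector γ (-1))) ∧
      IsC2UpToBoundary D g := by
    intro ζ₀
    by_cases h : ζ₀ ∈ sphere (0 : ℂ) 1 ∧ f ζ₀ = p
    · obtain ⟨V, D, g, hV⟩ := hf.exists_graph hp hι hιM h.1 h.2
      exact ⟨V, D, g, fun _ _ => hV⟩
    · exact ⟨∅, ∅, 0, fun h1 h2 => absurd ⟨h1, h2⟩ h⟩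
  choose V D g hV using hex
  refine ⟨V, D, g, hV, ?_⟩
  -- Removing `U` from the closed disc leaves a compact set with no preimage of `p`, since all such
  -- preimages lie on the circle. Its image is closed, `X` being Hausdorff, and `N` is the
  -- complement.
  set U : Set ℂ := ⋃ ζ₀ ∈ {ζ₀ | ζ₀ ∈ sphere (0 : ℂ) 1 ∧ f ζ₀ = p}, interior (V ζ₀) with hU
  have hUo : IsOpen U := isOpen_biUnion fun _ _ => isOpen_interior
  have hK : IsCompact (f '' (closedBall 0 1 \ U)) :=
    ((isCompact_closedBall (0 : ℂ) 1).diff hUo).image_of_continuousOn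
      (hf.continuousOn.mono sdiff_subset)
  refine ⟨(f '' (closedBall 0 1 \ U))ᶜ, hK.isClosed.isOpen_compl.mem_nhds ?_, ?_⟩
  · rintro ⟨ζ, ⟨hζ, hζU⟩, hζp⟩
    have hsph : ζ ∈ sphere (0 : ℂ) 1 := by
      by_contra hs
      refine hf.ne_of_mem_ball hp hι hιM ?_ hζp
      rw [mem_closedBall] at hζ
      exact lt_of_le_of_ne hζ hs
    exact hζU (mem_biUnion (show ζ ∈ {ζ₀ | ζ₀ ∈ sphere (0 : ℂ) 1 ∧ f ζ₀ = p} from ⟨hsph, hζp⟩)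
      (mem_interior_iff_mem_nhds.2 (hV ζ hsph hζp).1))
  · intro ζ hζ hfN
    by_cases hζU : ζ ∈ U
    · obtain ⟨ζ₀, h0, h1⟩ := mem_iUnion₂.1 hζU
      exact ⟨ζ₀, h0.1, h0.2, interior_subset h1⟩
    · exact absurd ⟨ζ, ⟨ball_subset_closedBall hζ, hζU⟩, rfl⟩ hfN
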